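/- **Setting.** Let $1\le n\le d$ be integers and let $P=(P_1,\dots,P_n)$ be real quadratic forms on $\mathbb R^d$. For $\delta=2^{-k}$, $k\in\mathbb N$, let $\mathrm{Part}(\delta)$ be the set of closed dyadic cubes $\theta=a+\delta[0,1]^d$ of side $\delta$ in $[0,1]^d$. For a constant $C$ and $\theta=a+\delta[0,1]^d\in \mathrm{Part}(\delta)$ put $$\mathcal U_\theta=\{(a+\delta u,\;P(a)+\nabla P(a)^{T}\delta u+\delta^2 v): u\in[-C,C]^d,\ v\in[-C,C]^n\}\subset\mathbb R^{d+n}.$$ Below, $f_\theta$ denotes an arbitrary function in $L^p(\mathbb R^{d+n})$ whose (distributional) Fourier transform is supported in $\mathcal U_\theta$. The decoupling constant $\mathrm{Dec}^p(\delta)$ is the smallest constant such that $\|\sum_{\theta\in \mathrm{Part}(\delta)}f_\theta\|_p\le \mathrm{Dec}^p(\delta)\,(\sum_\theta\|f_\theta\|_p^p)^{1/p}$ for all such $f_\theta$. A hyperplane $\mathcal H\ni 0$ of $\mathbb R^d$ can be written as a graph $t_i=\mathcal L(t')$, $t'=(t_l)_{l\ne i}$, where $\mathcal L$ is a linear form with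 coefficients in $[-1,1]$; $\mathrm{Dec}^p_{\mathcal H}(\delta)$ is the decoupling constant, with the same parameter $C$, of the forms $P_j(t',\mathcal L(t'))$ on $\mathbb R^{d-1}$. For $\sigma>0$, $N_\sigma(E)$ is the (open, Euclidean) $\sigma$-neighbourhood of $E$, and $Z_Q$ is the real zero set of a polynomial $Q$. Cubes are called disjoint if their interiors are disjoint. The parameter $C$ is fixed and sufficiently large: there is $C_0$, depending only on $d,n,P$, such that everything below holds for every $C\ge C_0$. Let $1\le p<\infty$ and $\Lambda\in\mathbb R$. **Hypothesis.** $\mathrm{Dec}^p_{\mathcal H}(\delta)\lesssim\delta^{-\Lambda}$ for all $\delta\in 2^{-\mathbb N}$, uniformly in all hyperplanes $\mathcal H$ through $0$ (and all their representations as above). **Theorem.** Assume the Hypothesis. For all integers $D\ge1$, all real $A>1$ and every sufficiently large $K$ there exist $$1\le K_1\le K_2\le\dots\le K_{D+1}=K,\qquad K_{j+1}\sim K_j^{A+1},\qquad K_j^A\in 2^{\mathbb N}\quad(1\le j\le D),$$ where the constants in $\sim$ depend only on $d,n,j$, such that for every non-zero polynomial $Q$ in $d$ real variables of degree at most $D$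 there exist collections $\mathcal G_j\subset\mathrm{Part}(1/K_j^A)$, $j=1,\dots,D$, all of whose cubes are pairwise disjoint (also for different $j$), with $$N_{1/K}(Z_Q)\cap[0,1]^d\subset\bigcup_{j=1}^D\bigcup_{\Box\in\mathcal G_j}\Box$$ and such that for every $\epsilon>0$, every $j$ and all $f_\Box$ $$\Big\|\sum_{\Box\in\mathcal G_j}f_\Box\Big\|_p\lesssim_{D,\epsilon}K_j^d\,(K_j^{A-1})^{\Lambda+\epsilon}\Big(\sum_{\Box\in\mathcal G_j}\|f_\Box\|_p^p\Big)^{1/p}.$$ The implicit constant depends only on $D,\epsilon$ and on the fixed data $d,n,P,C,p,\Lambda$; in particular not on $A,K,Q,j$. **Corollary.** Assume the Hypothesis. For every integer $D\ge1$ and $\epsilon>0$ there is $c>0$, depending only on $D,\epsilon,d,n$, such that for every sufficiently large $K$ there exist $$K^c\le\tilde K_1\le\dots\le\tilde K_D\le\sqrt K,\qquad \tilde K_j\in 2^{\mathbb N},$$ such that for every non-zero polynomial $Q$ in $d$ real variables of degree at most $D$ there exist collections $\mathcal G_j\subset\mathrm{Part}(1/\tilde K_j)$, $j=1,\dots,D$,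 all of whose cubes are pairwise disjoint (also for different $j$), with $N_{1/K}(Z_Q)\cap[0,1]^d\subset\bigcup_{j=1}^D\bigcup_{\Box\in\mathcal G_j}\Box$ and, for every $j$ and all $f_\Box$, $$\Big\|\sum_{\Box\in\mathcal G_j}f_\Box\Big\|_p\lesssim_{D,\epsilon}\tilde K_j^{\Lambda+\epsilon}\Big(\sum_{\Box\in\mathcal G_j}\|f_\Box\|_p^p\Big)^{1/p},$$ with an implicit constant depending only on $D,\epsilon$ and the fixed data. -/

import Mathlib

open MeasureTheory
open scoped ENNReal FourierTransform SchwartzMap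

noncomputable section

namespace QuadDecoupling

/-- The space `ℝ^{d+n}`, where `d` is the cardinality of `ι`, with Euclidean norm and Lebesgue
measure; a point is a pair `(t, y)` with `t ∈ ℝ^d`, `y ∈ ℝ^n`. -/
abbrev Ambient (ι : Type) (n : ℕ) : Type := EuclideanSpace ℝ (ι ⊕ Fin n)

/-- The set `Part(2^{-k})` of dyadic cubes of side length `2^{-k}` in `[0,1]^d`: the index `θ`
stands for the cube with corner `2^{-k} θ`. -/
abbrev DyadicCube (ι : Type) (k : ℕ) : Type := ι → Fin (2 ^ k)

/-- The corner `a` of the cube `a + 2^{-k} [0,1]^d`. -/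
def corner {ι : Type} {k : ℕ} (θ : DyadicCube ι k) : ι → ℝ := fun i => ((θ i : ℕ) : ℝ) / 2 ^ k

/-- The closed cube `a + 2^{-k} [0,1]^d` as a set of points. -/
def cubeSet {ι : Type} {k : ℕ} (θ : DyadicCube ι k) : Set (EuclideanSpace ℝ ι) :=
  {t | ∀ i, corner θ i ≤ t i ∧ t i ≤ corner θ i + 1 / 2 ^ k}

/-- The parallelepiped
`U_θ = {(a + δ u, P(a) + ∇P(a)ᵀ (δ u) + δ² v) : u ∈ [-C,C]^d, v ∈ [-C,C]^n}`
for the cube `θ = a + δ [0,1]^d`, `δ = 2^{-k}`. The directional derivative of the quadratic form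
`P j` at `a` in the direction `h` is its polar form `P j (a + h) - P j a - P j h`. -/
def uncertaintyBox {ι : Type} {n k : ℕ} (P : Fin n → QuadraticForm ℝ (ι → ℝ)) (C : ℝ)
    (θ : DyadicCube ι k) : Set (Ambient ι n) :=
  {z | ∃ (u : ι → ℝ) (v : Fin n → ℝ), (∀ i, |u i| ≤ C) ∧ (∀ j, |v j| ≤ C) ∧
    (∀ i, z (Sum.inl i) = corner θ i + 1 / 2 ^ k * u i) ∧
    (∀ j, z (Sum.inr j) = P j (corner θ)
      + QuadraticMap.polar (P j) (corner θ) ((1 / 2 ^ k : ℝ) • u) + (1 / 2 ^ k) ^ 2 * v j)}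

/-- The support of the Fourier transform of `f ∈ L^p(ℝ^{d+n})`, as a tempered distribution. -/
def fourierSupport {ι : Type} [Fintype ι] {n : ℕ} {p : ℝ≥0∞} [Fact (1 ≤ p)]
    (f : Lp ℂ p (volume : Measure (Ambient ι n))) : Set (Ambient ι n) :=
  Distribution.dsupport ⇑(𝓕 (Lp.toTemperedDistribution f) : 𝓢'(Ambient ι n, ℂ))

/-- The `ℓ^p L^p` decoupling inequality with constant `M` for the family of cubes `G`:
`‖∑_{θ ∈ G} f_θ‖_p ≤ M (∑_{θ ∈ G} ‖f_θ‖_p^p)^{1/p}` for all `f_θ ∈ L^p(ℝ^{d+n})` whose Fourier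
transform (as a tempered distribution) is supported in `U_θ`. -/
def Decouples {ι : Type} [Fintype ι] {n k : ℕ} (P : Fin n → QuadraticForm ℝ (ι → ℝ)) (C : ℝ)
    (p : ℝ≥0∞) [Fact (1 ≤ p)] (G : Finset (DyadicCube ι k)) (M : ℝ) : Prop :=
  ∀ f : DyadicCube ι k → Lp ℂ p (volume : Measure (Ambient ι n)),
    (∀ θ ∈ G, fourierSupport (f θ) ⊆ uncertaintyBox P C θ) →
    ‖∑ θ ∈ G, f θ‖ ≤ M * (∑ θ ∈ G, ‖f θ‖ ^ p.toReal) ^ (1 / p.toReal)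

/-- The decoupling constant `Dec^p(2^{-k})`: the smallest `M ≥ 0` for which the decoupling
inequality holds for the family of all dyadic cubes of side length `2^{-k}` in `[0,1]^d`. -/
def decConst {ι : Type} [Fintype ι] [DecidableEq ι] {n : ℕ}
    (P : Fin n → QuadraticForm ℝ (ι → ℝ)) (C : ℝ) (p : ℝ≥0∞) [Fact (1 ≤ p)] (k : ℕ) : ℝ :=
  sInf {M : ℝ | 0 ≤ M ∧ Decouples P C p (Finset.univ : Finset (DyadicCube ι k)) M}

/-- For finite `p` the infimum defining the decoupling constant is a minimum. -/
theorem isLeast_decConst {ι : Type} [Fintype ι] [DecidableEq ι] {n : ℕ}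
    (P : Fin n → QuadraticForm ℝ (ι → ℝ)) (C : ℝ) (p : ℝ≥0∞) [Fact (1 ≤ p)] (hp : p ≠ ∞)
    (k : ℕ) :
    IsLeast {M : ℝ | 0 ≤ M ∧ Decouples P C p (Finset.univ : Finset (DyadicCube ι k)) M}
      (decConst P C p k) := by
  have hp1 : (1 : ℝ≥0∞) ≤ p := Fact.out
  have hp0 : 0 < p.toReal := ENNReal.toReal_pos (by positivity) hp
  have hb : BddBelow {M : ℝ | 0 ≤ M ∧
      Decouples P C p (Finset.univ : Finset (DyadicCube ι k)) M} := ⟨0, fun M hM => hM.1⟩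
  refine ⟨IsClosed.csInf_mem ?_ ?_ hb, fun M hM => csInf_le hb hM⟩
  · have : {M : ℝ | 0 ≤ M ∧ Decouples P C p (Finset.univ : Finset (DyadicCube ι k)) M}
        = Set.Ici 0 ∩ ⋂ (f : DyadicCube ι k → Lp ℂ p (volume : Measure (Ambient ι n)))
          (_ : ∀ θ ∈ Finset.univ, fourierSupport (f θ) ⊆ uncertaintyBox P C θ),
          {M : ℝ | ‖∑ θ, f θ‖ ≤ M * (∑ θ, ‖f θ‖ ^ p.toReal) ^ (1 / p.toReal)} := by
      ext M
      simp [Decouples]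
    rw [this]
    refine isClosed_Ici.inter (isClosed_iInter fun f => isClosed_iInter fun _ => ?_)
    exact isClosed_le continuous_const (by fun_prop)
  · refine ⟨(Fintype.card (DyadicCube ι k) : ℝ), by positivity, fun f _ => ?_⟩
    calc ‖∑ θ, f θ‖ ≤ ∑ θ, ‖f θ‖ := norm_sum_le _ _
      _ ≤ ∑ _θ : DyadicCube ι k, (∑ θ, ‖f θ‖ ^ p.toReal) ^ (1 / p.toReal) := by
        refine Finset.sum_le_sum fun θ _ => ?_
        rw [one_div, Real.le_rpow_inv_iff_of_pos (norm_nonneg _) (by positivity) hp0]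
        exact Finset.single_le_sum (f := fun θ => ‖f θ‖ ^ p.toReal)
          (fun _ _ => by positivity) (Finset.mem_univ θ)
      _ = _ := by simp

/-- The parametrisation `t' ↦ (t', L(t'))` of the hyperplane `t_i = L(t') = ∑_{l ≠ i} b_l t_l`
through `0`, where `t' = (t_l)_{l ≠ i}`. -/
def graphMap {ι : Type} [Fintype ι] [DecidableEq ι] (i : ι) (b : {l : ι // l ≠ i} → ℝ) :
    ({l : ι // l ≠ i} → ℝ) →ₗ[ℝ] (ι → ℝ) :=
  LinearMap.pi fun k =>
    if h : k = i then ∑ l, b l • LinearMap.proj l else LinearMap.proj ⟨k, h⟩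

/-- Lower-dimensional decoupling with exponent `Λ`: `Dec_H^p(δ) ≤ B δ^{-Λ}` for all dyadic `δ`,
uniformly in the hyperplanes `H ∋ 0`. Every such hyperplane is a graph `t_i = ∑_{l ≠ i} b_l t_l`
with `|b_l| ≤ 1` (take for `i` a largest entry of a normal vector), and `Dec_H^p` is the decoupling
constant of the forms `P_j(t', L(t'))` on `ℝ^{d-1}`. -/
def LowerDimDecoupling {ι : Type} [Fintype ι] [DecidableEq ι] {n : ℕ}
    (P : Fin n → QuadraticForm ℝ (ι → ℝ)) (C : ℝ) (p : ℝ≥0∞) [Fact (1 ≤ p)] (Λ : ℝ) : Prop :=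
  ∃ B : ℝ, ∀ (i : ι) (b : {l : ι // l ≠ i} → ℝ), (∀ l, |b l| ≤ 1) →
    ∀ k : ℕ, decConst (fun j => (P j).comp (graphMap i b)) C p k
      ≤ B * ((1 / 2 ^ k : ℝ)) ^ (-Λ)

/-- The real zero set of a polynomial in `d` variables. -/
def zeroSet {d : ℕ} (Q : MvPolynomial (Fin d) ℝ) : Set (EuclideanSpace ℝ (Fin d)) :=
  {x | MvPolynomial.eval (fun i => x i) Q = 0}

/-- The families `G_j ⊂ Part(2^{-k_j})`, `j = 1, …, D`, consist of pairwise disjoint cubes (also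
across different `j`; disjointness of closed dyadic cubes means disjointness of their interiors),
and together they cover `N_{1/K}(Z_Q) ∩ [0,1]^d`. -/
def DisjointCover {d : ℕ} (Q : MvPolynomial (Fin d) ℝ) (K : ℝ) (D : ℕ) (k : ℕ → ℕ)
    (G : (j : ℕ) → Finset (DyadicCube (Fin d) (k j))) : Prop :=
  (∀ j ∈ Finset.Icc 1 D, ∀ j' ∈ Finset.Icc 1 D, ∀ θ ∈ G j, ∀ θ' ∈ G j',
    (⟨j, θ⟩ : Σ j, DyadicCube (Fin d) (k j)) ≠ ⟨j', θ'⟩ →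
      Disjoint (interior (cubeSet θ)) (interior (cubeSet θ'))) ∧
  Metric.thickening (1 / K) (zeroSet Q) ∩ {x | ∀ i, x i ∈ Set.Icc (0 : ℝ) 1}
    ⊆ ⋃ j ∈ Finset.Icc 1 D, ⋃ θ ∈ G j, cubeSet θ

end QuadDecoupling

end

/-! The zero set of a polynomial is treated as flat wherever it is regular, and the singular part is
passed on to derivatives. Take scales with K_{j+1} ≥ K_j^{A+1}. A point within 1/K_{D+1} of Z_Q
either stays at distance at least 1/K_D from the zeros of all nonzero first and second derivatives
of Q, or is within 1/K_D of the zeros of one of them; in the second case the argument is repeated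
with that derivative. Degrees drop and nonzero constants have no zeros, so the process stops: for
some j the point is within 1/K_{j+1} of Z_q and 1/K_j-far from the zeros of the derivatives of q
(`exists_nearRegularZero`). The number of polynomials q that occur is bounded in terms of d and D,
so handling them one at a time costs a constant (`DecouplesPow.of_cover`). Keeping only maximal
dyadic cubes makes the families disjoint (`exists_disjointCover`).

Flatness comes from monotonicity. If neither g nor its first derivatives change sign on a cube, then
|g| decreases from the centre into one of the orthants, so the value at the centre bounds |g| there
and hence bounds all coefficients of g (`exists_coeff_le_eval_zero`). With g = ∂_l q, the gradient
of q at a zero controls every coefficient of q, and Z_q stays within O(r²/ρ) of its tangent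
hyperplane at distance r from that zero, ρ being the size of the regular cube (`exists_hyperplane`).

Near a hyperplane the lower-dimensional inequality applies on slices: freezing the physical variable
dual to t_i projects the spectrum along t_i, onto the surface of the restricted forms
(`IsOrthogonalSplitting.ae_spectrumIn`). A parabolic rescaling reduces a small cube and an affine
hyperplane to the unit cube and a hyperplane through 0 (`lpPow_sum_le_of_hyperplane`). From scale
about 1/K_j down to 1/K_j^A this is iterated in steps of ratio 2^{-e}; the number of steps depends
only on d and ε, so the constants lost at each step are harmless. The coarse levels, where nothing
is known, are decoupled by the triangle inequality and cost K_j^d; a few extreme levels are treated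
in the same way and cost the ε in the exponent (`exists_decouplesPow_of_nearRegularZero`).

The corollary is the theorem for √K with A so large that K_j^d is at most (K_j^A)^{ε/2}. -/

noncomputable section

namespace QuadDecoupling

open Filter Topology

/-! ### Distributions and test functions supported off their support -/

section Support

variable {E : Type*} [NormedAddCommGroup E] [NormedSpace ℝ E] [FiniteDimensional ℝ E]

/-- Every Schwartz function is a limit of compactly supported ones, whose supports lie in its own
support. -/
theorem exists_compactSupport_tendsto (φ : 𝓢(E, ℂ)) :
    ∃ u : ℕ → 𝓢(E, ℂ), (∀ m, HasCompactSupport (u m)) ∧ (∀ m, tsupport (u m) ⊆ tsupport φ) ∧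
      Tendsto u atTop (𝓝 φ) := by
  let χ : ContDiffBump (0 : E) := ⟨1, 2, one_pos, one_lt_two⟩
  have hχ : ContDiff ℝ (⊤ : ℕ∞) (fun x => (χ x : ℂ)) := Complex.ofRealCLM.contDiff.comp χ.contDiff
  have hχc : HasCompactSupport (fun x => (χ x : ℂ)) :=
    χ.hasCompactSupport.comp_left (g := fun t : ℝ => (t : ℂ)) rfl
  have hpos : ∀ m : ℕ, (0 : ℝ) < ((m : ℝ) + 1)⁻¹ := fun m => by positivity
  have hcomp : ∀ m : ℕ, HasCompactSupport (fun x : E => (χ (((m : ℝ) + 1)⁻¹ • x) : ℂ)) :=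
    fun m => hχc.comp_smul (hpos m).ne'
  have hsm : ∀ m : ℕ, ContDiff ℝ (⊤ : ℕ∞) (fun x : E => (χ (((m : ℝ) + 1)⁻¹ • x) : ℂ)) :=
    fun m => hχ.comp (contDiff_const_smul _)
  let u : ℕ → 𝓢(E, ℂ) := fun m => HasCompactSupport.toSchwartzMap
    (f := fun x => (χ (((m : ℝ) + 1)⁻¹ • x) : ℂ) * φ x) ((hcomp m).mul_right)
    ((hsm m).mul (φ.smooth ⊤))
  refine ⟨u, fun m => (hcomp m).mul_right, fun m => tsupport_mul_subset_right, ?_⟩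
  set η : E → ℂ := fun x => (χ x : ℂ) - 1 with hη
  have hηs : ContDiff ℝ (⊤ : ℕ∞) η := hχ.sub contDiff_const
  have hηb : ∀ i : ℕ, ∃ B : ℝ, 0 ≤ B ∧ ∀ x, ‖iteratedFDeriv ℝ i η x‖ ≤ B := by
    intro i
    let ψ : 𝓢(E, ℂ) := HasCompactSupport.toSchwartzMap hχc hχ
    obtain ⟨B, hB, hB'⟩ := ψ.decay 0 i
    refine ⟨B + 1, by positivity, fun x => ?_⟩
    have h1 : iteratedFDeriv ℝ i η x = iteratedFDeriv ℝ i (fun x => (χ x : ℂ)) x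
        - iteratedFDeriv ℝ i (fun _ : E => (1 : ℂ)) x :=
      iteratedFDeriv_sub_apply ((hχ.of_le (by exact_mod_cast le_top)).contDiffAt)
        contDiff_const.contDiffAt
    rw [h1]
    refine (norm_sub_le _ _).trans (add_le_add (by simpa using! hB' x) ?_)
    rcases Nat.eq_zero_or_pos i with rfl | hi
    · simp
    · rw [iteratedFDeriv_const_of_ne hi.ne']; simp
  choose B hB0 hB using hηb
  rw [(schwartz_withSeminorms ℝ E ℂ).tendsto_nhds]
  rintro ⟨k, n⟩ ε hε
  choose Dφ hD0 hD using fun i : ℕ => φ.decay (k + 1) i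
  set S : ℝ := ∑ i ∈ Finset.range (n + 1), (n.choose i : ℝ) * B i * Dφ (n - i) with hS
  have hS0 : 0 ≤ S := Finset.sum_nonneg fun i _ =>
    mul_nonneg (mul_nonneg (by positivity) (hB0 i)) (hD0 _).le
  have key : ∀ m : ℕ, SchwartzMap.seminorm ℝ k n (u m - φ) ≤ S * ((m : ℝ) + 1)⁻¹ := by
    intro m
    refine SchwartzMap.seminorm_le_bound ℝ k n _ (mul_nonneg hS0 (hpos m).le) fun x => ?_
    have hfun : ⇑(u m - φ) = fun x => η (((m : ℝ) + 1)⁻¹ • x) * φ x := by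
      ext x
      simp only [sub_apply, hη, sub_mul, one_mul]
      rfl
    rw [hfun]
    -- Inside this ball the cutoff is 1 and the difference vanishes; outside, the extra power of ‖x‖
    -- in the decay of φ yields the factor 1/(m+1).
    by_cases hx : ‖x‖ < (m : ℝ) + 1
    · have h0 : (fun x => η (((m : ℝ) + 1)⁻¹ • x) * φ x) =ᶠ[𝓝 x] fun _ => 0 := by
        have : Metric.ball (0 : E) ((m : ℝ) + 1) ∈ 𝓝 x :=
          Metric.isOpen_ball.mem_nhds (by simpa using hx)
        filter_upwards [this] with y hy
        have : χ (((m : ℝ) + 1)⁻¹ • y) = 1 := by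
          apply χ.one_of_mem_closedBall
          simp only [mem_closedBall_zero_iff, norm_smul, norm_inv, Real.norm_eq_abs]
          rw [abs_of_pos (by positivity : (0 : ℝ) < (m : ℝ) + 1)]
          have : ‖y‖ < (m : ℝ) + 1 := by simpa using hy
          change _ ≤ (1 : ℝ)
          rw [inv_mul_le_iff₀ (by positivity)]
          linarith
        simp [hη, this]
      rw [(h0.iteratedFDeriv ℝ n).eq_of_nhds]
      have : iteratedFDeriv ℝ n (fun _ : E => (0 : ℂ)) x = 0 := by
        simp
      rw [this]
      simp only [norm_zero, mul_zero]
      exact mul_nonneg hS0 (hpos m).le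
    · push Not at hx
      have hxp : (0 : ℝ) < ‖x‖ := lt_of_lt_of_le (by positivity) hx
      have hηm : ContDiff ℝ (⊤ : ℕ∞) (fun x : E => η (((m : ℝ) + 1)⁻¹ • x)) :=
        hηs.comp (contDiff_const_smul _)
      have hle := norm_iteratedFDeriv_mul_le (𝕜 := ℝ) hηm (φ.smooth ⊤) x (n := n)
        (by exact_mod_cast le_top)
      calc ‖x‖ ^ k * ‖iteratedFDeriv ℝ n (fun x => η (((m : ℝ) + 1)⁻¹ • x) * φ x) x‖
          ≤ ‖x‖ ^ k * ∑ i ∈ Finset.range (n + 1), (n.choose i : ℝ)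
            * ‖iteratedFDeriv ℝ i (fun x : E => η (((m : ℝ) + 1)⁻¹ • x)) x‖
            * ‖iteratedFDeriv ℝ (n - i) φ x‖ := by gcongr
        _ ≤ ‖x‖ ^ k * ∑ i ∈ Finset.range (n + 1), (n.choose i : ℝ)
            * B i * ‖iteratedFDeriv ℝ (n - i) φ x‖ := by
          gcongr with i hi
          rw [iteratedFDeriv_comp_const_smul _ (hηs.of_le (by exact_mod_cast le_top)), norm_smul]
          refine le_trans ?_ (hB i (((m : ℝ) + 1)⁻¹ • x))
          refine mul_le_of_le_one_left (norm_nonneg _) ?_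
          rw [norm_pow]
          refine pow_le_one₀ (norm_nonneg _) ?_
          rw [Real.norm_eq_abs, abs_of_pos (hpos m)]
          exact inv_le_one_of_one_le₀ (by linarith [(Nat.cast_nonneg m : (0 : ℝ) ≤ m)])
        _ = ∑ i ∈ Finset.range (n + 1), (n.choose i : ℝ)
            * B i * (‖x‖ ^ (k + 1) * ‖iteratedFDeriv ℝ (n - i) φ x‖) * ‖x‖⁻¹ := by
          rw [Finset.mul_sum]
          refine Finset.sum_congr rfl fun i _ => ?_
          field_simp
          ring
        _ ≤ ∑ i ∈ Finset.range (n + 1), (n.choose i : ℝ) * B i * Dφ (n - i)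
            * ((m : ℝ) + 1)⁻¹ := by
          have hi1 : ‖x‖⁻¹ ≤ ((m : ℝ) + 1)⁻¹ := by
            gcongr
          gcongr with i hi
          · exact mul_nonneg (mul_nonneg (by positivity) (hB0 i)) (hD0 _).le
          · exact mul_nonneg (by positivity) (hB0 i)
          · exact hD _ x
        _ = S * ((m : ℝ) + 1)⁻¹ := by rw [hS, Finset.sum_mul]
  have hlim : Tendsto (fun m : ℕ => S * ((m : ℝ) + 1)⁻¹) atTop (𝓝 0) := by
    have := (tendsto_one_div_add_atTop_nhds_zero_nat (𝕜 := ℝ)).const_mul S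
    simpa [one_div] using this
  filter_upwards [hlim.eventually (gt_mem_nhds hε)] with m hm
  exact lt_of_le_of_lt (key m) hm

/-- A tempered distribution vanishes on every Schwartz function supported off its support. -/
theorem apply_eq_zero_of_disjoint_dsupport (T : 𝓢'(E, ℂ)) (φ : 𝓢(E, ℂ))
    (h : Disjoint (tsupport φ) (Distribution.dsupport ⇑T)) : T φ = 0 := by
  have hcomp : ∀ ψ : 𝓢(E, ℂ), HasCompactSupport ψ → tsupport ψ ⊆ tsupport φ → T ψ = 0 := by
    intro ψ hψ hψφ
    -- A partition of unity subordinate to open sets on which T vanishes splits ψ into finitely many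
    -- pieces, by compactness of its support. Points off the support are given the empty set.
    have hloc : ∀ x : E, ∃ s : Set E, IsOpen s ∧ (x ∈ tsupport ψ → x ∈ s) ∧
        Distribution.IsVanishingOn ⇑T s := by
      intro x
      by_cases hx : x ∈ tsupport ψ
      · obtain ⟨s, hs, ho, hxs⟩ := (Distribution.notMem_dsupport_iff x).1
          (Set.disjoint_left.1 h (hψφ hx))
        exact ⟨s, ho, fun _ => hxs, hs⟩
      · refine ⟨∅, isOpen_empty, fun h => absurd h hx, fun u hu => ?_⟩
        have : u = 0 := by
          ext y
          exact image_eq_zero_of_notMem_tsupport (fun hy => by simpa using hu hy)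
        rw [this, map_zero]
    choose U hUo hUm hUv using hloc
    obtain ⟨ρ, hρ⟩ := SmoothPartitionOfUnity.exists_isSubordinate (modelWithCornersSelf ℝ E)
      (isClosed_tsupport ψ) U hUo (fun x hx => Set.mem_iUnion.2 ⟨x, hUm x hx⟩)
    have hfin := ρ.locallyFinite.finite_nonempty_inter_compact hψ
    have hρs : ∀ i, ContDiff ℝ (⊤ : ℕ∞) (fun x => (ρ i x : ℂ)) := fun i =>
      Complex.ofRealCLM.contDiff.comp (ρ i).contMDiff.contDiff
    let v : E → 𝓢(E, ℂ) := fun i => HasCompactSupport.toSchwartzMap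
      (f := fun x => (ρ i x : ℂ) * ψ x) (hψ.mul_left) ((hρs i).mul (ψ.smooth ⊤))
    have hv : ∀ i, T (v i) = 0 := by
      intro i
      refine hUv i (v i) (subset_trans ?_ (hρ i))
      refine subset_trans (tsupport_mul_subset_left (f := fun x => (ρ i x : ℂ))) ?_
      exact tsupport_comp_subset (g := fun t : ℝ => (t : ℂ)) rfl (ρ i)
    have hsum : ψ = ∑ i ∈ hfin.toFinset, v i := by
      ext x
      rw [sum_apply]
      change ψ x = ∑ i ∈ hfin.toFinset, (ρ i x : ℂ) * ψ x
      rw [← Finset.sum_mul]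
      by_cases hx : x ∈ tsupport ψ
      · have h1 := ρ.sum_eq_one hx
        rw [finsum_eq_sum_of_support_subset (s := hfin.toFinset)] at h1
        · have : (∑ i ∈ hfin.toFinset, (ρ i x : ℂ)) = 1 := by exact_mod_cast h1
          rw [this, one_mul]
        · intro i hi
          simp only [Set.Finite.coe_toFinset, Set.mem_ofPred_eq]
          exact ⟨x, hi, hx⟩
      · rw [image_eq_zero_of_notMem_tsupport hx, mul_zero]
    rw [hsum, map_sum]
    exact Finset.sum_eq_zero fun i _ => hv i
  obtain ⟨u, hu1, hu2, hu3⟩ := exists_compactSupport_tendsto φ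
  have ht : Tendsto (fun m => T (u m)) atTop (𝓝 (T φ)) :=
    ((ContinuousLinearMap.continuous T).tendsto φ).comp hu3
  have h0 : (fun m => T (u m)) = fun _ => 0 := funext fun m => hcomp _ (hu1 m) (hu2 m)
  rw [h0] at ht
  exact (tendsto_nhds_unique ht tendsto_const_nhds)

end Support

/-! ### Spectral support and p-th powers of norms -/

section Spectrum

variable {X : Type*} [NormedAddCommGroup X] [InnerProductSpace ℝ X] [FiniteDimensional ℝ X]
  [MeasurableSpace X] [BorelSpace X]

/-- The Fourier transform of `f`, as a distribution, is supported in `F`. -/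
def SpectrumIn (f : X → ℂ) (F : Set X) : Prop :=
  ∀ φ : 𝓢(X, ℂ), Disjoint (tsupport φ) F → ∫ x, 𝓕 φ x * f x = 0

/-- The `p`-th power of the `L^p` norm. -/
def lpPow (p : ℝ≥0∞) (f : X → ℂ) : ℝ≥0∞ := ∫⁻ x, ‖f x‖ₑ ^ p.toReal

theorem SpectrumIn.mono {f : X → ℂ} {F F' : Set X} (h : SpectrumIn f F) (hF : F ⊆ F') :
    SpectrumIn f F' := fun φ hφ => h φ (hφ.mono_right hF)

theorem SpectrumIn.congr_ae {f g : X → ℂ} {F : Set X} (h : SpectrumIn f F) (hfg : f =ᵐ[volume] g) :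
    SpectrumIn g F := fun φ hφ => by
  rw [← h φ hφ]
  refine integral_congr_ae ?_
  filter_upwards [hfg] with x hx
  rw [hx]

theorem spectrumIn_zero (F : Set X) : SpectrumIn (fun _ : X => (0 : ℂ)) F := fun φ _ => by simp

theorem integrable_schwartz_mul {p : ℝ≥0∞} (hp : 1 ≤ p) {f : X → ℂ} (hf : MemLp f p)
    (φ : 𝓢(X, ℂ)) : Integrable (fun x => φ x * f x) := by
  have := ENNReal.HolderConjugate.inv_one_sub_inv' hp
  have h2 : MemLp (⇑φ) (1 - p⁻¹)⁻¹ (volume : Measure X) := φ.memLp _ _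
  exact h2.integrable_mul hf

theorem SpectrumIn.sum {κ : Type*} {s : Finset κ} {p : ℝ≥0∞} (hp : 1 ≤ p) {f : κ → X → ℂ}
    {F : Set X} (hf : ∀ i ∈ s, MemLp (f i) p) (h : ∀ i ∈ s, SpectrumIn (f i) F) :
    SpectrumIn (fun x => ∑ i ∈ s, f i x) F := by
  intro φ hφ
  simp_rw [Finset.mul_sum]
  rw [integral_finsetSum _ fun i hi => integrable_schwartz_mul hp (hf i hi) (𝓕 φ)]
  exact Finset.sum_eq_zero fun i hi => h i hi φ hφ

theorem lpPow_congr_ae {p : ℝ≥0∞} {f g : X → ℂ} (h : f =ᵐ[volume] g) : lpPow p f = lpPow p g := by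
  refine lintegral_congr_ae ?_
  filter_upwards [h] with x hx
  rw [hx]

theorem enorm_rpow_eq_lpPow {p : ℝ≥0∞} (hp : 1 ≤ p) (hp' : p ≠ ∞)
    (f : Lp ℂ p (volume : Measure X)) : ENNReal.ofReal (‖f‖ ^ p.toReal) = lpPow p f := by
  have h0 : p ≠ 0 := (zero_lt_one.trans_le hp).ne'
  have hpos : 0 < p.toReal := ENNReal.toReal_pos h0 hp'
  have : Fact (1 ≤ p) := ⟨hp⟩
  rw [← ENNReal.ofReal_rpow_of_nonneg (norm_nonneg _) hpos.le, Lp.norm_def,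
    ENNReal.ofReal_toReal (Lp.eLpNorm_ne_top f), eLpNorm_eq_lintegral_rpow_enorm_toReal h0 hp',
    ← ENNReal.rpow_mul, one_div, inv_mul_cancel₀ hpos.ne', ENNReal.rpow_one]
  rfl

theorem lpPow_ne_top {p : ℝ≥0∞} (hp : 1 ≤ p) (hp' : p ≠ ∞) {f : X → ℂ} (hf : MemLp f p) :
    lpPow p f ≠ ∞ := by
  have h := enorm_rpow_eq_lpPow hp hp' hf.toLp
  rw [lpPow_congr_ae hf.coeFn_toLp] at h
  rw [← h]
  exact ENNReal.ofReal_ne_top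

/-- The power triangle inequality `‖∑_{i ∈ s} f_i‖_p^p ≤ (#s)^p ∑_{i ∈ s} ‖f_i‖_p^p`. -/
theorem lpPow_sum_le {κ : Type*} (s : Finset κ) {p : ℝ≥0∞} (hp : 1 ≤ p) (hp' : p ≠ ∞)
    {f : κ → X → ℂ} (hf : ∀ i ∈ s, AEStronglyMeasurable (f i)) :
    lpPow p (fun x => ∑ i ∈ s, f i x) ≤ (s.card : ℝ≥0∞) ^ p.toReal * ∑ i ∈ s, lpPow p (f i) := by
  have hpos : 0 < p.toReal := ENNReal.toReal_pos (zero_lt_one.trans_le hp).ne' hp'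
  unfold lpPow
  rw [← lintegral_finsetSum' _ fun i hi => ((hf i hi).enorm.pow_const _), ← lintegral_const_mul'']
  · refine lintegral_mono fun x => ?_
    simp only
    rcases s.eq_empty_or_nonempty with rfl | hs
    · simp [hpos]
    -- Pointwise, every summand is bounded by the largest one. This is cruder than convexity, but
    -- only a power of the cardinality matters.
    obtain ⟨i₀, hi₀, hmax⟩ := s.exists_max_image (fun i => ‖f i x‖ₑ) hs
    calc ‖∑ i ∈ s, f i x‖ₑ ^ p.toReal ≤ (∑ i ∈ s, ‖f i x‖ₑ) ^ p.toReal := by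
          gcongr
          exact enorm_sum_le _ _
      _ ≤ (s.card * ‖f i₀ x‖ₑ) ^ p.toReal := by
          gcongr
          rw [← nsmul_eq_mul]
          exact Finset.sum_le_card_nsmul _ _ _ hmax
      _ = (s.card : ℝ≥0∞) ^ p.toReal * ‖f i₀ x‖ₑ ^ p.toReal :=
          ENNReal.mul_rpow_of_nonneg _ _ hpos.le
      _ ≤ _ := by
          gcongr
          exact Finset.single_le_sum (f := fun i => ‖f i x‖ₑ ^ p.toReal) (fun _ _ => zero_le) hi₀
  · exact Finset.aemeasurable_fun_sum _ fun i hi => ((hf i hi).enorm.pow_const _)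

end Spectrum

theorem mem_uncertaintyBox_iff {ι : Type} {n k : ℕ} (P : Fin n → QuadraticForm ℝ (ι → ℝ)) (C : ℝ)
    (θ : DyadicCube ι k) (z : Ambient ι n) :
    z ∈ uncertaintyBox P C θ ↔ (∀ i, |z (Sum.inl i) - corner θ i| ≤ C * (1 / 2 ^ k)) ∧
      ∀ j, |z (Sum.inr j) - P j (corner θ)
        - QuadraticMap.polar (P j) (corner θ) (fun i => z (Sum.inl i) - corner θ i)|
          ≤ C * (1 / 2 ^ k) ^ 2 := by
  have hδ : (0 : ℝ) < 1 / 2 ^ k := by positivity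
  constructor
  · rintro ⟨u, v, hu, hv, h1, h2⟩
    have h3 : (fun i => z (Sum.inl i) - corner θ i) = (1 / 2 ^ k : ℝ) • u := by
      ext i
      simp [h1 i]
    refine ⟨fun i => ?_, fun j => ?_⟩
    · rw [h1 i, add_sub_cancel_left, abs_mul, abs_of_pos hδ, mul_comm]
      exact mul_le_mul_of_nonneg_right (hu i) hδ.le
    · rw [h3, h2 j]
      have : P j (corner θ) + QuadraticMap.polar (P j) (corner θ) ((1 / 2 ^ k : ℝ) • u)
          + (1 / 2 ^ k) ^ 2 * v j - P j (corner θ)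
          - QuadraticMap.polar (P j) (corner θ) ((1 / 2 ^ k : ℝ) • u)
          = (1 / 2 ^ k) ^ 2 * v j := by ring
      rw [this, abs_mul, abs_of_pos (by positivity), mul_comm]
      exact mul_le_mul_of_nonneg_right (hv j) (by positivity)
  · rintro ⟨h1, h2⟩
    have h3 : ((1 / 2 ^ k : ℝ) • fun i => (z (Sum.inl i) - corner θ i) / (1 / 2 ^ k))
        = fun i => z (Sum.inl i) - corner θ i := by
      ext i
      simp only [Pi.smul_apply, smul_eq_mul]
      rw [mul_div_cancel₀ _ hδ.ne']
    refine ⟨fun i => (z (Sum.inl i) - corner θ i) / (1 / 2 ^ k),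
      fun j => (z (Sum.inr j) - P j (corner θ)
        - QuadraticMap.polar (P j) (corner θ) (fun i => z (Sum.inl i) - corner θ i))
          / (1 / 2 ^ k) ^ 2, fun i => ?_, fun j => ?_, fun i => ?_, fun j => ?_⟩
    · rw [abs_div, abs_of_pos hδ, div_le_iff₀ hδ]
      exact h1 i
    · rw [abs_div, abs_of_pos (by positivity : (0 : ℝ) < (1 / 2 ^ k) ^ 2),
        div_le_iff₀ (by positivity)]
      exact h2 j
    · rw [mul_div_cancel₀ _ hδ.ne']
      ring
    · rw [h3, mul_div_cancel₀ _ (by positivity)]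
      ring

/-! ### Passage between the distributional inequality and its form for functions -/

section FunctionForm

variable {ι : Type} [Fintype ι] {n : ℕ}

theorem spectrumIn_of_fourierSupport_subset {p : ℝ≥0∞} [Fact (1 ≤ p)]
    {f : Lp ℂ p (volume : Measure (Ambient ι n))} {F : Set (Ambient ι n)}
    (h : fourierSupport f ⊆ F) : SpectrumIn f F := by
  intro φ hφ
  have h1 := apply_eq_zero_of_disjoint_dsupport
    (𝓕 (Lp.toTemperedDistribution f) : 𝓢'(Ambient ι n, ℂ)) φ (hφ.mono_right h)
  rw [TemperedDistribution.fourier_apply, Lp.toTemperedDistribution_apply] at h1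
  simpa using h1

/-- The distributional support is the intersection of the closed sets off which the distribution
vanishes, so closedness of `F` makes it one of the competitors. -/
theorem fourierSupport_subset_of_spectrumIn {p : ℝ≥0∞} [Fact (1 ≤ p)]
    {f : Lp ℂ p (volume : Measure (Ambient ι n))} {F : Set (Ambient ι n)} (hF : IsClosed F)
    (h : SpectrumIn f F) : fourierSupport f ⊆ F := by
  refine Set.sInter_subset_of_mem ⟨fun φ hφ => ?_, hF⟩
  rw [TemperedDistribution.fourier_apply, Lp.toTemperedDistribution_apply]
  simpa using h φ (Set.disjoint_left.2 fun x hx hx' => hφ hx hx')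

theorem isClosed_uncertaintyBox {k : ℕ} (P : Fin n → QuadraticForm ℝ (ι → ℝ)) (C : ℝ)
    (θ : DyadicCube ι k) : IsClosed (uncertaintyBox P C θ) := by
  have : uncertaintyBox P C θ = (⋂ i, {z | |z (Sum.inl i) - corner θ i| ≤ C * (1 / 2 ^ k)}) ∩
      ⋂ j, {z | |z (Sum.inr j) - P j (corner θ)
        - QuadraticMap.polar (P j) (corner θ) (fun i => z (Sum.inl i) - corner θ i)|
          ≤ C * (1 / 2 ^ k) ^ 2} := by
    ext z
    rw [mem_uncertaintyBox_iff]
    simp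
  rw [this]
  refine (isClosed_iInter fun i => isClosed_le (by fun_prop) continuous_const).inter
    (isClosed_iInter fun j => isClosed_le ?_ continuous_const)
  have hl : Continuous fun x : ι → ℝ => QuadraticMap.polar (P j) (corner θ) x :=
    LinearMap.continuous_of_finiteDimensional ((P j).polarBilin (corner θ))
  have hl' : Continuous fun z : Ambient ι n =>
      QuadraticMap.polar (P j) (corner θ) (fun i => z (Sum.inl i) - corner θ i) :=
    hl.comp (by fun_prop)
  fun_prop

/-- The decoupling inequality for functions, in terms of `p`-th powers of norms. -/
def DecouplesPow {k : ℕ} (P : Fin n → QuadraticForm ℝ (ι → ℝ)) (C : ℝ) (p : ℝ≥0∞)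
    (G : Finset (DyadicCube ι k)) (M : ℝ) : Prop :=
  ∀ f : DyadicCube ι k → Ambient ι n → ℂ, (∀ θ ∈ G, MemLp (f θ) p) →
    (∀ θ ∈ G, SpectrumIn (f θ) (uncertaintyBox P C θ)) →
    lpPow p (fun x => ∑ θ ∈ G, f θ x) ≤ ENNReal.ofReal M ^ p.toReal * ∑ θ ∈ G, lpPow p (f θ)

theorem coeFn_finsetSum_Lp {X : Type*} [MeasurableSpace X] {μ : Measure X} {p : ℝ≥0∞}
    {κ : Type*} (s : Finset κ) (f : κ → Lp ℂ p μ) :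
    ⇑(∑ i ∈ s, f i) =ᵐ[μ] fun x => ∑ i ∈ s, f i x := by
  classical
  induction s using Finset.induction_on with
  | empty =>
    simp only [Finset.sum_empty]
    exact Lp.coeFn_zero ℂ p μ
  | insert a s ha ih =>
    rw [Finset.sum_insert ha]
    filter_upwards [Lp.coeFn_add (f a) (∑ i ∈ s, f i), ih] with x h1 h2
    rw [h1, Finset.sum_insert ha, Pi.add_apply, h2]

theorem norm_le_mul_rpow_iff {X : Type*} [NormedAddCommGroup X] [InnerProductSpace ℝ X]
    [FiniteDimensional ℝ X] [MeasurableSpace X] [BorelSpace X] {κ : Type*} (s : Finset κ)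
    {p : ℝ≥0∞} [hp : Fact (1 ≤ p)] (hp' : p ≠ ∞) (F : Lp ℂ p (volume : Measure X))
    (f : κ → Lp ℂ p (volume : Measure X)) {M : ℝ} (hM : 0 ≤ M) :
    ‖F‖ ≤ M * (∑ i ∈ s, ‖f i‖ ^ p.toReal) ^ (1 / p.toReal) ↔
      lpPow p F ≤ ENNReal.ofReal M ^ p.toReal * ∑ i ∈ s, lpPow p (f i) := by
  have hpos : 0 < p.toReal := ENNReal.toReal_pos (zero_lt_one.trans_le hp.out).ne' hp'
  have hS : 0 ≤ ∑ i ∈ s, ‖f i‖ ^ p.toReal := Finset.sum_nonneg fun _ _ => by positivity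
  have h1 : ENNReal.ofReal M ^ p.toReal * ∑ i ∈ s, lpPow p (f i)
      = ENNReal.ofReal (M ^ p.toReal * ∑ i ∈ s, ‖f i‖ ^ p.toReal) := by
    rw [ENNReal.ofReal_mul (by positivity), ← ENNReal.ofReal_rpow_of_nonneg hM hpos.le,
      ENNReal.ofReal_sum_of_nonneg fun _ _ => by positivity]
    simp_rw [enorm_rpow_eq_lpPow hp.out hp']
  rw [h1, ← enorm_rpow_eq_lpPow hp.out hp', ENNReal.ofReal_le_ofReal_iff (by positivity),
    ← Real.rpow_le_rpow_iff (norm_nonneg _) (by positivity) hpos,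
    Real.mul_rpow hM (by positivity), ← Real.rpow_mul hS, one_div, inv_mul_cancel₀ hpos.ne',
    Real.rpow_one]

theorem decouples_of_decouplesPow {k : ℕ} {P : Fin n → QuadraticForm ℝ (ι → ℝ)} {C : ℝ}
    {p : ℝ≥0∞} [hp : Fact (1 ≤ p)] (hp' : p ≠ ∞) {G : Finset (DyadicCube ι k)} {M : ℝ}
    (hM : 0 ≤ M) (h : DecouplesPow P C p G M) : Decouples P C p G M := by
  intro f hf
  rw [norm_le_mul_rpow_iff G hp' _ f hM, lpPow_congr_ae (coeFn_finsetSum_Lp G f)]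
  exact h (fun θ => f θ) (fun θ _ => Lp.memLp _)
    fun θ hθ => spectrumIn_of_fourierSupport_subset (hf θ hθ)

theorem decouplesPow_of_decouples {k : ℕ} {P : Fin n → QuadraticForm ℝ (ι → ℝ)} {C : ℝ}
    {p : ℝ≥0∞} [hp : Fact (1 ≤ p)] (hp' : p ≠ ∞) {G : Finset (DyadicCube ι k)} {M : ℝ}
    (hM : 0 ≤ M) (h : Decouples P C p G M) : DecouplesPow P C p G M := by
  classical
  intro f hf hs
  -- Nothing is assumed about `f θ` for θ outside `G`, so zero is used there.
  let F : DyadicCube ι k → Lp ℂ p (volume : Measure (Ambient ι n)) := fun θ =>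
    if hθ : θ ∈ G then (hf θ hθ).toLp else 0
  have hF : ∀ θ ∈ G, F θ =ᵐ[volume] f θ := fun θ hθ => by
    simp only [F, dif_pos hθ]
    exact (hf θ hθ).coeFn_toLp
  have h1 := h F fun θ hθ => fourierSupport_subset_of_spectrumIn (isClosed_uncertaintyBox P C θ)
    ((hs θ hθ).congr_ae (hF θ hθ).symm)
  rw [norm_le_mul_rpow_iff G hp' _ F hM, lpPow_congr_ae (coeFn_finsetSum_Lp G F),
    Finset.sum_congr rfl fun θ hθ => lpPow_congr_ae (p := p) (hF θ hθ)] at h1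
  refine le_trans (le_of_eq (lpPow_congr_ae ?_)) h1
  have : ∀ᵐ x, ∀ θ ∈ G, F θ x = f θ x := by
    rw [Filter.eventually_all_finset]
    exact hF
  filter_upwards [this] with x hx
  exact Finset.sum_congr rfl fun θ hθ => (hx θ hθ).symm

end FunctionForm

/-! ### Affine changes of the frequency variable -/

open scoped RealInnerProductSpace

/-- The transposed inverse of a linear automorphism. -/
theorem exists_dual_equiv {X : Type*} [NormedAddCommGroup X] [InnerProductSpace ℝ X]
    [FiniteDimensional ℝ X] (M : X ≃L[ℝ] X) :
    ∃ B : X ≃L[ℝ] X, ∀ x η, ⟪M η, B x⟫ = ⟪η, x⟫ := by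
  let A : X →L[ℝ] X := ContinuousLinearMap.adjoint (M : X →L[ℝ] X)
  let A' : X →L[ℝ] X := ContinuousLinearMap.adjoint (M.symm : X →L[ℝ] X)
  refine ⟨ContinuousLinearEquiv.equivOfInverse A' A (fun x => ?_) (fun x => ?_), fun x η => ?_⟩
  · refine ext_inner_left ℝ fun y => ?_
    simp [A, A', ContinuousLinearMap.adjoint_inner_right]
  · refine ext_inner_left ℝ fun y => ?_
    simp [A, A', ContinuousLinearMap.adjoint_inner_right]
  · simp [A', ContinuousLinearMap.adjoint_inner_right]

section Affine

variable {X : Type*} [NormedAddCommGroup X] [InnerProductSpace ℝ X] [FiniteDimensional ℝ X]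
  [MeasurableSpace X] [BorelSpace X]

/-- The value of the Jacobian is irrelevant: it appears on both sides of a decoupling inequality, so
only its being nonzero and finite is recorded. -/
theorem exists_map_volume_eq_smul (L : X ≃L[ℝ] X) :
    ∃ c : ℝ≥0∞, c ≠ 0 ∧ c ≠ ∞ ∧ Measure.map L (volume : Measure X) = c • volume := by
  have hdet : LinearMap.det (L : X →ₗ[ℝ] X) ≠ 0 := (LinearEquiv.isUnit_det' L.toLinearEquiv).ne_zero
  refine ⟨ENNReal.ofReal |(LinearMap.det (L : X →ₗ[ℝ] X))⁻¹|, ?_, ENNReal.ofReal_ne_top,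
    Measure.map_linearMap_addHaar_eq_smul_addHaar volume hdet⟩
  simpa using hdet

theorem integral_comp_continuousLinearEquiv (L : X ≃L[ℝ] X) :
    ∃ c : ℝ, c ≠ 0 ∧ ∀ f : X → ℂ, ∫ x, f (L x) = c • ∫ x, f x := by
  obtain ⟨c, h0, ht, hc⟩ := exists_map_volume_eq_smul L
  refine ⟨c.toReal, ENNReal.toReal_ne_zero.2 ⟨h0, ht⟩, fun f => ?_⟩
  rw [← integral_smul_measure, ← hc]
  exact (integral_map_equiv L.toHomeomorph.toMeasurableEquiv f).symm

theorem lintegral_comp_continuousLinearEquiv (L : X ≃L[ℝ] X) :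
    ∃ c : ℝ≥0∞, c ≠ 0 ∧ c ≠ ∞ ∧ ∀ f : X → ℝ≥0∞, ∫⁻ x, f (L x) = c * ∫⁻ x, f x := by
  obtain ⟨c, h0, ht, hc⟩ := exists_map_volume_eq_smul L
  refine ⟨c, h0, ht, fun f => ?_⟩
  rw [← smul_eq_mul, ← lintegral_smul_measure, ← hc]
  exact (lintegral_map_equiv f L.toHomeomorph.toMeasurableEquiv).symm

/-- The function `x ↦ e(-⟨Bx, ξ₀⟩) f(Bx)`. -/
def modulatedComp (B : X ≃L[ℝ] X) (ξ₀ : X) (f : X → ℂ) : X → ℂ :=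
  fun x => (𝐞 (-⟪ξ₀, B x⟫) : ℂ) * f (B x)

theorem lpPow_modulatedComp (p : ℝ≥0∞) (B : X ≃L[ℝ] X) (ξ₀ : X) :
    ∃ c : ℝ≥0∞, c ≠ 0 ∧ c ≠ ∞ ∧
      ∀ f : X → ℂ, lpPow p (modulatedComp B ξ₀ f) = c * lpPow p f := by
  obtain ⟨c, h0, ht, hc⟩ := lintegral_comp_continuousLinearEquiv B
  refine ⟨c, h0, ht, fun f => ?_⟩
  rw [lpPow, lpPow, ← hc]
  refine lintegral_congr fun x => ?_
  have h1 : ‖(𝐞 (-⟪ξ₀, B x⟫) : ℂ)‖ₑ = 1 := by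
    rw [← ofReal_norm, Circle.norm_coe, ENNReal.ofReal_one]
  rw [modulatedComp, enorm_mul, h1, one_mul]

theorem memLp_modulatedComp {p : ℝ≥0∞} (B : X ≃L[ℝ] X) (ξ₀ : X) {f : X → ℂ} (hf : MemLp f p) :
    MemLp (modulatedComp B ξ₀ f) p := by
  obtain ⟨c, h0, ht, hc⟩ := exists_map_volume_eq_smul B
  have h1 : MemLp (fun x => f (B x)) p := by
    have h2 : MemLp f p (Measure.map B (volume : Measure X)) := by
      rw [hc]
      exact hf.smul_measure ht
    exact (memLp_map_measure_iff h2.1 B.continuous.aemeasurable).1 h2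
  refine h1.of_le ?_ (Filter.Eventually.of_forall fun x => ?_)
  · refine AEStronglyMeasurable.mul ?_ h1.1
    refine Continuous.aestronglyMeasurable ?_
    exact continuous_subtype_val.comp (Real.continuous_fourierChar.comp
      ((continuous_const.inner B.continuous).neg))
  · rw [modulatedComp, norm_mul, Circle.norm_coe, one_mul]

/-- `B` is the inverse transpose of `M`. Testing the new function with φ amounts, up to nonzero
Jacobians, to testing `f` with φ(M⁻¹(ξ - ξ₀)), whose support is the image of that of φ under η ↦ ξ₀
+ Mη. -/
theorem spectrumIn_modulatedComp {B M : X ≃L[ℝ] X} (hBM : ∀ x η, ⟪M η, B x⟫ = ⟪η, x⟫)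
    (ξ₀ : X) {f : X → ℂ} {F : Set X} (h : SpectrumIn f F) :
    SpectrumIn (modulatedComp B ξ₀ f) {η | ξ₀ + M η ∈ F} := by
  intro φ hφ
  set Θ : 𝓢(X, ℂ) := SchwartzMap.compSubConstCLM ℂ ξ₀
    (SchwartzMap.compCLMOfContinuousLinearEquiv ℂ M.symm φ) with hΘ
  have hΘa : ∀ ξ, Θ ξ = φ (M.symm (ξ - ξ₀)) := fun ξ => by simp [hΘ]
  have hsupp : Disjoint (tsupport Θ) F := by
    have hsub : tsupport Θ ⊆ (fun ξ => M.symm (ξ - ξ₀)) ⁻¹' tsupport φ := by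
      refine closure_minimal (fun ξ hξ => subset_closure ?_)
        ((isClosed_tsupport φ).preimage (by fun_prop))
      simpa [hΘa] using hξ
    refine Set.disjoint_left.2 fun ξ h1 h2 => Set.disjoint_left.1 hφ (hsub h1) ?_
    simpa using h2
  have h0 := h Θ hsupp
  obtain ⟨c, hc0, hc⟩ := integral_comp_continuousLinearEquiv M
  obtain ⟨c', hc0', hc'⟩ := integral_comp_continuousLinearEquiv B
  have hF : ∀ x, 𝓕 φ x * (modulatedComp B ξ₀ f) x = c • (𝓕 Θ (B x) * f (B x)) := by
    intro x
    have h1 : c • 𝓕 Θ (B x) = (𝐞 (-⟪ξ₀, B x⟫) : ℂ) * 𝓕 φ x := by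
      rw [SchwartzMap.fourier_coe, SchwartzMap.fourier_coe, Real.fourier_eq, Real.fourier_eq,
        ← integral_sub_right_eq_self (fun v => 𝐞 (-⟪v, B x⟫) • Θ v) (-ξ₀), ← hc,
        ← integral_const_mul]
      refine integral_congr_ae (Filter.Eventually.of_forall fun η => ?_)
      simp only [sub_neg_eq_add, hΘa, add_sub_cancel_right, ContinuousLinearEquiv.symm_apply_apply,
        inner_add_left, hBM, neg_add, AddChar.map_add_eq_mul, Circle.smul_def, Circle.coe_mul,
        smul_eq_mul]
      ring
    rw [modulatedComp, ← smul_mul_assoc, h1]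
    ring
  simp_rw [hF]
  rw [integral_smul, hc' (fun y => 𝓕 Θ y * f y), h0, smul_zero, smul_zero]

end Affine

/-! ### Countably many test functions suffice -/

section Tests

variable {V : Type*} [NormedAddCommGroup V] [InnerProductSpace ℝ V] [FiniteDimensional ℝ V]
  [MeasurableSpace V] [BorelSpace V]

/-- Pairing with `g` is a continuous functional on L^q evaluated at `A φ`. As `q` is finite, L^q is
separable, so the admissible `A φ` contain a countable dense subset, and a functional that vanishes
on it vanishes on all of them. The tests are chosen before `g`, so they serve almost all slices of a
function at once. -/
theorem exists_countable_tests_of_pairing {q r : ℝ≥0∞} [Fact (1 ≤ q)] [Fact (q ≠ ∞)]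
    [Fact (1 ≤ r)] [r.HolderConjugate q] (A : 𝓢(V, ℂ) → 𝓢(V, ℂ)) (F : Set V) :
    ∃ D : ℕ → 𝓢(V, ℂ), (∀ m, Disjoint (tsupport (D m)) F) ∧
      ∀ g : V → ℂ, (∃ h : V → ℂ, MemLp h r ∧
        ∀ φ : 𝓢(V, ℂ), ∫ x, 𝓕 φ x * g x = ∫ x, h x * A φ x) →
        (∀ m, ∫ x, 𝓕 (D m) x * g x = 0) → SpectrumIn g F := by
  let S := {φ : 𝓢(V, ℂ) // Disjoint (tsupport φ) F}
  let J : S → Lp ℂ q (volume : Measure V) := fun φ => (A φ.1).toLp q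
  have hne : Nonempty (Set.range J) := by
    refine ⟨⟨_, ⟨⟨0, ?_⟩, rfl⟩⟩⟩
    have : tsupport (⇑(0 : 𝓢(V, ℂ))) = ∅ := by
      rw [tsupport_eq_empty_iff]; rfl
    rw [this]
    exact Set.empty_disjoint F
  obtain ⟨u, hu⟩ := TopologicalSpace.exists_dense_seq (Set.range J)
  choose D hD using fun m => (u m).2
  refine ⟨fun m => (D m).1, fun m => (D m).2, ?_⟩
  rintro g ⟨h, hh, hg⟩ h0 φ hφ
  let T : Lp ℂ q (volume : Measure V) →L[ℂ] ℂ :=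
    ContinuousLinearMap.lpPairing volume r q (ContinuousLinearMap.lsmul ℂ ℂ) hh.toLp
  have hT : ∀ ψ : S, T (J ψ) = ∫ x, 𝓕 ψ.1 x * g x := by
    intro ψ
    rw [hg ψ.1]
    simp only [T, J, ContinuousLinearMap.lpPairing_eq_integral]
    refine integral_congr_ae ?_
    filter_upwards [hh.coeFn_toLp, (A ψ.1).coeFn_toLp q volume] with x h1 h2
    rw [h1, h2]
    simp
  have hz : (fun y : Set.range J => T y) = fun _ => 0 := by
    refine Continuous.ext_on hu (T.continuous.comp continuous_subtype_val) continuous_const ?_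
    rintro _ ⟨m, rfl⟩
    simp only
    rw [← hD m, hT, h0]
  have := congrFun hz ⟨J ⟨φ, hφ⟩, ⟨_, rfl⟩⟩
  simp only at this
  rw [← hT ⟨φ, hφ⟩, this]

/-- For `L^p` functions it suffices to test the support of the Fourier transform with countably
many Schwartz functions. -/
theorem exists_countable_tests {p : ℝ≥0∞} (hp : 1 ≤ p) (F : Set V) :
    ∃ D : ℕ → 𝓢(V, ℂ), (∀ m, Disjoint (tsupport (D m)) F) ∧
      ∀ g : V → ℂ, MemLp g p → (∀ m, ∫ x, 𝓕 (D m) x * g x = 0) → SpectrumIn g F := by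
  rcases hp.eq_or_lt with rfl | hp1
  -- For p = 1 the dual exponent is ∞ and separability fails. The Fourier transform is moved onto
  -- `g`, which makes it bounded, and the tests are measured in L¹.
  · have : Fact ((1 : ℝ≥0∞) ≠ ∞) := ⟨ENNReal.one_ne_top⟩
    obtain ⟨D, h1, h2⟩ := exists_countable_tests_of_pairing (q := 1) (r := ∞)
      (fun φ : 𝓢(V, ℂ) => φ) F
    refine ⟨D, h1, fun g hg h => h2 g ⟨𝓕 g, ?_, fun φ => ?_⟩ h⟩
    · have hgi : Integrable g := memLp_one_iff_integrable.1 hg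
      have hcont : Continuous (𝓕 g) := VectorFourier.fourierIntegral_continuous
        Real.continuous_fourierChar (by exact continuous_inner) hgi
      exact memLp_top_of_bound hcont.aestronglyMeasurable (∫ v, ‖g v‖)
        (Filter.Eventually.of_forall fun w =>
          VectorFourier.norm_fourierIntegral_le_integral_norm _ _ _ _ _)
    · have hgi : Integrable g := memLp_one_iff_integrable.1 hg
      have := VectorFourier.integral_fourierIntegral_smul_eq_flip (μ := (volume : Measure V))
        (ν := (volume : Measure V)) (L := innerₗ V) Real.continuous_fourierChar
        (by exact continuous_inner) (φ.integrable) hgi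
      rw [flip_innerₗ] at this
      simp only [smul_eq_mul] at this
      rw [SchwartzMap.fourier_coe]
      refine this.trans (integral_congr_ae (Filter.Eventually.of_forall fun x => ?_))
      simp only
      rw [mul_comm]
      rfl
  · have hq := ENNReal.HolderConjugate.inv_one_sub_inv' hp
    have : Fact (1 ≤ p) := ⟨hp⟩
    have h1q : Fact (1 ≤ (1 - p⁻¹)⁻¹) := ⟨by simp⟩
    have hqt : Fact ((1 - p⁻¹)⁻¹ ≠ ∞) := ⟨by
      rw [Ne, ENNReal.inv_eq_top, tsub_eq_zero_iff_le, not_le]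
      exact ENNReal.inv_lt_one.2 hp1⟩
    obtain ⟨D, h1, h2⟩ := exists_countable_tests_of_pairing (q := (1 - p⁻¹)⁻¹) (r := p)
      (fun φ : 𝓢(V, ℂ) => 𝓕 φ) F
    refine ⟨D, h1, fun g hg h => h2 g ⟨g, hg, fun φ => ?_⟩ h⟩
    simp_rw [mul_comm]

end Tests

/-! ### Tensor products of test functions -/

section Tensor

variable {V W : Type*} [NormedAddCommGroup V] [NormedSpace ℝ V]
  [NormedAddCommGroup W] [NormedSpace ℝ W]

/-- The tensor product `(v, w) ↦ φ(v) ψ(w)` of two Schwartz functions. -/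
def schwartzTensor (φ : 𝓢(V, ℂ)) (ψ : 𝓢(W, ℂ)) : 𝓢(V × W, ℂ) where
  toFun := fun x => φ x.1 * ψ x.2
  smooth' := ((φ.smooth ⊤).comp contDiff_fst).mul ((ψ.smooth ⊤).comp contDiff_snd)
  decay' := by
    intro k n
    choose Dφ hφ0 hφ using fun k i => φ.decay k i
    choose Dψ hψ0 hψ using fun k i => ψ.decay k i
    have hfst : ∀ (i : ℕ) (x : V × W), ‖iteratedFDeriv ℝ i (fun y : V × W => φ y.1) x‖
        ≤ ‖iteratedFDeriv ℝ i φ x.1‖ := by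
      intro i x
      have h := (ContinuousLinearMap.fst ℝ V W).iteratedFDeriv_comp_right (φ.smooth ⊤) x (i := i)
        (by exact_mod_cast le_top)
      have h' : iteratedFDeriv ℝ i (fun y : V × W => φ y.1) x
          = (iteratedFDeriv ℝ i φ x.1).compContinuousLinearMap
            fun _ => ContinuousLinearMap.fst ℝ V W := h
      rw [h']
      refine (ContinuousMultilinearMap.norm_compContinuousLinearMap_le _ _).trans ?_
      refine mul_le_of_le_one_right (norm_nonneg _) (Finset.prod_le_one (fun _ _ => norm_nonneg _)
        fun _ _ => ContinuousLinearMap.norm_fst_le ℝ V W)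
    have hsnd : ∀ (i : ℕ) (x : V × W), ‖iteratedFDeriv ℝ i (fun y : V × W => ψ y.2) x‖
        ≤ ‖iteratedFDeriv ℝ i ψ x.2‖ := by
      intro i x
      have h := (ContinuousLinearMap.snd ℝ V W).iteratedFDeriv_comp_right (ψ.smooth ⊤) x (i := i)
        (by exact_mod_cast le_top)
      have h' : iteratedFDeriv ℝ i (fun y : V × W => ψ y.2) x
          = (iteratedFDeriv ℝ i ψ x.2).compContinuousLinearMap
            fun _ => ContinuousLinearMap.snd ℝ V W := h
      rw [h']
      refine (ContinuousMultilinearMap.norm_compContinuousLinearMap_le _ _).trans ?_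
      refine mul_le_of_le_one_right (norm_nonneg _) (Finset.prod_le_one (fun _ _ => norm_nonneg _)
        fun _ _ => ContinuousLinearMap.norm_snd_le ℝ V W)
    refine ⟨∑ i ∈ Finset.range (n + 1), (n.choose i : ℝ) *
      (Dφ k i * Dψ 0 (n - i) + Dφ 0 i * Dψ k (n - i)), fun x => ?_⟩
    have hle := norm_iteratedFDeriv_mul_le (𝕜 := ℝ) (N := (⊤ : ℕ∞))
      ((φ.smooth ⊤).comp (contDiff_fst (E := V) (F := W)))
      ((ψ.smooth ⊤).comp (contDiff_snd (E := V) (F := W))) x (n := n) (by exact_mod_cast le_top)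
    refine (mul_le_mul_of_nonneg_left hle (by positivity)).trans ?_
    rw [Finset.mul_sum]
    refine Finset.sum_le_sum fun i _ => ?_
    have h0φ : ‖iteratedFDeriv ℝ i φ x.1‖ ≤ Dφ 0 i := by simpa using hφ 0 i x.1
    have h0ψ : ‖iteratedFDeriv ℝ (n - i) ψ x.2‖ ≤ Dψ 0 (n - i) := by simpa using hψ 0 (n - i) x.2
    have hx : ‖x‖ ^ k ≤ ‖x.1‖ ^ k + ‖x.2‖ ^ k := by
      rcases le_total ‖x.1‖ ‖x.2‖ with h | h
      · rw [Prod.norm_def, max_eq_right h]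
        exact le_add_of_nonneg_left (by positivity)
      · rw [Prod.norm_def, max_eq_left h]
        exact le_add_of_nonneg_right (by positivity)
    calc ‖x‖ ^ k * ((n.choose i : ℝ) * ‖iteratedFDeriv ℝ i (⇑φ ∘ Prod.fst) x‖
          * ‖iteratedFDeriv ℝ (n - i) (⇑ψ ∘ Prod.snd) x‖)
        ≤ (‖x.1‖ ^ k + ‖x.2‖ ^ k) * ((n.choose i : ℝ) * ‖iteratedFDeriv ℝ i φ x.1‖
          * ‖iteratedFDeriv ℝ (n - i) ψ x.2‖) := by
          gcongr
          · exact hfst i x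
          · exact hsnd (n - i) x
      _ = (n.choose i : ℝ) * ((‖x.1‖ ^ k * ‖iteratedFDeriv ℝ i φ x.1‖)
          * ‖iteratedFDeriv ℝ (n - i) ψ x.2‖ + ‖iteratedFDeriv ℝ i φ x.1‖ *
          (‖x.2‖ ^ k * ‖iteratedFDeriv ℝ (n - i) ψ x.2‖)) := by ring
      _ ≤ _ := by
          gcongr
          · exact (hφ0 k i).le
          · exact hφ k i x.1
          · exact (hφ0 0 i).le
          · exact hψ k (n - i) x.2

theorem schwartzTensor_apply (φ : 𝓢(V, ℂ)) (ψ : 𝓢(W, ℂ)) (x : V × W) :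
    schwartzTensor φ ψ x = φ x.1 * ψ x.2 := rfl

end Tensor

/-! ### Spectra of slices -/

section Slice

variable {V X : Type*} [NormedAddCommGroup V] [InnerProductSpace ℝ V] [FiniteDimensional ℝ V]
  [MeasurableSpace V] [BorelSpace V] [NormedAddCommGroup X] [InnerProductSpace ℝ X]
  [FiniteDimensional ℝ X] [MeasurableSpace X] [BorelSpace X]

/-- An orthogonal splitting `X ≃ V × ℝ`. -/
structure IsOrthogonalSplitting (e : X ≃L[ℝ] V × ℝ) : Prop where
  measurePreserving : MeasurePreserving e
  inner_eq : ∀ x y, ⟪x, y⟫ = ⟪(e x).1, (e y).1⟫ + (e x).2 * (e y).2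

variable {e : X ≃L[ℝ] V × ℝ}

theorem IsOrthogonalSplitting.measurePreserving_symm (he : IsOrthogonalSplitting e) :
    MeasurePreserving e.symm :=
  MeasurePreserving.symm e.toHomeomorph.toMeasurableEquiv he.measurePreserving

/-- Orthogonality factors the character, measure preservation transports the integral to the
product, and Fubini separates the two variables. -/
theorem IsOrthogonalSplitting.fourier_tensor (he : IsOrthogonalSplitting e) (φ : 𝓢(V, ℂ))
    (ψ : 𝓢(ℝ, ℂ)) (x : X) :
    𝓕 (SchwartzMap.compCLMOfContinuousLinearEquiv ℂ e (schwartzTensor φ ψ)) x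
      = 𝓕 φ (e x).1 * 𝓕 ψ (e x).2 := by
  rw [SchwartzMap.fourier_coe, SchwartzMap.fourier_coe, SchwartzMap.fourier_coe, Real.fourier_eq,
    Real.fourier_eq, Real.fourier_eq, ← integral_prod_mul]
  rw [← Measure.volume_eq_prod]
  refine Eq.trans ?_ (he.measurePreserving.integral_comp
    e.toHomeomorph.measurableEmbedding (fun z : V × ℝ =>
      (𝐞 (-⟪z.1, (e x).1⟫) • φ z.1) * (𝐞 (-⟪z.2, (e x).2⟫) • ψ z.2)))
  refine integral_congr_ae (Filter.Eventually.of_forall fun y => ?_)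
  simp only [SchwartzMap.compCLMOfContinuousLinearEquiv_apply, Function.comp_apply,
    schwartzTensor_apply, he.inner_eq, neg_add, AddChar.map_add_eq_mul, Circle.smul_def,
    Circle.coe_mul, smul_eq_mul]
  have h : ⟪(e y).2, (e x).2⟫ = (e y).2 * (e x).2 := by simp [mul_comm]
  rw [h]
  ring

theorem IsOrthogonalSplitting.integrable_prod (he : IsOrthogonalSplitting e) {p : ℝ≥0∞}
    (hp : 1 ≤ p) {f : X → ℂ} (hf : MemLp f p) (φ : 𝓢(V, ℂ)) (ψ : 𝓢(ℝ, ℂ)) :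
    Integrable (fun z : V × ℝ => φ z.1 * ψ z.2 * f (e.symm z)) := by
  have h := integrable_schwartz_mul hp hf
    (SchwartzMap.compCLMOfContinuousLinearEquiv ℂ e (schwartzTensor φ ψ))
  have h2 := (he.measurePreserving_symm.integrable_comp_emb
    e.symm.toHomeomorph.measurableEmbedding).2 h
  refine h2.congr (Filter.Eventually.of_forall fun z => ?_)
  simp [schwartzTensor_apply]

/-- Integrating the slice pairing against an arbitrary smooth compactly supported g(s) gives the
pairing of `f` with the transform of φ ⊗ 𝓕⁻¹g. That tensor lives on the cylinder over the support of
φ, which avoids `E`, so the integral is 0. The exceptional null set depends on φ, which is why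
countably many tests are needed. -/
theorem IsOrthogonalSplitting.ae_integral_eq_zero (he : IsOrthogonalSplitting e) {p : ℝ≥0∞}
    (hp : 1 ≤ p) {f : X → ℂ} (hf : MemLp f p) {E : Set X} {F : Set V}
    (hE : ∀ x ∈ E, (e x).1 ∈ F) (hs : SpectrumIn f E) (φ : 𝓢(V, ℂ))
    (hφ : Disjoint (tsupport φ) F) :
    ∀ᵐ s : ℝ, ∫ v, 𝓕 φ v * f (e.symm (v, s)) = 0 := by
  have hint : ∀ ψ : 𝓢(ℝ, ℂ), Integrable (fun s => ψ s * ∫ v, 𝓕 φ v * f (e.symm (v, s))) := by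
    intro ψ
    have h1 := (he.integrable_prod hp hf (𝓕 φ) ψ)
    rw [Measure.volume_eq_prod] at h1
    refine h1.integral_prod_right.congr (Filter.Eventually.of_forall fun s => ?_)
    simp only
    rw [← integral_const_mul]
    refine integral_congr_ae (Filter.Eventually.of_forall fun v => ?_)
    simp only
    ring
  refine ae_eq_zero_of_integral_contDiff_smul_eq_zero ?_ ?_
  · intro s
    let χ : ContDiffBump s := ⟨1, 2, one_pos, one_lt_two⟩
    have hχ : ContDiff ℝ (⊤ : ℕ∞) (fun x => (χ x : ℂ)) :=
      Complex.ofRealCLM.contDiff.comp χ.contDiff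
    have hχc : HasCompactSupport (fun x => (χ x : ℂ)) :=
      χ.hasCompactSupport.comp_left (g := fun t : ℝ => (t : ℂ)) rfl
    refine ⟨Metric.closedBall s 1, Metric.closedBall_mem_nhds s one_pos, ?_⟩
    refine ((hint (hχc.toSchwartzMap hχ)).integrableOn (s := Metric.closedBall s 1)).congr_fun
      (fun t ht => ?_) measurableSet_closedBall
    have : χ t = 1 := χ.one_of_mem_closedBall ht
    simp [this]
  · intro g hg hgc
    have hg' : ContDiff ℝ (⊤ : ℕ∞) (fun x => (g x : ℂ)) := Complex.ofRealCLM.contDiff.comp hg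
    have hgc' : HasCompactSupport (fun x => (g x : ℂ)) :=
      hgc.comp_left (g := fun t : ℝ => (t : ℂ)) rfl
    let ψ : 𝓢(ℝ, ℂ) := hgc'.toSchwartzMap hg'
    -- The inverse transform in the second factor is chosen so that the transform of Θ carries g
    -- itself in the variable s. It need not have compact support: only the first factor has to
    -- avoid the spectrum.
    let Θ : 𝓢(X, ℂ) := SchwartzMap.compCLMOfContinuousLinearEquiv ℂ e (schwartzTensor φ (𝓕⁻ ψ))
    have hΘ : Disjoint (tsupport Θ) E := by
      have hsub : tsupport Θ ⊆ (fun x => (e x).1) ⁻¹' tsupport φ := by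
        refine closure_minimal (fun x hx => subset_closure ?_)
          ((isClosed_tsupport φ).preimage (by fun_prop))
        have hx' : φ (e x).1 * (𝓕⁻ ψ) (e x).2 ≠ 0 := hx
        exact left_ne_zero_of_mul hx'
      exact Set.disjoint_left.2 fun x h1 h2 => Set.disjoint_left.1 hφ (hsub h1) (hE x h2)
    have h0 := hs Θ hΘ
    have h1 : ∫ x, 𝓕 Θ x * f x = ∫ z : V × ℝ, 𝓕 φ z.1 * ψ z.2 * f (e.symm z) := by
      rw [← he.measurePreserving.integral_comp e.toHomeomorph.measurableEmbedding]
      refine integral_congr_ae (Filter.Eventually.of_forall fun x => ?_)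
      simp only [Θ]
      rw [he.fourier_tensor, FourierTransform.fourier_fourierInv_eq,
        ContinuousLinearEquiv.symm_apply_apply]
    have h2 := he.integrable_prod hp hf (𝓕 φ) ψ
    rw [Measure.volume_eq_prod] at h1 h2
    rw [integral_prod_symm _ h2] at h1
    rw [← h0, h1]
    refine integral_congr_ae (Filter.Eventually.of_forall fun s => ?_)
    have h3 : ψ s = (g s : ℂ) := rfl
    simp only [h3, Complex.real_smul]
    rw [← integral_const_mul]
    refine integral_congr_ae (Filter.Eventually.of_forall fun v => ?_)
    simp only
    ring

theorem IsOrthogonalSplitting.lpPow_eq (he : IsOrthogonalSplitting e) {p : ℝ≥0∞} {f : X → ℂ}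
    (hf : AEStronglyMeasurable f) :
    lpPow p f = ∫⁻ s : ℝ, lpPow p (fun v => f (e.symm (v, s))) := by
  have h1 : lpPow p f = ∫⁻ z : V × ℝ, ‖f (e.symm z)‖ₑ ^ p.toReal :=
    (MeasurePreserving.lintegral_comp_emb he.measurePreserving_symm
      e.symm.toHomeomorph.measurableEmbedding (fun x => ‖f x‖ₑ ^ p.toReal)).symm
  rw [h1, Measure.volume_eq_prod, lintegral_prod_symm]
  · rfl
  · rw [← Measure.volume_eq_prod]
    exact (hf.comp_measurePreserving he.measurePreserving_symm).enorm.pow_const _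

theorem IsOrthogonalSplitting.ae_memLp (he : IsOrthogonalSplitting e) {p : ℝ≥0∞} (hp : 1 ≤ p)
    (hp' : p ≠ ∞) {f : X → ℂ} (hf : MemLp f p) :
    ∀ᵐ s : ℝ, MemLp (fun v => f (e.symm (v, s))) p := by
  have h0 : p ≠ 0 := (zero_lt_one.trans_le hp).ne'
  have hm := hf.1.comp_measurePreserving he.measurePreserving_symm
  rw [Measure.volume_eq_prod] at hm
  have h1 : ∀ᵐ s : ℝ, AEStronglyMeasurable (fun v => f (e.symm (v, s))) := by
    exact (hm.comp_measurePreserving Measure.measurePreserving_swap).prodMk_left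
  have h2 : ∀ᵐ s : ℝ, lpPow p (fun v => f (e.symm (v, s))) < ∞ := by
    refine ae_lt_top' ?_ ?_
    · exact (hm.enorm.pow_const p.toReal).lintegral_prod_left'
    · rw [← he.lpPow_eq hf.1]
      exact lpPow_ne_top hp hp' hf
  filter_upwards [h1, h2] with s hs1 hs2
  refine ⟨hs1, ?_⟩
  rw [eLpNorm_lt_top_iff_lintegral_rpow_enorm_lt_top h0 hp']
  exact hs2

/-- Almost all slices of a function have their spectrum in the projection of its spectrum. -/
theorem IsOrthogonalSplitting.ae_spectrumIn (he : IsOrthogonalSplitting e) {p : ℝ≥0∞}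
    (hp : 1 ≤ p) (hp' : p ≠ ∞) {f : X → ℂ} (hf : MemLp f p) {E : Set X} {F : Set V}
    (hE : ∀ x ∈ E, (e x).1 ∈ F) (hs : SpectrumIn f E) :
    ∀ᵐ s : ℝ, SpectrumIn (fun v => f (e.symm (v, s))) F := by
  obtain ⟨D, hD1, hD2⟩ := exists_countable_tests (V := V) hp F
  have h1 : ∀ᵐ s : ℝ, ∀ m, ∫ v, 𝓕 (D m) v * f (e.symm (v, s)) = 0 :=
    ae_all_iff.2 fun m => he.ae_integral_eq_zero hp hf hE hs (D m) (hD1 m)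
  filter_upwards [h1, he.ae_memLp hp hp' hf] with s hs1 hs2
  exact hD2 _ hs2 hs1

end Slice

/-- `B` bounds the quadratic forms `P` and their polar forms in the sup norm. -/
def FormBound {ι : Type} [Fintype ι] {n : ℕ} (P : Fin n → QuadraticForm ℝ (ι → ℝ)) (B : ℝ) :
    Prop :=
  0 ≤ B ∧ ∀ j, (∀ x, |P j x| ≤ B * ‖x‖ ^ 2) ∧
    ∀ x y, |QuadraticMap.polar (P j) x y| ≤ B * ‖x‖ * ‖y‖

theorem exists_formBound {ι : Type} [Fintype ι] {n : ℕ} (P : Fin n → QuadraticForm ℝ (ι → ℝ)) :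
    ∃ B, FormBound P B := by
  let T : Fin n → (ι → ℝ) →L[ℝ] (ι → ℝ) →L[ℝ] ℝ := fun j =>
    LinearMap.toContinuousBilinearMap (P j).polarBilin
  have hB0 : 0 ≤ ∑ j, ‖T j‖ := Finset.sum_nonneg fun j _ => (T j).opNorm_nonneg
  have hpol : ∀ j x y, |QuadraticMap.polar (P j) x y| ≤ (∑ j, ‖T j‖) * ‖x‖ * ‖y‖ := by
    intro j x y
    refine ((T j).le_opNorm₂ x y).trans ?_
    gcongr
    exact Finset.single_le_sum (f := fun j => ‖T j‖) (fun j _ => (T j).opNorm_nonneg) (Finset.mem_univ j)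
  refine ⟨∑ j, ‖T j‖, hB0, fun j => ⟨fun x => ?_, hpol j⟩⟩
  have h1 := hpol j x x
  have h2 := QuadraticMap.polar_self (P j) x
  rw [h2, two_nsmul, ← two_mul, abs_mul, abs_two] at h1
  nlinarith [abs_nonneg (P j x)]

/-! ### Hyperplanes as graphs -/

section GraphMap

variable {ι : Type} [Fintype ι] [DecidableEq ι] (i : ι) (b : {l : ι // l ≠ i} → ℝ)

theorem graphMap_apply_self (x : {l : ι // l ≠ i} → ℝ) : graphMap i b x i = ∑ l, b l * x l := by
  simp [graphMap]

theorem graphMap_apply_of_ne (x : {l : ι // l ≠ i} → ℝ) (l : {l : ι // l ≠ i}) :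
    graphMap i b x l = x l := by
  simp [graphMap, l.2]

theorem abs_sum_mul_le (hb : ∀ l, |b l| ≤ 1) (x : {l : ι // l ≠ i} → ℝ) {r : ℝ} (hr : 0 ≤ r)
    (hx : ∀ l, |x l| ≤ r) : |∑ l, b l * x l| ≤ Fintype.card ι * r := by
  calc |∑ l, b l * x l| ≤ ∑ l, |b l * x l| := Finset.abs_sum_le_sum_abs _ _
    _ ≤ ∑ _l : {l : ι // l ≠ i}, r := by
        refine Finset.sum_le_sum fun l _ => ?_
        rw [abs_mul]
        exact (mul_le_mul (hb l) (hx l) (abs_nonneg _) zero_le_one).trans_eq (one_mul r)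
    _ ≤ Fintype.card ι * r := by
        rw [Finset.sum_const, nsmul_eq_mul, Finset.card_univ]
        gcongr
        exact Fintype.card_subtype_le _

theorem norm_graphMap_le (hb : ∀ l, |b l| ≤ 1) (x : {l : ι // l ≠ i} → ℝ) :
    ‖graphMap i b x‖ ≤ (Fintype.card ι + 1) * ‖x‖ := by
  refine (pi_norm_le_iff_of_nonneg (by positivity)).2 fun k => ?_
  rw [Real.norm_eq_abs]
  by_cases hk : k = i
  · subst hk
    rw [graphMap_apply_self]
    have := abs_sum_mul_le k b hb x (norm_nonneg x) fun l => norm_le_pi_norm x l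
    linarith [norm_nonneg x]
  · have h1 := graphMap_apply_of_ne i b x ⟨k, hk⟩
    simp only at h1
    rw [h1]
    have h2 : |x ⟨k, hk⟩| ≤ ‖x‖ := norm_le_pi_norm x ⟨k, hk⟩
    have h3 : 0 ≤ (Fintype.card ι : ℝ) * ‖x‖ := by positivity
    linarith

end GraphMap

/-! ### Parabolic rescaling -/

section Rescaling

variable {ι : Type} [Fintype ι] {n : ℕ}

/-- The linear map `(T, Y) ↦ (r T, r ∇P(a) T + r² Y)`. -/
def parabolicScaling (P : Fin n → QuadraticForm ℝ (ι → ℝ)) (a : ι → ℝ) (r : ℝ) (hr : r ≠ 0) :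
    Ambient ι n ≃L[ℝ] Ambient ι n :=
  LinearEquiv.toContinuousLinearEquiv
    { toFun := fun z => WithLp.toLp 2 (Sum.elim (fun i => r * z (Sum.inl i))
        (fun j => r * (P j).polarBilin a (fun i => z (Sum.inl i)) + r ^ 2 * z (Sum.inr j)))
      invFun := fun z => WithLp.toLp 2 (Sum.elim (fun i => r⁻¹ * z (Sum.inl i))
        (fun j => r⁻¹ ^ 2 * (z (Sum.inr j) - (P j).polarBilin a (fun i => z (Sum.inl i)))))
      map_add' := fun z w => by
        ext (i | j)
        · simp [mul_add]
        · have : (fun i => (z + w) (Sum.inl i)) = (fun i => z (Sum.inl i))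
            + fun i => w (Sum.inl i) := by ext; simp
          have h2 := congrArg ((P j).polarBilin a) this
          rw [map_add] at h2
          simp only [PiLp.add_apply, Sum.elim_inr] at h2 ⊢
          rw [h2]
          ring
      map_smul' := fun c z => by
        ext (i | j)
        · simp only [PiLp.smul_apply, Sum.elim_inl, smul_eq_mul, RingHom.id_apply]
          ring
        · have : (fun i => (c • z) (Sum.inl i)) = c • (fun i => z (Sum.inl i)) := by ext; simp
          have h2 := congrArg ((P j).polarBilin a) this
          rw [map_smul] at h2
          simp only [PiLp.smul_apply, Sum.elim_inr, smul_eq_mul, RingHom.id_apply] at h2 ⊢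
          rw [h2]
          ring
      left_inv := fun z => by
        ext (i | j)
        · simp [hr]
        · have : (fun i => r * z (Sum.inl i)) = r • (fun i => z (Sum.inl i)) := by ext; simp
          simp only [Sum.elim_inr, Sum.elim_inl, this, map_smul, smul_eq_mul]
          field_simp
          ring
      right_inv := fun z => by
        ext (i | j)
        · simp [hr]
        · have : (fun i => r⁻¹ * z (Sum.inl i)) = r⁻¹ • (fun i => z (Sum.inl i)) := by ext; simp
          simp only [Sum.elim_inr, Sum.elim_inl, this, map_smul, smul_eq_mul]
          field_simp
          ring }

theorem parabolicScaling_inl (P : Fin n → QuadraticForm ℝ (ι → ℝ)) (a : ι → ℝ) (r : ℝ)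
    (hr : r ≠ 0) (z : Ambient ι n) (i : ι) :
    parabolicScaling P a r hr z (Sum.inl i) = r * z (Sum.inl i) := rfl

theorem parabolicScaling_inr (P : Fin n → QuadraticForm ℝ (ι → ℝ)) (a : ι → ℝ) (r : ℝ)
    (hr : r ≠ 0) (z : Ambient ι n) (j : Fin n) :
    parabolicScaling P a r hr z (Sum.inr j)
      = r * QuadraticMap.polar (P j) a (fun i => z (Sum.inl i)) + r ^ 2 * z (Sum.inr j) := rfl

/-- The point `(a, P(a))`. -/
def graphPoint (P : Fin n → QuadraticForm ℝ (ι → ℝ)) (a : ι → ℝ) : Ambient ι n :=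
  WithLp.toLp 2 (Sum.elim a fun j => P j a)

/-- The expansion P(a + rT) = P(a) + r ∇P(a)·T + r² P(T) is exact, so the linear terms cancel and
the vertical distance to the surface is multiplied by exactly r². -/
theorem parabolicScaling_sub_form (P : Fin n → QuadraticForm ℝ (ι → ℝ)) (a : ι → ℝ) (r : ℝ)
    (hr : r ≠ 0) (z : Ambient ι n) (j : Fin n) :
    (graphPoint P a + parabolicScaling P a r hr z) (Sum.inr j)
      - P j (fun i => (graphPoint P a + parabolicScaling P a r hr z) (Sum.inl i))
      = r ^ 2 * (z (Sum.inr j) - P j fun i => z (Sum.inl i)) := by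
  have h1 : (fun i => (graphPoint P a + parabolicScaling P a r hr z) (Sum.inl i))
      = a + r • fun i => z (Sum.inl i) := by
    ext i
    simp [graphPoint, parabolicScaling_inl]
  rw [h1, QuadraticMap.map_add (P j), QuadraticMap.map_smul, QuadraticMap.polar_smul_right,
    PiLp.add_apply, parabolicScaling_inr]
  simp only [graphPoint, Sum.elim_inr, smul_eq_mul]
  ring

end Rescaling

/-! ### Splitting off one coordinate -/

section Splitting

variable {ι : Type} [Fintype ι] [DecidableEq ι] (n : ℕ) (i : ι)

/-- Splitting off the coordinate `t_i` of a point `(t, y)`. -/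
def splitLinearEquiv : Ambient ι n ≃ₗ[ℝ] Ambient {l : ι // l ≠ i} n × ℝ where
  toFun := fun z => (WithLp.toLp 2 (Sum.elim (fun l => z (Sum.inl l.1))
    fun j => z (Sum.inr j)), z (Sum.inl i))
  invFun := fun w => WithLp.toLp 2 (Sum.elim
    (fun l => if h : l = i then w.2 else w.1 (Sum.inl ⟨l, h⟩))
    fun j => w.1 (Sum.inr j))
  map_add' := fun z w => by
    ext (l | j) <;> simp
  map_smul' := fun c z => by
    ext (l | j) <;> simp
  left_inv := fun z => by
    ext (l | j)
    · by_cases h : l = i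
      · subst h; simp
      · simp [h]
    · simp
  right_inv := fun w => by
    ext (l | j)
    · simp [l.2]
    · simp
    · simp

/-- Splitting off the coordinate `t_i` of a point `(t, y)`, as a topological isomorphism. -/
def coordSplit : Ambient ι n ≃L[ℝ] Ambient {l : ι // l ≠ i} n × ℝ :=
  (splitLinearEquiv n i).toContinuousLinearEquiv

theorem inner_coordSplit (x y : Ambient ι n) :
    ⟪x, y⟫ = ⟪(coordSplit n i x).1, (coordSplit n i y).1⟫
      + (coordSplit n i x).2 * (coordSplit n i y).2 := by
  rw [PiLp.inner_apply, PiLp.inner_apply, Fintype.sum_sum_type,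
    Fintype.sum_sum_type, Fintype.sum_eq_add_sum_subtype_ne _ i]
  simp [coordSplit, splitLinearEquiv]
  ring

theorem isOrthogonalSplitting_coordSplit : IsOrthogonalSplitting (coordSplit n i) where
  measurePreserving := by
    -- With the Euclidean norm on the product the splitting is an isometry, hence preserves volume;
    -- replacing that norm by the product norm does not change the measure.
    let L : Ambient ι n ≃ₗ[ℝ] WithLp 2 (Ambient {l : ι // l ≠ i} n × ℝ) :=
      (splitLinearEquiv n i).trans (WithLp.linearEquiv 2 ℝ _).symm
    have hL : ∀ x y, ⟪L x, L y⟫ = ⟪x, y⟫ := fun x y => by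
      rw [inner_coordSplit n i x y, WithLp.prod_inner_apply]
      have : ∀ s t : ℝ, ⟪s, t⟫ = s * t := fun s t => by simp [mul_comm]
      rw [this]
      rfl
    have h1 := (L.isometryOfInner hL).measurePreserving
    exact (WithLp.volume_preserving_ofLp (Ambient {l : ι // l ≠ i} n) ℝ).comp h1
  inner_eq := inner_coordSplit n i

theorem coordSplit_fst_inl (z : Ambient ι n) (l : {l : ι // l ≠ i}) :
    (coordSplit n i z).1 (Sum.inl l) = z (Sum.inl l.1) := rfl

theorem coordSplit_fst_inr (z : Ambient ι n) (j : Fin n) :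
    (coordSplit n i z).1 (Sum.inr j) = z (Sum.inr j) := rfl

end Splitting

/-! ### Projection of the spectrum along a hyperplane direction -/

section Box

variable {ι : Type} [Fintype ι] [DecidableEq ι] {n : ℕ}

/-- A point close to the surface over a hyperplane through `0` projects into the parallelepipeds
of the forms restricted to that hyperplane. -/
theorem coordSplit_mem_uncertaintyBox {P : Fin n → QuadraticForm ℝ (ι → ℝ)} {B C : ℝ}
    (hB : FormBound P B) (hC : 2 + 8 * B * (Fintype.card ι + 1) ^ 2 ≤ C) {i : ι}
    {b : {l : ι // l ≠ i} → ℝ} (hb : ∀ l, |b l| ≤ 1) {e : ℕ}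
    (θ : DyadicCube {l : ι // l ≠ i} e) (z : Ambient ι n)
    (h1 : ∀ l : {l : ι // l ≠ i}, |z (Sum.inl l.1) - corner θ l| ≤ 2 * (1 / 2 ^ e))
    (h2 : |z (Sum.inl i) - ∑ l : {l : ι // l ≠ i}, b l * z (Sum.inl l.1)| ≤ (1 / 2 ^ e) ^ 2)
    (h3 : ∀ j, |z (Sum.inr j) - P j fun l => z (Sum.inl l)| ≤ (1 / 2 ^ e) ^ 2) :
    (coordSplit n i z).1 ∈ uncertaintyBox (fun j => (P j).comp (graphMap i b)) C θ := by
  obtain ⟨hB0, hP⟩ := hB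
  set δ : ℝ := 1 / 2 ^ e with hδ
  have hδ0 : 0 < δ := by positivity
  have hδ1 : δ ≤ 1 := by
    rw [hδ, div_le_one (by positivity)]
    exact one_le_pow₀ one_le_two
  set N : ℝ := (Fintype.card ι : ℝ) with hN
  have hN0 : 0 ≤ N := by positivity
  rw [mem_uncertaintyBox_iff]
  simp only [coordSplit_fst_inl, coordSplit_fst_inr]
  refine ⟨fun l => (h1 l).trans ?_, fun j => ?_⟩
  · refine mul_le_mul_of_nonneg_right ?_ hδ0.le
    have : 0 ≤ 8 * B * (N + 1) ^ 2 := by positivity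
    linarith
  · obtain ⟨hP1, hP2⟩ := hP j
    set T : {l : ι // l ≠ i} → ℝ := fun l => z (Sum.inl l.1) with hT
    set w : {l : ι // l ≠ i} → ℝ := fun l => z (Sum.inl l.1) - corner θ l with hw
    have hwn : ‖w‖ ≤ 2 * δ := (pi_norm_le_iff_of_nonneg (by positivity)).2 h1
    have hcor : ‖corner θ‖ ≤ 1 := by
      refine (pi_norm_le_iff_of_nonneg zero_le_one).2 fun l => ?_
      rw [Real.norm_eq_abs, corner, abs_of_nonneg (by positivity), div_le_one (by positivity)]
      exact_mod_cast (θ l).2.le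
    have hTw : T = corner θ + w := by ext l; simp [hT, hw]
    have hTn : ‖T‖ ≤ 3 := by
      rw [hTw]
      refine (norm_add_le _ _).trans ?_
      linarith
    set g := graphMap i b T with hg
    have hgn : ‖g‖ ≤ (N + 1) * 3 := (norm_graphMap_le i b hb T).trans (by gcongr)
    set s : ℝ := z (Sum.inl i) - ∑ l : {l : ι // l ≠ i}, b l * z (Sum.inl l.1) with hs
    set u : ι → ℝ := Pi.single i s with hu
    have hun : ‖u‖ ≤ δ ^ 2 := by
      rw [hu, Pi.norm_single]
      exact h2
    have hz : (fun l => z (Sum.inl l)) = g + u := by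
      ext l
      by_cases hl : l = i
      · subst hl
        simp [hg, graphMap_apply_self, hu, hs, hT]
      · have := graphMap_apply_of_ne i b T ⟨l, hl⟩
        simp only at this
        rw [Pi.add_apply, hu, Pi.single_eq_of_ne hl, add_zero, hg]
        exact this.symm
    -- The point is g + u with g on the hyperplane and |u| ≤ δ². The four terms are at most δ², Bδ²,
    -- 3B(N+1)δ² and 4B(N+1)²δ². Their sum is at most (1 + 8B(N+1)²)δ², whence the lower bound
    -- imposed on C; its summand 2 also covers the horizontal tolerance 2δ.
    have e1 : z (Sum.inr j) - ((P j).comp (graphMap i b)) (corner θ)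
        - QuadraticMap.polar ((P j).comp (graphMap i b)) (corner θ) w
        = (z (Sum.inr j) - P j fun l => z (Sum.inl l)) + P j u + QuadraticMap.polar (P j) g u
          + P j (graphMap i b w) := by
      have a1 : P j g = ((P j).comp (graphMap i b)) T := rfl
      have a2 := QuadraticMap.map_add ((P j).comp (graphMap i b)) (corner θ) w
      rw [← hTw] at a2
      have a3 : ((P j).comp (graphMap i b)) w = P j (graphMap i b w) := rfl
      rw [hz, QuadraticMap.map_add (P j) g u, a1, a2, a3]
      ring
    rw [e1]
    have b1 : |P j u| ≤ B * δ ^ 2 := (hP1 u).trans (by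
      refine mul_le_mul_of_nonneg_left ?_ hB0
      calc ‖u‖ ^ 2 ≤ (δ ^ 2) ^ 2 := by gcongr
        _ ≤ δ ^ 2 := by
          refine pow_le_of_le_one (by positivity) (pow_le_one₀ hδ0.le hδ1) two_ne_zero)
    have b2 : |QuadraticMap.polar (P j) g u| ≤ B * ((N + 1) * 3) * δ ^ 2 :=
      (hP2 g u).trans (by gcongr)
    have b3 : |P j (graphMap i b w)| ≤ B * ((N + 1) * (2 * δ)) ^ 2 := (hP1 _).trans (by
      gcongr
      exact (norm_graphMap_le i b hb w).trans (by gcongr))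
    have b4 := h3 j
    have hBN : B ≤ B * (N + 1) := le_mul_of_one_le_right hB0 (by linarith)
    have hBN2 : B * (N + 1) ≤ B * (N + 1) ^ 2 := by
      rw [pow_two, ← mul_assoc]
      exact le_mul_of_one_le_right (by positivity) (by linarith)
    calc |_ + P j u + QuadraticMap.polar (P j) g u + P j (graphMap i b w)|
        ≤ δ ^ 2 + B * δ ^ 2 + B * ((N + 1) * 3) * δ ^ 2 + B * ((N + 1) * (2 * δ)) ^ 2 := by
          refine (abs_add_le _ _).trans (add_le_add ?_ b3)
          refine (abs_add_le _ _).trans (add_le_add ?_ b2)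
          exact (abs_add_le _ _).trans (add_le_add b4 b1)
      _ = (1 + B + 3 * (B * (N + 1)) + 4 * (B * (N + 1) ^ 2)) * δ ^ 2 := by ring
      _ ≤ C * δ ^ 2 := by
          gcongr
          linarith

end Box

/-! ### Decoupling one cube near a hyperplane -/

section Step

variable {ι : Type} {a e : ℕ}

/-- The position of a cube of level `a + e` inside its ancestor of level `a`, projected along the
`i`-th coordinate. -/
def relativeFace (i : ι) (τ : DyadicCube ι (a + e)) : DyadicCube {l : ι // l ≠ i} e :=
  fun l => ⟨(τ l.1 : ℕ) % 2 ^ e, Nat.mod_lt _ (by positivity)⟩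

theorem corner_eq_add_relative {τ : DyadicCube ι (a + e)} {τ₀ : DyadicCube ι a}
    (h : ∀ l, (τ l : ℕ) / 2 ^ e = τ₀ l) (i : ι) (l : {l : ι // l ≠ i}) :
    corner τ l.1 = corner τ₀ l.1 + 1 / 2 ^ a * corner (relativeFace i τ) l := by
  have h1 : (τ l.1 : ℕ) = 2 ^ e * (τ₀ l.1 : ℕ) + (τ l.1 : ℕ) % 2 ^ e := by
    rw [← h l.1]
    exact (Nat.div_add_mod _ _).symm
  have h2 : ((τ l.1 : ℕ) : ℝ) = 2 ^ e * ((τ₀ l.1 : ℕ) : ℝ) + (((τ l.1 : ℕ) % 2 ^ e : ℕ) : ℝ) := by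
    exact_mod_cast h1
  simp only [corner, relativeFace]
  rw [h2, show (2 : ℝ) ^ (a + e) = 2 ^ a * 2 ^ e from pow_add _ _ _]
  field_simp

/-- Within a fibre a cube is determined by its `i`-th index, and the hyperplane confines that index
to an interval of length 2N, which contains at most 2N + 1 integers. -/
theorem card_fiber_relativeFace_le [Fintype ι] [DecidableEq ι] {τ₀ : DyadicCube ι a}
    {T : Finset (DyadicCube ι (a + e))} (hT : ∀ τ ∈ T, ∀ l, (τ l : ℕ) / 2 ^ e = τ₀ l) (i : ι)
    (b : {l : ι // l ≠ i} → ℝ) (h : ℝ) (N : ℕ)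
    (hN : ∀ τ ∈ T, |corner τ i - (h + ∑ l : {l : ι // l ≠ i}, b l * corner τ l.1)|
      ≤ N * (1 / 2 ^ (a + e))) (θ : DyadicCube {l : ι // l ≠ i} e) :
    (T.filter fun τ => relativeFace i τ = θ).card ≤ 2 * N + 1 := by
  set c : ℝ := h + ∑ l : {l : ι // l ≠ i}, b l * (corner τ₀ l.1 + 1 / 2 ^ a * corner θ l) with hc
  set m : ℤ := ⌈c * 2 ^ (a + e) - N⌉ with hm
  have hinj : Set.InjOn (fun τ : DyadicCube ι (a + e) => ((τ i : ℕ) : ℤ))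
      (T.filter fun τ => relativeFace i τ = θ) := by
    intro τ hτ τ' hτ' heq
    simp only [Finset.coe_filter, Set.mem_ofPred_eq] at hτ hτ'
    funext l
    apply Fin.ext
    by_cases hl : l = i
    · subst hl
      exact Int.ofNat_injective heq
    · have h1 := congrArg Fin.val (congrFun (hτ.2.trans hτ'.2.symm) ⟨l, hl⟩)
      simp only [relativeFace] at h1
      rw [← Nat.div_add_mod (τ l : ℕ) (2 ^ e), ← Nat.div_add_mod (τ' l : ℕ) (2 ^ e), h1,
        hT τ hτ.1 l, hT τ' hτ'.1 l]
  have hsub : (T.filter fun τ => relativeFace i τ = θ).image (fun τ => ((τ i : ℕ) : ℤ))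
      ⊆ Finset.Icc m (m + 2 * N) := by
    intro z hz
    obtain ⟨τ, hτ, rfl⟩ := Finset.mem_image.1 hz
    obtain ⟨hτ1, hτ2⟩ := Finset.mem_filter.1 hτ
    have h1 := hN τ hτ1
    have h2 : h + ∑ l : {l : ι // l ≠ i}, b l * corner τ l.1 = c := by
      rw [hc]
      congr 1
      refine Finset.sum_congr rfl fun l _ => ?_
      rw [corner_eq_add_relative (hT τ hτ1) i l, hτ2]
    rw [h2, corner, abs_le] at h1
    have hpos : (0 : ℝ) < 2 ^ (a + e) := by positivity
    have h3 : (((τ i : ℕ) : ℤ) : ℝ) ≤ c * 2 ^ (a + e) + N := by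
      have := mul_le_mul_of_nonneg_right h1.2 hpos.le
      rw [sub_mul, div_mul_cancel₀ _ hpos.ne', mul_assoc, one_div,
        inv_mul_cancel₀ hpos.ne'] at this
      push_cast
      linarith
    have h4 : c * 2 ^ (a + e) - N ≤ (((τ i : ℕ) : ℤ) : ℝ) := by
      have := mul_le_mul_of_nonneg_right h1.1 hpos.le
      rw [sub_mul, div_mul_cancel₀ _ hpos.ne', neg_mul, mul_assoc, one_div,
        inv_mul_cancel₀ hpos.ne'] at this
      push_cast
      linarith
    rw [Finset.mem_Icc]
    refine ⟨Int.ceil_le.2 h4, ?_⟩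
    have h5 := Int.le_ceil (c * 2 ^ (a + e) - N)
    rw [← hm] at h5
    have : (((τ i : ℕ) : ℤ) : ℝ) ≤ ((m + 2 * N : ℤ) : ℝ) := by
      push_cast at h3 ⊢
      linarith
    exact_mod_cast this
  calc (T.filter fun τ => relativeFace i τ = θ).card
      = ((T.filter fun τ => relativeFace i τ = θ).image (fun τ => ((τ i : ℕ) : ℤ))).card :=
        (Finset.card_image_of_injOn hinj).symm
    _ ≤ (Finset.Icc m (m + 2 * N)).card := Finset.card_le_card hsub
    _ = 2 * N + 1 := by
        rw [Int.card_Icc]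
        omega

theorem IsOrthogonalSplitting.aemeasurable_lpPow {V X : Type*} [NormedAddCommGroup V]
    [InnerProductSpace ℝ V] [FiniteDimensional ℝ V] [MeasurableSpace V] [BorelSpace V]
    [NormedAddCommGroup X] [InnerProductSpace ℝ X] [FiniteDimensional ℝ X] [MeasurableSpace X]
    [BorelSpace X] {e : X ≃L[ℝ] V × ℝ} (he : IsOrthogonalSplitting e) (p : ℝ≥0∞) {f : X → ℂ}
    (hf : AEStronglyMeasurable f) :
    AEMeasurable fun s : ℝ => lpPow p fun v => f (e.symm (v, s)) := by
  have hm := hf.comp_measurePreserving he.measurePreserving_symm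
  rw [Measure.volume_eq_prod] at hm
  exact (hm.enorm.pow_const p.toReal).lintegral_prod_left'

variable [Fintype ι] [DecidableEq ι] {n : ℕ}

/-- Decoupling of a function whose spectrum lies near the part of the surface over a hyperplane
through `0`, in terms of the lower-dimensional inequality for that hyperplane. -/
theorem lpPow_sum_le_of_hyperplane_zero {P : Fin n → QuadraticForm ℝ (ι → ℝ)} {B C : ℝ}
    (hB : FormBound P B) (hC : 2 + 8 * B * (Fintype.card ι + 1) ^ 2 ≤ C) {p : ℝ≥0∞} (hp : 1 ≤ p)
    (hp' : p ≠ ∞) {i : ι} {b : {l : ι // l ≠ i} → ℝ} (hb : ∀ l, |b l| ≤ 1) {M : ℝ}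
    (hM : DecouplesPow (fun j => (P j).comp (graphMap i b)) C p
      (Finset.univ : Finset (DyadicCube {l : ι // l ≠ i} e)) M)
    {κ : Type*} (T : Finset κ) (π : κ → DyadicCube {l : ι // l ≠ i} e) {N : ℕ}
    (hN : ∀ θ, (T.filter fun τ => π τ = θ).card ≤ N) (F : κ → Ambient ι n → ℂ)
    (hF : ∀ τ ∈ T, MemLp (F τ) p)
    (hs : ∀ τ ∈ T, SpectrumIn (F τ) {z |
      (∀ l : {l : ι // l ≠ i}, |z (Sum.inl l.1) - corner (π τ) l| ≤ 2 * (1 / 2 ^ e)) ∧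
      |z (Sum.inl i) - ∑ l : {l : ι // l ≠ i}, b l * z (Sum.inl l.1)| ≤ (1 / 2 ^ e) ^ 2 ∧
      ∀ j, |z (Sum.inr j) - P j fun l => z (Sum.inl l)| ≤ (1 / 2 ^ e) ^ 2}) :
    lpPow p (fun x => ∑ τ ∈ T, F τ x)
      ≤ (ENNReal.ofReal M * N) ^ p.toReal * ∑ τ ∈ T, lpPow p (F τ) := by
  have hpos : 0 < p.toReal := ENNReal.toReal_pos (zero_lt_one.trans_le hp).ne' hp'
  set E := coordSplit n i with hE
  have he : IsOrthogonalSplitting E := isOrthogonalSplitting_coordSplit n i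
  have hmem : ∀ᵐ s : ℝ, ∀ τ ∈ T, MemLp (fun v => F τ (E.symm (v, s))) p := by
    rw [Filter.eventually_all_finset]
    exact fun τ hτ => he.ae_memLp hp hp' (hF τ hτ)
  have hspec : ∀ᵐ s : ℝ, ∀ τ ∈ T, SpectrumIn (fun v => F τ (E.symm (v, s)))
      (uncertaintyBox (fun j => (P j).comp (graphMap i b)) C (π τ)) := by
    rw [Filter.eventually_all_finset]
    refine fun τ hτ => he.ae_spectrumIn hp hp' (hF τ hτ) (fun z hz => ?_) (hs τ hτ)
    exact coordSplit_mem_uncertaintyBox hB hC hb (π τ) z hz.1 hz.2.1 hz.2.2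
  have hslice : ∀ᵐ s : ℝ, lpPow p (fun v => ∑ τ ∈ T, F τ (E.symm (v, s)))
      ≤ (ENNReal.ofReal M * N) ^ p.toReal * ∑ τ ∈ T, lpPow p (fun v => F τ (E.symm (v, s))) := by
    filter_upwards [hmem, hspec] with s h1 h2
    -- On a fixed slice all functions whose cubes have the same projected cube are grouped. The
    -- lower-dimensional inequality separates the groups, and the triangle inequality inside a group
    -- costs at most N.
    let g : DyadicCube {l : ι // l ≠ i} e → Ambient {l : ι // l ≠ i} n → ℂ := fun θ v =>
      ∑ τ ∈ T with π τ = θ, F τ (E.symm (v, s))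
    have hg1 : ∀ θ ∈ (Finset.univ : Finset (DyadicCube {l : ι // l ≠ i} e)), MemLp (g θ) p :=
      fun θ _ => memLp_finsetSum _ fun τ hτ => h1 τ (Finset.mem_filter.1 hτ).1
    have hg2 : ∀ θ ∈ (Finset.univ : Finset (DyadicCube {l : ι // l ≠ i} e)),
        SpectrumIn (g θ) (uncertaintyBox (fun j => (P j).comp (graphMap i b)) C θ) := by
      refine fun θ _ => SpectrumIn.sum hp (fun τ hτ => h1 τ (Finset.mem_filter.1 hτ).1)
        fun τ hτ => ?_
      obtain ⟨hτ1, hτ2⟩ := Finset.mem_filter.1 hτ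
      rw [← hτ2]
      exact h2 τ hτ1
    have h3 := hM g hg1 hg2
    have h4 : (fun v => ∑ θ, g θ v) = fun v => ∑ τ ∈ T, F τ (E.symm (v, s)) :=
      funext fun v => Finset.sum_fiberwise T π fun τ => F τ (E.symm (v, s))
    rw [h4] at h3
    refine h3.trans ?_
    rw [ENNReal.mul_rpow_of_nonneg _ _ hpos.le, mul_assoc]
    gcongr
    rw [← Finset.sum_fiberwise T π fun τ => lpPow p (fun v => F τ (E.symm (v, s))),
      Finset.mul_sum]
    refine Finset.sum_le_sum fun θ _ => ?_
    refine (lpPow_sum_le _ hp hp' fun τ hτ => (h1 τ (Finset.mem_filter.1 hτ).1).1).trans ?_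
    gcongr
    exact_mod_cast hN θ
  have hmeas : ∀ τ ∈ T, AEMeasurable fun s : ℝ => lpPow p (fun v => F τ (E.symm (v, s))) :=
    fun τ hτ => he.aemeasurable_lpPow p (hF τ hτ).1
  calc lpPow p (fun x => ∑ τ ∈ T, F τ x)
      = ∫⁻ s : ℝ, lpPow p (fun v => ∑ τ ∈ T, F τ (E.symm (v, s))) :=
        he.lpPow_eq (memLp_finsetSum _ hF).1
    _ ≤ ∫⁻ s : ℝ, (ENNReal.ofReal M * N) ^ p.toReal *
          ∑ τ ∈ T, lpPow p (fun v => F τ (E.symm (v, s))) := lintegral_mono_ae hslice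
    _ = (ENNReal.ofReal M * N) ^ p.toReal * ∑ τ ∈ T, lpPow p (F τ) := by
        rw [lintegral_const_mul'' _ (Finset.aemeasurable_fun_sum _ hmeas),
          lintegral_finsetSum' _ hmeas]
        congr 1
        exact Finset.sum_congr rfl fun τ hτ => (he.lpPow_eq (hF τ hτ).1).symm

/-- One step of the decoupling iteration: a cube of level `a` is decoupled into those of its
subcubes of level `a + e` that meet a neighbourhood of a hyperplane. -/
theorem lpPow_sum_le_of_hyperplane {P : Fin n → QuadraticForm ℝ (ι → ℝ)} {B C : ℝ}
    (hB : FormBound P B) (hC : 2 + 8 * B * (Fintype.card ι + 1) ^ 2 ≤ C) {p : ℝ≥0∞} (hp : 1 ≤ p)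
    (hp' : p ≠ ∞) {i : ι} {b : {l : ι // l ≠ i} → ℝ} (hb : ∀ l, |b l| ≤ 1) (h : ℝ) {M : ℝ}
    (hM : DecouplesPow (fun j => (P j).comp (graphMap i b)) C p
      (Finset.univ : Finset (DyadicCube {l : ι // l ≠ i} e)) M)
    {τ₀ : DyadicCube ι a} {T : Finset (DyadicCube ι (a + e))}
    (hT : ∀ τ ∈ T, ∀ l, (τ l : ℕ) / 2 ^ e = τ₀ l) {N : ℕ}
    (hN : ∀ τ ∈ T, |corner τ i - (h + ∑ l : {l : ι // l ≠ i}, b l * corner τ l.1)|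
      ≤ N * (1 / 2 ^ (a + e)))
    (F : DyadicCube ι (a + e) → Ambient ι n → ℂ) (hF : ∀ τ ∈ T, MemLp (F τ) p)
    (hs : ∀ τ ∈ T, SpectrumIn (F τ) {z |
      (∀ l, |z (Sum.inl l) - corner τ l| ≤ 2 * (1 / 2 ^ (a + e))) ∧
      |z (Sum.inl i) - (h + ∑ l : {l : ι // l ≠ i}, b l * z (Sum.inl l.1))|
        ≤ 1 / 2 ^ a * (1 / 2 ^ e) ^ 2 ∧
      ∀ j, |z (Sum.inr j) - P j fun l => z (Sum.inl l)| ≤ (1 / 2 ^ (a + e)) ^ 2}) :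
    lpPow p (fun x => ∑ τ ∈ T, F τ x)
      ≤ (ENNReal.ofReal M * (2 * N + 1 : ℕ)) ^ p.toReal * ∑ τ ∈ T, lpPow p (F τ) := by
  set r : ℝ := 1 / 2 ^ a with hr
  have hr0 : 0 < r := by positivity
  set δ : ℝ := 1 / 2 ^ e with hδ
  have hrδ : (1 : ℝ) / 2 ^ (a + e) = r * δ := by
    rw [hr, hδ, pow_add]
    field_simp
  -- The centre of the rescaling is the corner of τ₀ moved along the `i`-th axis onto the
  -- hyperplane, which therefore passes through 0 after rescaling.
  set y : ι → ℝ := fun l => if l = i then h + ∑ l : {l : ι // l ≠ i}, b l * corner τ₀ l.1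
    else corner τ₀ l with hy
  have hyi : y i = h + ∑ l : {l : ι // l ≠ i}, b l * corner τ₀ l.1 := by simp [hy]
  have hyl : ∀ l : {l : ι // l ≠ i}, y l.1 = corner τ₀ l.1 := fun l => by simp [hy, l.2]
  set L := parabolicScaling P y r hr0.ne' with hL
  set ξ₀ := graphPoint P y with hξ
  obtain ⟨A, hA⟩ := exists_dual_equiv L
  obtain ⟨c, hc0, hct, hc⟩ := lpPow_modulatedComp p A ξ₀
  have key := lpPow_sum_le_of_hyperplane_zero hB hC hp hp' hb hM T (relativeFace i)
    (card_fiber_relativeFace_le hT i b h N hN) (fun τ => modulatedComp A ξ₀ (F τ))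
    (fun τ hτ => memLp_modulatedComp A ξ₀ (hF τ hτ)) ?_
  · have h1 : (fun x => ∑ τ ∈ T, modulatedComp A ξ₀ (F τ) x)
        = modulatedComp A ξ₀ fun x => ∑ τ ∈ T, F τ x := by
      ext x
      simp [modulatedComp, Finset.mul_sum]
    rw [h1, hc] at key
    simp_rw [hc] at key
    rw [← Finset.mul_sum, mul_left_comm] at key
    exact (ENNReal.mul_le_mul_iff_right hc0 hct).1 key
  · intro τ hτ
    refine (spectrumIn_modulatedComp hA ξ₀ (hs τ hτ)).mono ?_
    rintro z ⟨h1, h2, h3⟩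
    have hin : ∀ l, (ξ₀ + L z) (Sum.inl l) = y l + r * z (Sum.inl l) := fun l => by
      simp [hξ, hL, graphPoint, parabolicScaling_inl]
    simp only [hin] at h1 h2
    have h1' : ∀ l, |y l + r * z (Sum.inl l) - corner τ l| ≤ 2 * (r * δ) := fun l =>
      (h1 l).trans_eq (by rw [hrδ])
    have h3' : ∀ j, |(ξ₀ + L z) (Sum.inr j) - P j fun l => (ξ₀ + L z) (Sum.inl l)|
        ≤ (r * δ) ^ 2 := fun j => (h3 j).trans_eq (by rw [hrδ])
    refine ⟨fun l => ?_, ?_, fun j => ?_⟩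
    · have h4 := h1' l.1
      rw [hyl, corner_eq_add_relative (hT τ hτ) i l, add_sub_add_left_eq_sub, ← mul_sub, abs_mul,
        abs_of_pos hr0] at h4
      have h5 : r * |z (Sum.inl l.1) - corner (relativeFace i τ) l| ≤ r * (2 * δ) := by linarith
      exact le_of_mul_le_mul_left h5 hr0
    · have h4 : y i + r * z (Sum.inl i) - (h + ∑ l : {l : ι // l ≠ i}, b l *
          (y l.1 + r * z (Sum.inl l.1))) = r * (z (Sum.inl i)
            - ∑ l : {l : ι // l ≠ i}, b l * z (Sum.inl l.1)) := by
        simp only [hyi, hyl, mul_add, Finset.sum_add_distrib, mul_sub, Finset.mul_sum]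
        simp only [mul_left_comm]
        ring
      rw [h4, abs_mul, abs_of_pos hr0] at h2
      exact le_of_mul_le_mul_left h2 hr0
    · have h4 := h3' j
      rw [hξ, hL, parabolicScaling_sub_form, abs_mul, abs_of_pos (by positivity), mul_pow] at h4
      exact le_of_mul_le_mul_left h4 (by positivity)

end Step

/-! ### Flatness of zero sets of polynomials -/

section Polynomials

open MvPolynomial

variable {ι : Type}

/-- A real polynomial is identically zero or has no zero on the set `s`. -/
def ZeroFreeOn (g : MvPolynomial ι ℝ) (s : Set (ι → ℝ)) : Prop :=
  g = 0 ∨ ∀ u ∈ s, eval u g ≠ 0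

theorem ZeroFreeOn.mono {g : MvPolynomial ι ℝ} {s t : Set (ι → ℝ)} (h : ZeroFreeOn g t)
    (hst : s ⊆ t) : ZeroFreeOn g s :=
  h.imp_right fun h u hu => h u (hst hu)

/-- The coefficients of a polynomial of bounded degree are bounded by its values on a cube with
vertex `0`. -/
theorem exists_coeff_bound [Fintype ι] (D : ℕ) (σ : ι → ℝ) (hσ : ∀ l, σ l ≠ 0) (α : ι →₀ ℕ) :
    ∃ K : ℝ, 0 ≤ K ∧ ∀ (g : MvPolynomial ι ℝ) (M : ℝ), g.totalDegree ≤ D → 0 ≤ M →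
      (∀ t : ι → ℝ, (∀ l, t l ∈ Set.Icc (0 : ℝ) 1) → |eval (fun l => σ l * t l) g| ≤ M) →
        |coeff α g| ≤ K * M := by
  classical
  let S : Type := ι → Fin (D + 1)
  -- A polynomial of degree at most D is determined by its values on a grid with D + 1 points in
  -- each direction. A linear left inverse of the evaluation map expresses each coefficient as a
  -- bounded functional of these values.
  let pt : S → ι → ℝ := fun s l => σ l * ((s l : ℕ) / (D + 1 : ℝ))
  let ev : restrictTotalDegree ι ℝ D →ₗ[ℝ] (S → ℝ) :=
    { toFun := fun g s => eval (pt s) g.1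
      map_add' := fun g h => by ext s; simp
      map_smul' := fun c g => by ext s; simp [smul_eval] }
  have hker : LinearMap.ker ev = ⊥ := by
    rw [LinearMap.ker_eq_bot']
    rintro ⟨g, hg⟩ h0
    rw [mem_restrictTotalDegree] at hg
    have hinj : ∀ l, Function.Injective fun a : Fin (D + 1) => σ l * ((a : ℕ) / (D + 1 : ℝ)) := by
      intro l a b hab
      have h1 := mul_left_cancel₀ (hσ l) hab
      rw [div_left_inj' (by positivity)] at h1
      exact Fin.ext (by exact_mod_cast h1)
    have := eq_zero_of_eval_zero_at_prod_finset g
      (fun l => Finset.univ.image fun a : Fin (D + 1) => σ l * ((a : ℕ) / (D + 1 : ℝ)))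
      (fun l => by
        rw [Finset.card_image_of_injective _ (hinj l), Finset.card_univ, Fintype.card_fin]
        have := degreeOf_le_totalDegree g l
        omega)
      (fun x hx => by
        choose s hs using fun l => Finset.mem_image.1 (hx l)
        have h1 := congrFun h0 s
        have h2 : pt s = x := funext fun l => (hs l).2
        simpa [ev, h2] using h1)
    exact Subtype.ext this
  obtain ⟨inv, hinv⟩ := ev.exists_leftInverse_of_injective hker
  let φ : (S → ℝ) →L[ℝ] ℝ := LinearMap.toContinuousLinearMap
    ((lcoeff ℝ α).comp ((restrictTotalDegree ι ℝ D).subtype.comp inv))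
  refine ⟨‖φ‖, norm_nonneg _, fun g M hg hM hb => ?_⟩
  let g' : restrictTotalDegree ι ℝ D := ⟨g, (mem_restrictTotalDegree _ _ _).2 hg⟩
  have h1 : φ (ev g') = coeff α g := by
    have : inv (ev g') = g' := LinearMap.congr_fun hinv g'
    simp [φ, this, g', lcoeff]
  rw [← h1, ← Real.norm_eq_abs]
  refine (φ.le_opNorm _).trans ?_
  gcongr
  refine (pi_norm_le_iff_of_nonneg hM).2 fun s => ?_
  refine hb _ fun l => ⟨by positivity, ?_⟩
  rw [div_le_one (by positivity)]
  have : (s l : ℕ) ≤ D + 1 := (s l).2.le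
  exact_mod_cast this

theorem hasDerivAt_eval_smul [Fintype ι] (g : MvPolynomial ι ℝ) (u : ι → ℝ) (t : ℝ) :
    HasDerivAt (fun s : ℝ => eval (fun l => s * u l) g)
      (∑ l, u l * eval (fun l => t * u l) (pderiv l g)) t := by
  classical
  induction g using MvPolynomial.induction_on with
  | C a => simpa using hasDerivAt_const t a
  | add p q hp hq =>
    simp only [map_add, mul_add, Finset.sum_add_distrib]
    exact hp.add hq
  | mul_X p i hp =>
    have h1 : HasDerivAt (fun s : ℝ => s * u i) (u i) t := by
      simpa using (hasDerivAt_id t).mul_const (u i)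
    have h2 := hp.mul h1
    have h3 : (fun s : ℝ => eval (fun l => s * u l) (p * X i))
        = (fun s => eval (fun l => s * u l) p) * fun s => s * u i := by
      ext s
      simp
    rw [h3]
    refine h2.congr_deriv (Eq.symm ?_)
    simp only [pderiv_mul, pderiv_X, map_add, map_mul, eval_X, mul_add, Finset.sum_add_distrib]
    congr 1
    · rw [Finset.sum_mul]
      exact Finset.sum_congr rfl fun l _ => by ring
    · rw [Finset.sum_eq_single i]
      · simp; ring
      · intro l _ hl
        simp [hl.symm]
      · simp

theorem eval_sign_of_zeroFreeOn {g : MvPolynomial ι ℝ} {s : Set (ι → ℝ)} (hs : IsPreconnected s)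
    (hg : ZeroFreeOn g s) : (∀ u ∈ s, 0 ≤ eval u g) ∨ ∀ u ∈ s, eval u g ≤ 0 := by
  rcases hg with rfl | hg
  · exact Or.inl fun u _ => by simp
  · by_contra! h
    obtain ⟨⟨u, hu, hu'⟩, v, hv, hv'⟩ := h
    obtain ⟨w, hw, hw'⟩ := hs.intermediate_value₂ hu hv (f := fun x => eval x g)
      (g := fun _ => (0 : ℝ)) (continuous_eval g).continuousOn continuousOn_const hu'.le hv'.le
    exact hg w hw hw'

/-- A polynomial of bounded degree which has no zeros on the unit cube, and neither have its first
derivatives, is controlled by its value at the centre. -/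
theorem exists_coeff_le_eval_zero (ι : Type) [Fintype ι] (D : ℕ) (α : ι →₀ ℕ) :
    ∃ K : ℝ, 0 ≤ K ∧ ∀ g : MvPolynomial ι ℝ, g.totalDegree ≤ D →
      ZeroFreeOn g (Metric.closedBall 0 1) →
      (∀ l, ZeroFreeOn (pderiv l g) (Metric.closedBall 0 1)) →
        |coeff α g| ≤ K * |eval 0 g| := by
  classical
  let sg : Bool → ℝ := fun b => if b then 1 else -1
  have hsg : ∀ b, sg b ≠ 0 := fun b => by cases b <;> simp [sg]
  have hsg1 : ∀ b, |sg b| = 1 := fun b => by cases b <;> simp [sg]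
  -- The orthant that will be used depends on the polynomial, so the constant is summed over all
  -- sign patterns.
  choose K hK0 hK using fun σ : ι → Bool =>
    exists_coeff_bound D (fun l => sg (σ l)) (fun l => hsg _) α
  refine ⟨∑ σ, K σ, Finset.sum_nonneg fun σ _ => hK0 σ, fun g hgD hg hg' => ?_⟩
  set s : Set (ι → ℝ) := Metric.closedBall 0 1 with hs
  have hconn : IsPreconnected s := (convex_closedBall _ _).isPreconnected
  obtain ⟨ε, hε, hεg⟩ : ∃ ε : ℝ, |ε| = 1 ∧ ∀ u ∈ s, 0 ≤ ε * eval u g := by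
    rcases eval_sign_of_zeroFreeOn hconn hg with h | h
    · exact ⟨1, by simp, fun u hu => by simpa using h u hu⟩
    · exact ⟨-1, by simp, fun u hu => by simpa using h u hu⟩
  -- Each partial derivative keeps its sign on the cube. The signs `b` pick an orthant in which |g|
  -- = εg decreases along every ray from the centre, so that |g| ≤ |g(0)| there.
  have hder : ∀ l, ∃ b : Bool, ∀ u ∈ s, ε * (sg b * eval u (pderiv l g)) ≤ 0 := by
    intro l
    have hε' : ε = 1 ∨ ε = -1 := (abs_eq zero_le_one).1 hε
    rcases eval_sign_of_zeroFreeOn hconn (hg' l) with h | h <;> rcases hε' with rfl | rfl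
    · exact ⟨false, fun u hu => by simpa [sg] using h u hu⟩
    · exact ⟨true, fun u hu => by simpa [sg] using h u hu⟩
    · exact ⟨true, fun u hu => by simpa [sg] using h u hu⟩
    · exact ⟨false, fun u hu => by simpa [sg] using h u hu⟩
  choose b hb using hder
  have hmain : |coeff α g| ≤ K b * |eval 0 g| := by
    refine hK b g _ hgD (abs_nonneg _) fun t ht => ?_
    set u : ι → ℝ := fun l => sg (b l) * t l with hu
    have hus : ∀ r ∈ Set.Icc (0 : ℝ) 1, (fun l => r * u l) ∈ s := by
      intro r hr
      rw [hs, mem_closedBall_zero_iff, pi_norm_le_iff_of_nonneg zero_le_one]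
      intro l
      rw [Real.norm_eq_abs, abs_mul, hu, abs_mul, hsg1, one_mul, abs_of_nonneg hr.1,
        abs_of_nonneg (ht l).1]
      exact mul_le_one₀ hr.2 (ht l).1 (ht l).2
    have hanti : AntitoneOn (fun r : ℝ => ε * eval (fun l => r * u l) g) (Set.Icc 0 1) := by
      have hd : ∀ r : ℝ, HasDerivAt (fun r : ℝ => ε * eval (fun l => r * u l) g)
          (ε * ∑ l, u l * eval (fun l => r * u l) (pderiv l g)) r :=
        fun r => (hasDerivAt_eval_smul g u r).const_mul ε
      refine antitoneOn_of_deriv_nonpos (convex_Icc _ _)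
        (fun r _ => (hd r).continuousAt.continuousWithinAt)
        (fun r _ => (hd r).differentiableAt.differentiableWithinAt) fun r hr => ?_
      rw [(hd r).deriv, Finset.mul_sum]
      refine Finset.sum_nonpos fun l _ => ?_
      have h1 := hb l _ (hus r (interior_subset hr))
      have h2 : ε * (u l * eval (fun l => r * u l) (pderiv l g))
          = t l * (ε * (sg (b l) * eval (fun l => r * u l) (pderiv l g))) := by
        rw [hu]; ring
      rw [h2]
      exact mul_nonpos_of_nonneg_of_nonpos (ht l).1 h1
    have h1 := hanti (Set.left_mem_Icc.2 zero_le_one) (Set.right_mem_Icc.2 zero_le_one) zero_le_one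
    simp only [one_mul, zero_mul] at h1
    have habs : ∀ v ∈ s, |eval v g| = ε * eval v g := fun v hv => by
      rw [← abs_of_nonneg (hεg v hv), abs_mul, hε, one_mul]
    have hu1 : u ∈ s := by simpa using hus 1 (Set.right_mem_Icc.2 zero_le_one)
    have h0 : (0 : ι → ℝ) ∈ s := by simp [hs]
    rw [habs _ hu1, habs _ h0]
    exact h1
  refine hmain.trans ?_
  gcongr
  exact Finset.single_le_sum (fun σ _ => hK0 σ) (Finset.mem_univ b)

/-- If the first and second derivatives of `q` have no zeros on the unit cube, then the zero set of
`q` through the centre is contained in a quadratic neighbourhood of its tangent hyperplane. -/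
theorem exists_hyperplane_unit (ι : Type) [Fintype ι] [DecidableEq ι] [Nonempty ι] (D : ℕ) :
    ∃ K : ℝ, 0 ≤ K ∧ ∀ q : MvPolynomial ι ℝ, q ≠ 0 → q.totalDegree ≤ D → eval 0 q = 0 →
      (∀ l, ZeroFreeOn (pderiv l q) (Metric.closedBall 0 1)) →
      (∀ j l, ZeroFreeOn (pderiv j (pderiv l q)) (Metric.closedBall 0 1)) →
      ∃ (i : ι) (b : {l : ι // l ≠ i} → ℝ), (∀ l, |b l| ≤ 1) ∧
        ∀ u : ι → ℝ, ‖u‖ ≤ 1 → eval u q = 0 → |u i - ∑ l, b l * u l.1| ≤ K * ‖u‖ ^ 2 := by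
  let S : Type := ι → Fin (D + 1)
  let fs : S → (ι →₀ ℕ) := fun s => Finsupp.equivFunOnFinite.symm fun l => (s l : ℕ)
  choose Ka hKa0 hKa using fun s : S => exists_coeff_le_eval_zero ι D (fs s)
  set K : ℝ := ∑ s, Ka s with hKdef
  have hK0 : 0 ≤ K := Finset.sum_nonneg fun s _ => hKa0 s
  have hfs : ∀ (g : MvPolynomial ι ℝ), g.totalDegree ≤ D → ∀ α ∈ g.support, ∃ s, fs s = α := by
    intro g hg α hα
    refine ⟨fun l => ⟨α l, ?_⟩, by ext l; simp [fs]⟩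
    have h1 := le_degreeOf_of_mem_support l hα
    have h2 := degreeOf_le_totalDegree g l
    omega
  have hcoeff : ∀ g : MvPolynomial ι ℝ, g.totalDegree ≤ D →
      ZeroFreeOn g (Metric.closedBall 0 1) →
      (∀ l, ZeroFreeOn (pderiv l g) (Metric.closedBall 0 1)) →
        ∀ α, |coeff α g| ≤ K * |eval 0 g| := by
    intro g hgD hg hg' α
    by_cases hα : α ∈ g.support
    · obtain ⟨s, rfl⟩ := hfs g hgD α hα
      refine (hKa s g hgD hg hg').trans ?_
      gcongr
      exact Finset.single_le_sum (fun σ _ => hKa0 σ) (Finset.mem_univ s)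
    · rw [notMem_support_iff.1 hα, abs_zero]
      positivity
  refine ⟨Fintype.card S * K, by positivity, fun q hq hqD hq0 h1 h2 => ?_⟩
  have hpD : ∀ l, (pderiv l q).totalDegree ≤ D := by
    intro l
    refine (Finset.sup_le fun m hm => ?_)
    rw [mem_support_iff, coeff_pderiv] at hm
    have h3 : m + Finsupp.single l 1 ∈ q.support := mem_support_iff.2 (left_ne_zero_of_mul hm)
    refine le_trans ?_ ((le_totalDegree h3).trans hqD)
    rw [Finsupp.sum_add_index' (fun _ => rfl) fun _ _ _ => rfl]
    exact Nat.le_add_right _ _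
  set c : ι → ℝ := fun l => eval 0 (pderiv l q) with hc
  have hc' : ∀ l, coeff (Finsupp.single l 1) q = c l := by
    intro l
    rw [hc]
    simp [eval_zero, constantCoeff_eq, coeff_pderiv]
  -- Solving for the variable with the largest partial derivative keeps the coefficients of the
  -- graph in [-1,1].
  obtain ⟨i, hi⟩ := Finite.exists_max fun l => |c l|
  -- A monomial containing the variable l survives in ∂_l q with its coefficient multiplied by a
  -- positive integer, and the coefficients of ∂_l q are bounded by its value at 0.
  have hcoeffq : ∀ α : ι →₀ ℕ, α ≠ 0 → |coeff α q| ≤ K * |c i| := by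
    intro α hα
    obtain ⟨l, hl⟩ := Finsupp.ne_iff.1 hα
    have hl' : 1 ≤ α l := Nat.one_le_iff_ne_zero.2 hl
    have h3 := hcoeff (pderiv l q) (hpD l) (h1 l) (fun j => h2 j l) (α - Finsupp.single l 1 : ι →₀ ℕ)
    rw [coeff_pderiv, tsub_add_cancel_of_le (Finsupp.single_le_iff.2 hl'), abs_mul] at h3
    have h4 : (1 : ℝ) ≤ |(((α - Finsupp.single l 1 : ι →₀ ℕ) l : ℕ) : ℝ) + 1| := by
      rw [abs_of_nonneg (by positivity)]
      have : (0 : ℝ) ≤ (((α - Finsupp.single l 1 : ι →₀ ℕ) l : ℕ) : ℝ) := by positivity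
      linarith
    calc |coeff α q| ≤ |coeff α q| * |(((α - Finsupp.single l 1 : ι →₀ ℕ) l : ℕ) : ℝ) + 1| :=
          le_mul_of_one_le_right (abs_nonneg _) h4
      _ ≤ K * |c l| := h3
      _ ≤ K * |c i| := mul_le_mul_of_nonneg_left (hi l) hK0
  have hcoeff0 : coeff 0 q = 0 := by
    rw [← hq0, eval_zero, constantCoeff_eq]
  -- A vanishing gradient would force every coefficient of q to vanish, the constant one because
  -- q(0) = 0.
  have hci : c i ≠ 0 := by
    intro h0
    apply hq
    ext α
    by_cases hα : α = 0
    · rw [hα, hcoeff0, coeff_zero]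
    · have := hcoeffq α hα
      rw [h0, abs_zero, mul_zero] at this
      rw [abs_nonpos_iff.1 this, coeff_zero]
  refine ⟨i, fun l => -c l.1 / c i, fun l => ?_, fun u hu huq => ?_⟩
  · rw [abs_div, abs_neg, div_le_one (abs_pos.2 hci)]
    exact hi l.1
  have hsplit : (∑ l, c l * u l) = c i * (u i - ∑ l : {l : ι // l ≠ i}, -c l.1 / c i * u l.1) := by
    rw [← Fintype.sum_subtype_add_sum_subtype (fun l => l ≠ i) fun l => c l * u l, mul_sub,
      Finset.mul_sum]
    have h3 : ∑ l : {l : ι // ¬ l ≠ i}, c l.1 * u l.1 = c i * u i := by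
      rw [Fintype.sum_eq_single (⟨i, by simp⟩ : {l : ι // ¬ l ≠ i})]
      rintro ⟨l, hl⟩ hne
      exact absurd (Subtype.ext (not_not.1 hl)) hne
    have h4 : ∀ l : {l : ι // l ≠ i}, c i * (-c l.1 / c i * u l.1) = -(c l.1 * u l.1) := by
      intro l
      field_simp
    rw [h3, Finset.sum_congr rfl fun l _ => h4 l, Finset.sum_neg_distrib]
    ring
  have hlin : |∑ l, c l * u l| ≤ Fintype.card S * (K * |c i| * ‖u‖ ^ 2) := by
    -- Only monomials of degree at least 2 remain, each bounded by K|c_i|‖u‖²; at a zero of q the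
    -- linear part equals -q'(u).
    set q' := q - ∑ l, C (c l) * X l with hq'
    have he : eval u q' = -∑ l, c l * u l := by
      simp [hq', huq]
    have hcq : ∀ α : ι →₀ ℕ, coeff α q' =
        coeff α q - ∑ l, if Finsupp.single l 1 = α then c l else 0 := by
      intro α
      simp [hq', coeff_sub, coeff_sum, coeff_C_mul, coeff_X]
    have hbig : ∀ α ∈ q'.support, α ≠ 0 ∧ (∀ l, Finsupp.single l 1 ≠ α) := by
      intro α hα
      have h3 : ∀ l, Finsupp.single l 1 ≠ α := by
        rintro l rfl
        rw [mem_support_iff, hcq, hc', Finset.sum_eq_single l] at hα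
        · simp at hα
        · intro j _ hj
          rw [if_neg]
          intro h
          exact hj (Finsupp.single_left_injective one_ne_zero h)
        · simp
      refine ⟨?_, h3⟩
      rintro rfl
      rw [mem_support_iff, hcq, hcoeff0] at hα
      simp [Finsupp.single_eq_zero] at hα
    have hsupp : q'.support ⊆ q.support := by
      intro α hα
      have h3 := hbig α hα
      rw [mem_support_iff, hcq, Finset.sum_eq_zero fun l _ => if_neg (h3.2 l), sub_zero] at hα
      exact mem_support_iff.2 hα
    have hcard : (q'.support.card : ℝ) ≤ Fintype.card S := by
      have : q'.support ⊆ Finset.univ.image fs := fun α hα => by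
        obtain ⟨s, hs⟩ := hfs q hqD α (hsupp hα)
        exact Finset.mem_image.2 ⟨s, Finset.mem_univ _, hs⟩
      exact_mod_cast (Finset.card_le_card this).trans (Finset.card_image_le.trans_eq rfl)
    rw [← abs_neg, ← he, eval_eq']
    calc |∑ α ∈ q'.support, coeff α q' * ∏ l, u l ^ α l|
        ≤ ∑ α ∈ q'.support, |coeff α q' * ∏ l, u l ^ α l| := Finset.abs_sum_le_sum_abs _ _
      _ ≤ ∑ α ∈ q'.support, K * |c i| * ‖u‖ ^ 2 := by
        refine Finset.sum_le_sum fun α hα => ?_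
        have h3 := hbig α hα
        rw [abs_mul]
        have h4 : coeff α q' = coeff α q := by
          rw [hcq, Finset.sum_eq_zero fun l _ => if_neg (h3.2 l), sub_zero]
        have h5 : 2 ≤ ∑ l, α l := by
          by_contra! hlt
          obtain ⟨l, hl⟩ := Finsupp.ne_iff.1 h3.1
          have hl' : 1 ≤ α l := Nat.one_le_iff_ne_zero.2 hl
          have h6 := Finset.add_sum_erase Finset.univ (fun l => α l) (Finset.mem_univ l)
          have h7 : ∑ j ∈ Finset.univ.erase l, α j = 0 := by omega
          refine h3.2 l (Finsupp.ext fun j => ?_)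
          by_cases hj : j = l
          · subst hj
            simp only [Finsupp.single_eq_same]
            omega
          · rw [Finsupp.single_eq_of_ne hj]
            exact ((Finset.sum_eq_zero_iff.1 h7) j (by simp [hj])).symm
        gcongr
        · rw [h4]; exact hcoeffq α h3.1
        · rw [Finset.abs_prod]
          calc ∏ l, |u l ^ α l| ≤ ∏ l, ‖u‖ ^ α l := by
                refine Finset.prod_le_prod (fun _ _ => abs_nonneg _) fun l _ => ?_
                rw [abs_pow]
                gcongr
                exact norm_le_pi_norm u l
            _ = ‖u‖ ^ ∑ l, α l := Finset.prod_pow_eq_pow_sum _ _ _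
            _ ≤ ‖u‖ ^ 2 := pow_le_pow_of_le_one (norm_nonneg _) hu h5
      _ = q'.support.card * (K * |c i| * ‖u‖ ^ 2) := by rw [Finset.sum_const, nsmul_eq_mul]
      _ ≤ _ := by gcongr
  rw [hsplit, abs_mul] at hlin
  refine le_of_mul_le_mul_left ?_ (abs_pos.2 hci)
  calc _ ≤ _ := hlin
    _ = _ := by ring

/-- The polynomial `u ↦ Q(z + ρ u)`. -/
def rescalePoly (z : ι → ℝ) (ρ : ℝ) : MvPolynomial ι ℝ →ₐ[ℝ] MvPolynomial ι ℝ :=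
  aeval fun l => C (z l) + C ρ * X l

theorem eval_rescalePoly (z : ι → ℝ) (ρ : ℝ) (u : ι → ℝ) (Q : MvPolynomial ι ℝ) :
    eval u (rescalePoly z ρ Q) = eval (fun l => z l + ρ * u l) Q := by
  induction Q using MvPolynomial.induction_on with
  | C a => simp [rescalePoly]
  | add p q hp hq => simp [hp, hq]
  | mul_X p i hp =>
    have hX : rescalePoly z ρ (X i) = C (z i) + C ρ * X i := by simp [rescalePoly]
    simp [hp, hX]

theorem pderiv_rescalePoly [DecidableEq ι] (z : ι → ℝ) (ρ : ℝ) (l : ι) (Q : MvPolynomial ι ℝ) :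
    pderiv l (rescalePoly z ρ Q) = C ρ * rescalePoly z ρ (pderiv l Q) := by
  induction Q using MvPolynomial.induction_on with
  | C a => simp [rescalePoly]
  | add p q hp hq => simp [hp, hq, mul_add]
  | mul_X p i hp =>
    have hX : rescalePoly z ρ (X i) = C (z i) + C ρ * X i := by simp [rescalePoly]
    simp only [map_mul, pderiv_mul, hp, hX, map_add, pderiv_C, pderiv_X, zero_mul, zero_add]
    by_cases h : i = l
    · subst h
      simp
      ring
    · simp [Ne.symm h]
      ring

theorem totalDegree_rescalePoly_le [Fintype ι] (z : ι → ℝ) (ρ : ℝ) (Q : MvPolynomial ι ℝ) :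
    (rescalePoly z ρ Q).totalDegree ≤ Q.totalDegree := by
  rw [rescalePoly, aeval_def, eval₂_eq']
  refine totalDegree_finsetSum_le fun m hm => ?_
  refine (totalDegree_mul _ _).trans ?_
  rw [MvPolynomial.algebraMap_eq, totalDegree_C, zero_add]
  refine (totalDegree_finsetProd _ _).trans (le_trans ?_ (le_totalDegree hm))
  rw [Finsupp.sum_fintype _ _ fun _ => rfl]
  refine Finset.sum_le_sum fun l _ => (totalDegree_pow _ _).trans ?_
  refine (Nat.mul_le_mul_left _ ?_).trans_eq (mul_one _)
  refine (totalDegree_add _ _).trans (max_le (by simp) ((totalDegree_mul _ _).trans ?_))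
  simp

theorem ZeroFreeOn.rescalePoly [Fintype ι] {g : MvPolynomial ι ℝ} {z : ι → ℝ} {ρ : ℝ} (hρ : 0 ≤ ρ)
    (h : ZeroFreeOn g (Metric.closedBall z ρ)) :
    ZeroFreeOn (rescalePoly z ρ g) (Metric.closedBall 0 1) := by
  rcases h with rfl | h
  · exact Or.inl (map_zero _)
  · refine Or.inr fun u hu => ?_
    rw [eval_rescalePoly]
    refine h _ ?_
    rw [mem_closedBall_zero_iff] at hu
    rw [Metric.mem_closedBall, dist_eq_norm]
    have : (fun l => z l + ρ * u l) - z = ρ • u := by ext l; simp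
    rw [this, norm_smul, Real.norm_eq_abs, abs_of_nonneg hρ]
    exact mul_le_of_le_one_right hρ hu

theorem ZeroFreeOn.const_mul {g : MvPolynomial ι ℝ} {s : Set (ι → ℝ)} (h : ZeroFreeOn g s)
    {ρ : ℝ} (hρ : ρ ≠ 0) : ZeroFreeOn (C ρ * g) s := by
  rcases h with rfl | h
  · exact Or.inl (mul_zero _)
  · exact Or.inr fun u hu => by
      rw [map_mul, eval_C]
      exact mul_ne_zero hρ (h u hu)

/-- The rescaled version of `exists_hyperplane_unit` for the cube of radius `ρ` about `z`. -/
theorem exists_hyperplane (ι : Type) [Fintype ι] [DecidableEq ι] [Nonempty ι] (D : ℕ) :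
    ∃ K : ℝ, 0 ≤ K ∧ ∀ (Q : MvPolynomial ι ℝ) (z : ι → ℝ) (ρ : ℝ), Q ≠ 0 → Q.totalDegree ≤ D →
      0 < ρ → eval z Q = 0 →
      (∀ l, ZeroFreeOn (pderiv l Q) (Metric.closedBall z ρ)) →
      (∀ j l, ZeroFreeOn (pderiv j (pderiv l Q)) (Metric.closedBall z ρ)) →
      ∃ (i : ι) (b : {l : ι // l ≠ i} → ℝ), (∀ l, |b l| ≤ 1) ∧
        ∀ y : ι → ℝ, ‖y - z‖ ≤ ρ → eval y Q = 0 →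
          |(y i - z i) - ∑ l : {l : ι // l ≠ i}, b l * (y l.1 - z l.1)|
            ≤ K / ρ * ‖y - z‖ ^ 2 := by
  obtain ⟨K, hK, h⟩ := exists_hyperplane_unit ι D
  refine ⟨K, hK, fun Q z ρ hQ hQD hρ hz h1 h2 => ?_⟩
  have hback : ∀ y : ι → ℝ, (fun l => z l + ρ * (ρ⁻¹ • (y - z)) l) = y := fun y => by
    ext l
    simp [mul_inv_cancel_left₀ hρ.ne']
  have hne : rescalePoly z ρ Q ≠ 0 := by
    intro h0
    apply hQ
    refine MvPolynomial.funext fun y => ?_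
    rw [← hback y, ← eval_rescalePoly, h0, map_zero, map_zero]
  obtain ⟨i, b, hb, hu⟩ := h (rescalePoly z ρ Q) hne
    ((totalDegree_rescalePoly_le z ρ Q).trans hQD)
    (by rw [eval_rescalePoly]; simpa using hz)
    (fun l => by
      rw [pderiv_rescalePoly]
      exact ((h1 l).rescalePoly hρ.le).const_mul hρ.ne')
    (fun j l => by
      rw [pderiv_rescalePoly, pderiv_C_mul, pderiv_rescalePoly]
      exact (((h2 j l).rescalePoly hρ.le).const_mul hρ.ne').const_mul hρ.ne')
  refine ⟨i, b, hb, fun y hy hy0 => ?_⟩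
  have hnorm : ‖ρ⁻¹ • (y - z)‖ = ρ⁻¹ * ‖y - z‖ := by
    rw [norm_smul, Real.norm_eq_abs, abs_of_pos (inv_pos.2 hρ)]
  have h3 := hu (ρ⁻¹ • (y - z)) (by rw [hnorm, inv_mul_le_iff₀ hρ, mul_one]; exact hy)
    (by rw [eval_rescalePoly, hback, hy0])
  rw [hnorm] at h3
  have h4 : (ρ⁻¹ • (y - z)) i - ∑ l : {l : ι // l ≠ i}, b l * (ρ⁻¹ • (y - z)) l.1
      = ρ⁻¹ * ((y i - z i) - ∑ l : {l : ι // l ≠ i}, b l * (y l.1 - z l.1)) := by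
    simp only [Pi.smul_apply, Pi.sub_apply, smul_eq_mul, mul_sub, Finset.mul_sum]
    congr 1
    exact Finset.sum_congr rfl fun l _ => by ring
  rw [h4, abs_mul, abs_of_pos (inv_pos.2 hρ)] at h3
  refine le_of_mul_le_mul_left (h3.trans_eq ?_) (inv_pos.2 hρ)
  field_simp

theorem totalDegree_pderiv_le (i : ι) (q : MvPolynomial ι ℝ) :
    (pderiv i q).totalDegree ≤ q.totalDegree - 1 := by
  refine Finset.sup_le fun m hm => ?_
  rw [mem_support_iff, coeff_pderiv] at hm
  have h3 : m + Finsupp.single i 1 ∈ q.support := mem_support_iff.2 (left_ne_zero_of_mul hm)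
  have h4 := le_totalDegree h3
  rw [Finsupp.sum_add_index' (fun _ => rfl) fun _ _ _ => rfl, Finsupp.sum_single_index rfl] at h4
  exact Nat.le_sub_of_add_le h4

end Polynomials

/-! ### The tree of dyadic cubes and one level of the iteration -/

section Tree

variable {ι : Type} {k : ℕ}

/-- The dyadic cube of level `a` containing the cube `θ` of level `k`, for `a ≤ k`. -/
def ancestor (a : ℕ) (θ : DyadicCube ι k) : DyadicCube ι a :=
  fun l => ⟨(θ l : ℕ) / 2 ^ (k - a) % 2 ^ a, Nat.mod_lt _ (by positivity)⟩

/-- The reduction modulo 2^a only makes the index well typed for arbitrary levels; when a ≤ k the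
quotient is already smaller than 2^a. -/
theorem ancestor_val {a : ℕ} (ha : a ≤ k) (θ : DyadicCube ι k) (l : ι) :
    (ancestor a θ l : ℕ) = (θ l : ℕ) / 2 ^ (k - a) := by
  refine Nat.mod_eq_of_lt (Nat.div_lt_of_lt_mul ?_)
  rw [← pow_add, Nat.sub_add_cancel ha]
  exact (θ l).2

theorem ancestor_self (θ : DyadicCube ι k) : ancestor k θ = θ := by
  funext l
  apply Fin.ext
  rw [ancestor_val le_rfl, Nat.sub_self, pow_zero, Nat.div_one]

theorem ancestor_ancestor {a b : ℕ} (hab : a ≤ b) (hb : b ≤ k) (θ : DyadicCube ι k) :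
    ancestor a (ancestor b θ) = ancestor a θ := by
  funext l
  apply Fin.ext
  rw [ancestor_val hab, ancestor_val hb, ancestor_val (hab.trans hb), Nat.div_div_eq_div_mul,
    ← pow_add]
  congr 2
  omega

theorem corner_ancestor_le {a : ℕ} (ha : a ≤ k) (θ : DyadicCube ι k) (l : ι) :
    corner (ancestor a θ) l ≤ corner θ l := by
  simp only [corner, ancestor_val ha]
  rw [div_le_div_iff₀ (by positivity) (by positivity)]
  have h := Nat.div_mul_le_self (θ l : ℕ) (2 ^ (k - a))
  calc (((θ l : ℕ) / 2 ^ (k - a) : ℕ) : ℝ) * 2 ^ k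
      = (((θ l : ℕ) / 2 ^ (k - a) * 2 ^ (k - a) : ℕ) : ℝ) * 2 ^ a := by
        push_cast
        rw [mul_assoc, ← pow_add, Nat.sub_add_cancel ha]
    _ ≤ _ := by gcongr

theorem corner_add_le_ancestor {a : ℕ} (ha : a ≤ k) (θ : DyadicCube ι k) (l : ι) :
    corner θ l + 1 / 2 ^ k ≤ corner (ancestor a θ) l + 1 / 2 ^ a := by
  simp only [corner, ancestor_val ha]
  rw [← add_div, ← add_div, div_le_div_iff₀ (by positivity) (by positivity)]
  have h : (θ l : ℕ) + 1 ≤ ((θ l : ℕ) / 2 ^ (k - a) + 1) * 2 ^ (k - a) := by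
    have h1 := Nat.div_add_mod (θ l : ℕ) (2 ^ (k - a))
    have h2 := Nat.mod_lt (θ l : ℕ) (show 0 < 2 ^ (k - a) by positivity)
    rw [Nat.add_mul, one_mul, mul_comm _ (2 ^ (k - a))]
    omega
  calc (((θ l : ℕ) : ℝ) + 1) * 2 ^ a = (((θ l : ℕ) + 1 : ℕ) : ℝ) * 2 ^ a := by push_cast; ring
    _ ≤ ((((θ l : ℕ) / 2 ^ (k - a) + 1) * 2 ^ (k - a) : ℕ) : ℝ) * 2 ^ a := by gcongr
    _ = _ := by
        push_cast
        rw [mul_assoc, ← pow_add, Nat.sub_add_cancel ha]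

variable [Fintype ι] {n : ℕ}

theorem card_ancestor_fiber_le [DecidableEq ι] {a b : ℕ} (hab : a ≤ b) (T : Finset (DyadicCube ι b))
    (τ₀ : DyadicCube ι a) :
    (T.filter fun τ => ancestor a τ = τ₀).card ≤ 2 ^ (Fintype.card ι * (b - a)) := by
  have hinj : Set.InjOn (fun (τ : DyadicCube ι b) (l : ι) =>
      (⟨(τ l : ℕ) % 2 ^ (b - a), Nat.mod_lt _ (by positivity)⟩ : Fin (2 ^ (b - a))))
      (T.filter fun τ => ancestor a τ = τ₀) := by
    intro τ hτ τ' hτ' h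
    simp only [Finset.coe_filter, Set.mem_ofPred_eq] at hτ hτ'
    funext l
    apply Fin.ext
    have h1 := congrArg Fin.val (congrFun (hτ.2.trans hτ'.2.symm) l)
    rw [ancestor_val hab, ancestor_val hab] at h1
    have h2 := congrArg Fin.val (congrFun h l)
    simp only at h2
    rw [← Nat.div_add_mod (τ l : ℕ) (2 ^ (b - a)), ← Nat.div_add_mod (τ' l : ℕ) (2 ^ (b - a)),
      h1, h2]
  rw [← Finset.card_image_of_injOn hinj]
  refine (Finset.card_le_univ _).trans_eq ?_
  rw [Fintype.card_fun, Fintype.card_fin, ← pow_mul, mul_comm]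

/-- The sum of the functions `f θ` over the cubes `θ ∈ G` contained in `τ`. -/
def cubeSum (G : Finset (DyadicCube ι k)) (f : DyadicCube ι k → Ambient ι n → ℂ) {a : ℕ}
    (τ : DyadicCube ι a) : Ambient ι n → ℂ :=
  fun x => ∑ θ ∈ G with ancestor a θ = τ, f θ x

/-- The sum of the `p`-th powers of the `L^p` norms of the sums over cubes of level `a`. -/
def levelSum (p : ℝ≥0∞) (G : Finset (DyadicCube ι k)) (f : DyadicCube ι k → Ambient ι n → ℂ)
    (a : ℕ) : ℝ≥0∞ :=
  ∑ τ ∈ G.image (ancestor a), lpPow p (cubeSum G f τ)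

variable {G : Finset (DyadicCube ι k)} {f : DyadicCube ι k → Ambient ι n → ℂ} {p : ℝ≥0∞}

theorem memLp_cubeSum (hf : ∀ θ ∈ G, MemLp (f θ) p) {a : ℕ} (τ : DyadicCube ι a) :
    MemLp (cubeSum G f τ) p :=
  memLp_finsetSum _ fun θ hθ => hf θ (Finset.mem_filter.1 hθ).1

theorem cubeSum_eq {a b : ℕ} (hab : a ≤ b) (hb : b ≤ k) (τ₀ : DyadicCube ι a) :
    cubeSum G f τ₀ = fun x =>
      ∑ τ ∈ (G.image (ancestor b)).filter fun τ => ancestor a τ = τ₀, cubeSum G f τ x := by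
  funext x
  simp only [cubeSum]
  rw [← Finset.sum_fiberwise_of_maps_to (g := fun θ : DyadicCube ι k => ancestor b θ)
    (t := (G.image (ancestor b)).filter fun τ => ancestor a τ = τ₀)]
  · refine Finset.sum_congr rfl fun τ hτ => Finset.sum_congr ?_ fun _ _ => rfl
    ext θ
    simp only [Finset.mem_filter]
    constructor
    · exact fun h => ⟨h.1.1, h.2⟩
    · rintro ⟨h1, h2⟩
      refine ⟨⟨h1, ?_⟩, h2⟩
      rw [← (Finset.mem_filter.1 hτ).2, ← h2, ancestor_ancestor hab hb]
  · intro θ hθ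
    obtain ⟨h1, h2⟩ := Finset.mem_filter.1 hθ
    exact Finset.mem_filter.2 ⟨Finset.mem_image_of_mem _ h1, by rw [ancestor_ancestor hab hb, h2]⟩

/-- A cube of level `b` has exactly one ancestor of level `a`, so inequalities for the individual
parents with a common constant add up. This lets the steps be multiplied along the levels. -/
theorem levelSum_le_mul {a b : ℕ} (hab : a ≤ b) (hb : b ≤ k) {c : ℝ≥0∞}
    (h : ∀ τ₀ ∈ G.image (ancestor a), lpPow p (cubeSum G f τ₀)
      ≤ c * ∑ τ ∈ (G.image (ancestor b)).filter fun τ => ancestor a τ = τ₀,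
        lpPow p (cubeSum G f τ)) :
    levelSum p G f a ≤ c * levelSum p G f b := by
  refine (Finset.sum_le_sum h).trans_eq ?_
  rw [← Finset.mul_sum, Finset.sum_fiberwise_of_maps_to]
  · rfl
  · intro τ hτ
    obtain ⟨θ, hθ, rfl⟩ := Finset.mem_image.1 hτ
    rw [ancestor_ancestor hab hb]
    exact Finset.mem_image_of_mem _ hθ

/-- The crude bound from counting descendants, meant for levels at which no hyperplane is available.
-/
theorem levelSum_le_of_le [DecidableEq ι] (hp : 1 ≤ p) (hp' : p ≠ ∞) (hf : ∀ θ ∈ G, MemLp (f θ) p) {a b : ℕ}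
    (hab : a ≤ b) (hb : b ≤ k) :
    levelSum p G f a
      ≤ ((2 : ℝ≥0∞) ^ (Fintype.card ι * (b - a))) ^ p.toReal * levelSum p G f b := by
  refine levelSum_le_mul hab hb fun τ₀ _ => ?_
  rw [cubeSum_eq hab hb]
  refine (lpPow_sum_le _ hp hp' fun τ _ => (memLp_cubeSum hf τ).1).trans ?_
  gcongr
  exact_mod_cast card_ancestor_fiber_le hab _ τ₀

theorem levelSum_self : levelSum p G f k = ∑ θ ∈ G, lpPow p (f θ) := by
  have h : G.image (ancestor k) = G := by
    ext θ
    simp [ancestor_self]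
  rw [levelSum, h]
  refine Finset.sum_congr rfl fun θ hθ => ?_
  congr 1
  funext x
  simp only [cubeSum, ancestor_self]
  rw [Finset.sum_filter, Finset.sum_eq_single θ (fun θ' _ h => if_neg h) (fun h => absurd hθ h),
    if_pos rfl]

theorem lpPow_le_levelSum_zero (hp : 1 ≤ p) (hp' : p ≠ ∞) :
    lpPow p (fun x => ∑ θ ∈ G, f θ x) ≤ levelSum p G f 0 := by
  have hpos : 0 < p.toReal := ENNReal.toReal_pos (zero_lt_one.trans_le hp).ne' hp'
  rcases G.eq_empty_or_nonempty with rfl | ⟨θ, hθ⟩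
  · simp [lpPow, hpos]
  · have huniq : ∀ τ τ' : DyadicCube ι 0, τ = τ' := fun τ τ' => by
      funext l
      apply Fin.ext
      have h1 := (τ l).2
      have h2 := (τ' l).2
      simp only [pow_zero, Nat.lt_one_iff] at h1 h2
      rw [h1, h2]
    have h1 : (fun x => ∑ θ ∈ G, f θ x) = cubeSum G f (ancestor 0 θ) := by
      funext x
      refine Finset.sum_congr ?_ fun _ _ => rfl
      rw [Finset.filter_true_of_mem fun θ' _ => huniq _ _]
    rw [h1]
    exact Finset.single_le_sum (f := fun τ : DyadicCube ι 0 => lpPow p (cubeSum G f τ))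
      (fun _ _ => bot_le) (Finset.mem_image_of_mem _ hθ)

theorem abs_sub_hyperplane_le [DecidableEq ι] {i : ι} {b : {l : ι // l ≠ i} → ℝ} (hb : ∀ l, |b l| ≤ 1)
    {h η r : ℝ} (hr : 0 ≤ r) {y z : ι → ℝ}
    (hz : |z i - (h + ∑ l : {l : ι // l ≠ i}, b l * z l.1)| ≤ η) (hyz : ∀ l, |y l - z l| ≤ r) :
    |y i - (h + ∑ l : {l : ι // l ≠ i}, b l * y l.1)| ≤ η + Fintype.card ι * r := by
  have h1 : ∑ l : {l : ι // l ≠ i}, |b l * (y l.1 - z l.1)| + r ≤ Fintype.card ι * r := by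
    have : ∑ l : {l : ι // l ≠ i}, |b l * (y l.1 - z l.1)| ≤ ∑ _l : {l : ι // l ≠ i}, r :=
      Finset.sum_le_sum fun l _ => by
        rw [abs_mul]
        exact (mul_le_of_le_one_left (abs_nonneg _) (hb l)).trans (hyz l.1)
    rw [Finset.sum_const, Finset.card_univ, nsmul_eq_mul] at this
    have hcard : (Fintype.card {l : ι // l ≠ i} : ℝ) + 1 ≤ Fintype.card ι := by
      have := Fintype.card_subtype_lt (p := fun l : ι => l ≠ i) (x := i) (by simp)
      exact_mod_cast this
    nlinarith
  have h2 : y i - (h + ∑ l : {l : ι // l ≠ i}, b l * y l.1)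
      = (z i - (h + ∑ l : {l : ι // l ≠ i}, b l * z l.1)) + ((y i - z i)
        - ∑ l : {l : ι // l ≠ i}, b l * (y l.1 - z l.1)) := by
    simp only [mul_sub, Finset.sum_sub_distrib]
    ring
  rw [h2]
  have h3 := Finset.abs_sum_le_sum_abs (fun l : {l : ι // l ≠ i} => b l * (y l.1 - z l.1))
    Finset.univ
  have h4 := hyz i
  calc _ ≤ _ := abs_add_le _ _
    _ ≤ η + (|y i - z i| + |∑ l : {l : ι // l ≠ i}, b l * (y l.1 - z l.1)|) :=
      add_le_add hz (abs_sub _ _)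
    _ ≤ _ := by linarith

/-- The box is built on the tangent plane, from which the surface departs by P(w) alone, with |w| ≤
Cδ. -/
theorem abs_sub_form_le_of_mem_uncertaintyBox {P : Fin n → QuadraticForm ℝ (ι → ℝ)} {B C : ℝ}
    (hB : FormBound P B) (hC : 0 ≤ C) {θ : DyadicCube ι k} {z : Ambient ι n}
    (hz : z ∈ uncertaintyBox P C θ) (j : Fin n) :
    |z (Sum.inr j) - P j fun l => z (Sum.inl l)| ≤ (C + B * C ^ 2) * (1 / 2 ^ k) ^ 2 := by
  rw [mem_uncertaintyBox_iff] at hz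
  set w : ι → ℝ := fun i => z (Sum.inl i) - corner θ i with hw
  have h1 : P j (fun l => z (Sum.inl l)) = P j (corner θ) + P j w
      + QuadraticMap.polar (P j) (corner θ) w := by
    have : (fun l => z (Sum.inl l)) = corner θ + w := by ext l; simp [hw]
    rw [this, QuadraticMap.polar]
    ring
  have hnorm : ‖w‖ ≤ C * (1 / 2 ^ k) := (pi_norm_le_iff_of_nonneg (by positivity)).2 hz.1
  have h2 : |P j w| ≤ B * (C * (1 / 2 ^ k)) ^ 2 := by
    refine ((hB.2 j).1 w).trans ?_
    have := hB.1
    gcongr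
  have h3 : z (Sum.inr j) - P j (fun l => z (Sum.inl l))
      = (z (Sum.inr j) - P j (corner θ) - QuadraticMap.polar (P j) (corner θ) w) - P j w := by
    rw [h1]; ring
  rw [h3]
  refine (abs_sub _ _).trans ?_
  have h4 := hz.2 j
  calc _ ≤ C * (1 / 2 ^ k) ^ 2 + B * (C * (1 / 2 ^ k)) ^ 2 := add_le_add h4 h2
    _ = _ := by ring

/-- One level of the iteration, when the cubes of `G` below any cube of level `a` lie near a
hyperplane. -/
theorem levelSum_le_of_hyperplane [DecidableEq ι] {P : Fin n → QuadraticForm ℝ (ι → ℝ)} {B C : ℝ}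
    (hB : FormBound P B) (hC : 2 + 8 * B * (Fintype.card ι + 1) ^ 2 ≤ C) (hp : 1 ≤ p)
    (hp' : p ≠ ∞) (hf : ∀ θ ∈ G, MemLp (f θ) p)
    (hs : ∀ θ ∈ G, SpectrumIn (f θ) (uncertaintyBox P C θ)) {a e : ℕ} {M : ℝ}
    (hM : ∀ (i : ι) (b : {l : ι // l ≠ i} → ℝ), (∀ l, |b l| ≤ 1) →
      DecouplesPow (fun j => (P j).comp (graphMap i b)) C p
        (Finset.univ : Finset (DyadicCube {l : ι // l ≠ i} e)) M)
    (hae : a + 3 * e ≤ k)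
    (hsmall : (2 * Fintype.card ι * (C + 2) + C + B * C ^ 2) * (1 / 2 ^ e) ≤ 1)
    (hyp : ∀ τ₀ ∈ G.image (ancestor a), ∃ (i : ι) (b : {l : ι // l ≠ i} → ℝ) (h : ℝ),
      (∀ l, |b l| ≤ 1) ∧ ∀ θ ∈ G, ancestor a θ = τ₀ → ∃ z : ι → ℝ,
        (∀ l, |corner θ l - z l| ≤ 2 * (1 / 2 ^ k)) ∧
        |z i - (h + ∑ l : {l : ι // l ≠ i}, b l * z l.1)|
          ≤ 1 / 2 * (1 / 2 ^ a * (1 / 2 ^ e) ^ 2)) :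
    levelSum p G f a ≤ (ENNReal.ofReal M * (2 * (3 * Fintype.card ι + 1) + 1 : ℕ)) ^ p.toReal
      * levelSum p G f (a + e) := by
  have hB0 := hB.1
  have hC0 : 0 ≤ C := le_trans (by positivity) hC
  have hbk : a + e ≤ k := by omega
  refine levelSum_le_mul (Nat.le_add_right a e) hbk fun τ₀ hτ₀ => ?_
  obtain ⟨i, b, h, hb, hθ⟩ := hyp τ₀ hτ₀
  rw [cubeSum_eq (Nat.le_add_right a e) hbk]
  set r : ℝ := 1 / 2 ^ a with hr
  set δ : ℝ := 1 / 2 ^ e with hδ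
  set s : ℝ := 1 / 2 ^ k with hsdef
  have hr0 : 0 < r := by positivity
  have hδ0 : 0 < δ := by positivity
  have hs0 : 0 < s := by positivity
  have hδ1 : δ ≤ 1 := by
    rw [hδ, div_le_one (by positivity)]
    exact one_le_pow₀ one_le_two
  have hw : (1 : ℝ) / 2 ^ (a + e) = r * δ := by
    rw [hr, hδ, pow_add]
    field_simp
  -- The final cubes are finer than the width rδ² allowed around the hyperplane by a further factor
  -- δ, which absorbs the constants collected in `hsmall`.
  have hsr : s ≤ r * δ ^ 3 := by
    rw [hsdef, hr, hδ, div_pow, one_pow, div_mul_div_comm, one_mul, ← pow_mul, ← pow_add]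
    gcongr
    · exact one_le_two
    · omega
  have hcard0 : (0 : ℝ) ≤ Fintype.card ι := by positivity
  have hX1 : 2 * Fintype.card ι * (C + 2) * δ ≤ 1 := by
    refine le_trans ?_ hsmall
    gcongr
    nlinarith [mul_nonneg hB0 (sq_nonneg C)]
  have hX2 : (C + B * C ^ 2) * δ ≤ 1 := by
    refine le_trans ?_ hsmall
    gcongr
    nlinarith [mul_nonneg hcard0 hC0]
  have hX3 : C * δ ≤ 1 := by
    refine le_trans ?_ hX2
    gcongr
    nlinarith [mul_nonneg hB0 (sq_nonneg C)]
  have hδ32 : r * δ ^ 3 ≤ r * δ := by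
    gcongr
    exact pow_le_of_le_one hδ0.le hδ1 (by norm_num)
  refine lpPow_sum_le_of_hyperplane hB hC hp hp' hb h (hM i b hb) (τ₀ := τ₀) (fun τ hτ l => ?_)
    (fun τ hτ => ?_) _ (fun τ _ => memLp_cubeSum hf τ) (fun τ hτ => ?_)
  · obtain ⟨-, h2⟩ := Finset.mem_filter.1 hτ
    rw [← h2, ancestor_val (Nat.le_add_right a e), Nat.add_sub_cancel_left]
  · obtain ⟨h1, h2⟩ := Finset.mem_filter.1 hτ
    obtain ⟨θ, hθG, rfl⟩ := Finset.mem_image.1 h1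
    rw [ancestor_ancestor (Nat.le_add_right a e) hbk] at h2
    obtain ⟨z, hz1, hz2⟩ := hθ θ hθG h2
    rw [hw]
    have h3 : ∀ l, |corner (ancestor (a + e) θ) l - z l| ≤ 3 * (r * δ) := fun l => by
      have h4 := corner_ancestor_le hbk θ l
      have h5 := corner_add_le_ancestor hbk θ l
      rw [hw] at h5
      have h6 := abs_le.1 (hz1 l)
      rw [abs_le]
      constructor <;> linarith
    -- A corner within 3rδ of `z` is within rδ²/2 + 3d·rδ of the hyperplane, hence the value N = 3d
    -- + 1.
    refine (abs_sub_hyperplane_le hb (by positivity) hz2 h3).trans ?_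
    have h7 : r * δ ^ 2 ≤ r * δ := by
      gcongr
      exact pow_le_of_le_one hδ0.le hδ1 (by norm_num)
    push_cast
    nlinarith [mul_pos hr0 hδ0]
  · refine SpectrumIn.sum hp (fun θ hθG => hf θ (Finset.mem_filter.1 hθG).1) fun θ hθ' => ?_
    obtain ⟨hθG, rfl⟩ := Finset.mem_filter.1 hθ'
    have h2 := (Finset.mem_filter.1 hτ).2
    rw [ancestor_ancestor (Nat.le_add_right a e) hbk] at h2
    obtain ⟨z, hz1, hz2⟩ := hθ θ hθG h2
    refine (hs θ hθG).mono fun ζ hζ => ?_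
    have hζ' := (mem_uncertaintyBox_iff P C θ ζ).1 hζ
    refine ⟨fun l => ?_, ?_, fun j => ?_⟩
    · rw [hw]
      have h4 := corner_ancestor_le hbk θ l
      have h5 := corner_add_le_ancestor hbk θ l
      rw [hw] at h5
      have h6 := abs_le.1 (hζ'.1 l)
      have h7 : C * s ≤ r * δ := by
        calc C * s ≤ C * (r * δ ^ 3) := by gcongr
          _ = (C * δ) * (r * δ ^ 2) := by ring
          _ ≤ 1 * (r * δ) := by
            gcongr
            exact pow_le_of_le_one hδ0.le hδ1 (by norm_num)
          _ = _ := one_mul _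
      rw [abs_le]
      constructor <;> linarith
    · have h3 : ∀ l, |ζ (Sum.inl l) - z l| ≤ (C + 2) * s := fun l => by
        have h4 := abs_le.1 (hζ'.1 l)
        have h5 := abs_le.1 (hz1 l)
        rw [abs_le]
        constructor <;> linarith
      refine (abs_sub_hyperplane_le (y := fun l => ζ (Sum.inl l)) hb (by positivity) hz2 h3).trans
        ?_
      -- Half of the allowed width rδ² is used by `z`, the other half by the passage from `z` to the
      -- frequency box.
      have h4 : Fintype.card ι * ((C + 2) * s) ≤ 1 / 2 * (r * δ ^ 2) := by
        calc Fintype.card ι * ((C + 2) * s) ≤ Fintype.card ι * ((C + 2) * (r * δ ^ 3)) := by gcongr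
          _ = 1 / 2 * ((2 * Fintype.card ι * (C + 2) * δ) * (r * δ ^ 2)) := by ring
          _ ≤ 1 / 2 * (1 * (r * δ ^ 2)) := by gcongr
          _ = _ := by ring
      linarith
    · refine (abs_sub_form_le_of_mem_uncertaintyBox hB hC0 hζ j).trans ?_
      rw [hw]
      calc (C + B * C ^ 2) * s ^ 2 ≤ (C + B * C ^ 2) * (r * δ ^ 3) ^ 2 := by gcongr
        _ = ((C + B * C ^ 2) * δ) * (r ^ 2 * δ ^ 5) := by ring
        _ ≤ 1 * (r ^ 2 * δ ^ 2) := by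
          gcongr ?_ * (_ * ?_)
          exact pow_le_pow_of_le_one hδ0.le hδ1 (by norm_num)
        _ = _ := by ring

end Tree

/-! ### Decoupling near the regular part of a zero set -/

section Level

open MvPolynomial

variable {d n k : ℕ}

/-- The cube `θ` contains a point at distance less than `1/K` from the zero set of `Q`, but at
distance at least `1/κ` from the zeros of the nonzero first and second derivatives of `Q`. -/
def NearRegularZero (Q : MvPolynomial (Fin d) ℝ) (K κ : ℝ) (θ : DyadicCube (Fin d) k) : Prop :=
  ∃ x ∈ cubeSet θ, x ∈ Metric.thickening (1 / K) (zeroSet Q) ∧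
    (∀ l, ZeroFreeOn (pderiv l Q) {y | WithLp.toLp 2 y ∈ Metric.ball x (1 / κ)}) ∧
    ∀ j l, ZeroFreeOn (pderiv j (pderiv l Q)) {y | WithLp.toLp 2 y ∈ Metric.ball x (1 / κ)}

theorem abs_sub_apply_le_dist (x y : EuclideanSpace ℝ (Fin d)) (l : Fin d) :
    |x l - y l| ≤ dist x y := by
  rw [dist_eq_norm, ← Real.norm_eq_abs]
  exact PiLp.norm_apply_le (x - y) l

theorem dist_toLp_le (y : Fin d → ℝ) (z : EuclideanSpace ℝ (Fin d)) :
    dist (WithLp.toLp 2 y) z ≤ d * ‖y - WithLp.ofLp z‖ := by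
  rw [EuclideanSpace.dist_eq]
  refine Real.sqrt_le_iff.2 ⟨by positivity, ?_⟩
  have h1 : ∀ l ∈ Finset.univ, dist ((WithLp.toLp 2 y : EuclideanSpace ℝ (Fin d)) l) (z l) ^ 2
      ≤ ‖y - WithLp.ofLp z‖ ^ 2 := fun l _ => by
    rw [dist_eq_norm]
    gcongr
    exact norm_le_pi_norm (y - WithLp.ofLp z) l
  refine (Finset.sum_le_sum h1).trans ?_
  rw [Finset.sum_const, Finset.card_univ, Fintype.card_fin, nsmul_eq_mul, mul_pow]
  gcongr
  rcases Nat.eq_zero_or_pos d with rfl | h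
  · simp
  · exact le_self_pow₀ (by exact_mod_cast h) two_ne_zero

/-- A single zero z₀ near one of the cubes below τ₀ provides the tangent hyperplane for all of them:
the other zeros used lie within 3r of z₀, so their deviation is O(κr²), and κr ≤ δ³ brings it below
rδ²/2. In `X` the summand 6d ensures 3r ≤ ρ, and 36dY absorbs the constant of the quadratic error.
-/
theorem exists_hyperplane_of_nearRegularZero (hd : 0 < d) (D : ℕ) :
    ∃ X : ℝ, 0 ≤ X ∧ ∀ (Q : MvPolynomial (Fin d) ℝ) (K κ : ℝ) (k a e : ℕ)
      (G : Finset (DyadicCube (Fin d) k)), Q ≠ 0 → Q.totalDegree ≤ D → 0 < κ → 0 < K →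
      1 / K ≤ 1 / 2 ^ k → 1 / K ≤ 1 / (2 * κ) → a ≤ k → κ * (1 / 2 ^ a) ≤ (1 / 2 ^ e) ^ 3 →
      X * (1 / 2 ^ e) ≤ 1 → (∀ θ ∈ G, NearRegularZero Q K κ θ) →
      ∀ τ₀ ∈ G.image (ancestor a), ∃ (i : Fin d) (b : {l : Fin d // l ≠ i} → ℝ) (h : ℝ),
        (∀ l, |b l| ≤ 1) ∧ ∀ θ ∈ G, ancestor a θ = τ₀ → ∃ z : Fin d → ℝ,
          (∀ l, |corner θ l - z l| ≤ 2 * (1 / 2 ^ k)) ∧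
          |z i - (h + ∑ l : {l : Fin d // l ≠ i}, b l * z l.1)|
            ≤ 1 / 2 * (1 / 2 ^ a * (1 / 2 ^ e) ^ 2) := by
  have : Nonempty (Fin d) := ⟨⟨0, hd⟩⟩
  obtain ⟨Y, hY, hflat⟩ := exists_hyperplane (Fin d) D
  refine ⟨36 * d * Y + 6 * d, by positivity, ?_⟩
  intro Q K κ k a e G hQ hQD hκ hK hKk hKκ hak hκa hX hG τ₀ hτ₀
  obtain ⟨θ₀, hθ₀, rfl⟩ := Finset.mem_image.1 hτ₀
  obtain ⟨x₀, hx₀, hx₀', h1, h2⟩ := hG θ₀ hθ₀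
  obtain ⟨z₀, hz₀, hxz₀⟩ := Metric.mem_thickening_iff.1 hx₀'
  have hd' : (0 : ℝ) < d := by exact_mod_cast hd
  -- Sup-norm balls of this radius about z₀ lie in the Euclidean ball of radius 1/κ about x₀: the
  -- change of norm costs at most d, and the distance from x₀ to z₀ takes up the remaining half.
  set ρ : ℝ := 1 / (2 * d * κ) with hρ
  have hρ0 : 0 < ρ := by positivity
  set r : ℝ := 1 / 2 ^ a with hr
  set δ : ℝ := 1 / 2 ^ e with hδ
  set s : ℝ := 1 / 2 ^ k with hs
  have hr0 : 0 < r := by positivity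
  have hδ0 : 0 < δ := by positivity
  have hδ1 : δ ≤ 1 := by
    rw [hδ, div_le_one (by positivity)]
    exact one_le_pow₀ one_le_two
  have hsr : s ≤ r := by
    rw [hs, hr]
    gcongr
    exact one_le_two
  have hsub : Metric.closedBall (WithLp.ofLp z₀) ρ
      ⊆ {y | WithLp.toLp 2 y ∈ Metric.ball x₀ (1 / κ)} := by
    intro y hy
    rw [Metric.mem_closedBall, dist_eq_norm] at hy
    rw [Set.mem_ofPred_eq, Metric.mem_ball]
    calc dist (WithLp.toLp 2 y) x₀ ≤ dist (WithLp.toLp 2 y) z₀ + dist z₀ x₀ := dist_triangle _ _ _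
      _ < d * ρ + 1 / K := by
        refine add_lt_add_of_le_of_lt ((dist_toLp_le y z₀).trans (by gcongr)) ?_
        rwa [dist_comm]
      _ ≤ 1 / (2 * κ) + 1 / (2 * κ) := by
        refine add_le_add (le_of_eq ?_) hKκ
        rw [hρ]
        field_simp
      _ = 1 / κ := by field_simp; norm_num
  obtain ⟨i, b, hb, hu⟩ := hflat Q (WithLp.ofLp z₀) ρ hQ hQD hρ0 hz₀
    (fun l => (h1 l).mono hsub) fun j l => (h2 j l).mono hsub
  refine ⟨i, b, z₀ i - ∑ l : {l : Fin d // l ≠ i}, b l * z₀ l.1, hb, fun θ hθ hτ => ?_⟩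
  obtain ⟨x, hx, hx', -, -⟩ := hG θ hθ
  obtain ⟨z, hz, hxz⟩ := Metric.mem_thickening_iff.1 hx'
  refine ⟨WithLp.ofLp z, fun l => ?_, ?_⟩
  · have h3 := abs_le.1 (abs_sub_apply_le_dist x z l)
    have h4 := hx l
    rw [abs_le]
    constructor <;> linarith
  have hnorm : ‖WithLp.ofLp z - WithLp.ofLp z₀‖ ≤ 3 * r := by
    refine (pi_norm_le_iff_of_nonneg (by positivity)).2 fun l => ?_
    have h3 := abs_le.1 (abs_sub_apply_le_dist x z l)
    have h4 := hx l
    have h5 := abs_le.1 (abs_sub_apply_le_dist x₀ z₀ l)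
    have h6 := hx₀ l
    have h7 := corner_ancestor_le hak θ l
    have h8 := corner_add_le_ancestor hak θ l
    have h9 := corner_ancestor_le hak θ₀ l
    have h10 := corner_add_le_ancestor hak θ₀ l
    rw [hτ] at h7 h8
    rw [Real.norm_eq_abs, Pi.sub_apply, abs_le]
    constructor <;> linarith
  have hrκ : r ≤ δ ^ 3 / κ := by
    rw [le_div_iff₀ hκ, mul_comm]
    exact hκa
  have hX1 : 6 * d * δ ≤ 1 := by
    refine le_trans ?_ hX
    gcongr
    nlinarith
  have hX2 : 36 * d * Y * δ ≤ 1 := by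
    refine le_trans ?_ hX
    gcongr
    linarith
  have h3 := hu (WithLp.ofLp z) (hnorm.trans ?_) hz
  · have h4 : z i - ((z₀ i - ∑ l : {l : Fin d // l ≠ i}, b l * z₀ l.1)
        + ∑ l : {l : Fin d // l ≠ i}, b l * z l.1)
        = (z i - z₀ i) - ∑ l : {l : Fin d // l ≠ i}, b l * (z l.1 - z₀ l.1) := by
      simp only [mul_sub, Finset.sum_sub_distrib]
      ring
    rw [h4]
    refine h3.trans ?_
    calc Y / ρ * ‖WithLp.ofLp z - WithLp.ofLp z₀‖ ^ 2 ≤ Y / ρ * (3 * r) ^ 2 := by gcongr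
      _ = 1 / 2 * (36 * d * Y * (κ * r) * r) := by
        rw [hρ]
        field_simp
        ring
      _ ≤ 1 / 2 * (36 * d * Y * δ ^ 3 * r) := by gcongr
      _ = 1 / 2 * ((36 * d * Y * δ) * (r * δ ^ 2)) := by ring
      _ ≤ 1 / 2 * (1 * (r * δ ^ 2)) := by gcongr
      _ = _ := by rw [one_mul]
  · calc 3 * r ≤ 3 * (δ ^ 3 / κ) := by gcongr
      _ ≤ 3 * (δ / κ) := by
        gcongr
        exact pow_le_of_le_one hδ0.le hδ1 (by norm_num)
      _ = (6 * d * δ) * ρ := by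
        rw [hρ]
        field_simp
        norm_num
      _ ≤ 1 * ρ := by gcongr
      _ = ρ := one_mul ρ

theorem le_ofReal_rpow_mul_trans {q : ℝ} (hq : 0 ≤ q) {a b c : ℝ≥0∞} {x y : ℝ} (hx : 0 ≤ x)
    (h1 : a ≤ ENNReal.ofReal x ^ q * b) (h2 : b ≤ ENNReal.ofReal y ^ q * c) :
    a ≤ ENNReal.ofReal (x * y) ^ q * c := by
  rw [ENNReal.ofReal_mul hx, ENNReal.mul_rpow_of_nonneg _ _ hq, mul_assoc]
  exact h1.trans (by gcongr)

theorem exists_two_pow_near {κ : ℝ} (hκ : 1 ≤ κ) : ∃ m : ℕ, κ ≤ 2 ^ m ∧ (2 : ℝ) ^ m ≤ 2 * κ := by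
  obtain ⟨m, h1, h2⟩ := exists_nat_pow_near hκ one_lt_two
  exact ⟨m + 1, h2.le, by rw [pow_succ]; linarith⟩

/-- The levels from 0 to m + 3e, and those after the last step, are passed trivially. In between
there is room for exactly N - 5 steps: the last one starts at m + (N - 3)e, the latest start for
which 3e further levels are guaranteed by m + Ne ≤ k. -/
theorem le_of_iterate_step {q : ℝ} (hq : 0 ≤ q) {S : ℕ → ℝ≥0∞} {W : ℝ} (hW : 0 ≤ W)
    {d m e N k : ℕ} (htriv : ∀ a b : ℕ, a ≤ b → b ≤ k →
      S a ≤ ENNReal.ofReal (2 ^ (d * (b - a))) ^ q * S b)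
    (hstep : ∀ a : ℕ, m + 3 * e ≤ a → a + 3 * e ≤ k → S a ≤ ENNReal.ofReal W ^ q * S (a + e))
    (hN : 5 ≤ N) (hk : m + N * e ≤ k) :
    S 0 ≤ ENNReal.ofReal (2 ^ (d * (m + 3 * e)) * (W ^ (N - 5)
      * 2 ^ (d * (k - (m + 3 * e + (N - 5) * e))))) ^ q * S k := by
  have hNe : N * e = (N - 5) * e + 5 * e := by rw [← add_mul, Nat.sub_add_cancel hN]
  have hiter : ∀ j : ℕ, j + 5 ≤ N → S (m + 3 * e)
      ≤ ENNReal.ofReal (W ^ j) ^ q * S (m + 3 * e + j * e) := by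
    intro j
    induction j with
    | zero => intro _; simp
    | succ j ih =>
      intro hj
      rw [pow_succ, show m + 3 * e + (j + 1) * e = m + 3 * e + j * e + e by ring]
      refine le_ofReal_rpow_mul_trans hq (pow_nonneg hW j) (ih (by omega)) (hstep (m + 3 * e + j * e) (by omega) ?_)
      have h3 : (j + 6) * e ≤ N * e := Nat.mul_le_mul_right _ (by omega)
      have h4 : (j + 6) * e = j * e + 6 * e := add_mul _ _ _
      omega
  have h1 := htriv 0 (m + 3 * e) (Nat.zero_le _) (by omega)
  rw [Nat.sub_zero] at h1
  exact le_ofReal_rpow_mul_trans hq (by positivity) h1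
    (le_ofReal_rpow_mul_trans hq (pow_nonneg hW _) (hiter (N - 5) (by omega))
      (htriv _ k (by omega) le_rfl))

/-- The trivial steps cover at most m + N + 6e levels. Here 2^{dm} will be comparable to κ^d, 2^{dN}
is a constant, and 2^{6de} ≤ (2^L)^ε because 6d ≤ εN and Ne ≤ L. -/
theorem two_pow_mul_pow_le {Λ ε R κ : ℝ} (hΛ : 0 ≤ Λ) (hε : 0 < ε) (hR : 1 ≤ R) (hκ : 0 < κ)
    {d m e N k L : ℕ} (hm : κ ≤ 2 ^ m) (hN : 6 * d ≤ ε * N) (hN5 : 5 ≤ N) (hk : m + L = k)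
    (hNe : N * e ≤ L) (hL : L ≤ N * e + N) :
    (2 : ℝ) ^ (d * (m + 3 * e)) * ((R * ((2 : ℝ) ^ e) ^ Λ) ^ (N - 5)
      * 2 ^ (d * (k - (m + 3 * e + (N - 5) * e))))
      ≤ 2 ^ (d * m) * 2 ^ (d * N) * R ^ N * (2 ^ k / κ) ^ (Λ + ε) := by
  have hNe' : N * e = (N - 5) * e + 5 * e := by rw [← add_mul, Nat.sub_add_cancel hN5]
  have h4 : (R * ((2 : ℝ) ^ e) ^ Λ) ^ (N - 5) ≤ R ^ N * ((2 : ℝ) ^ L) ^ Λ := by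
    rw [mul_pow]
    refine mul_le_mul (pow_le_pow_right₀ hR (Nat.sub_le _ _)) ?_ (by positivity) (by positivity)
    rw [← Real.rpow_mul_natCast (by positivity), mul_comm Λ, Real.rpow_mul (by positivity),
      Real.rpow_natCast, ← pow_mul]
    refine Real.rpow_le_rpow (by positivity) (pow_le_pow_right₀ one_le_two ?_) hΛ
    rw [mul_comm]
    omega
  have h5 : (2 : ℝ) ^ (6 * d * e) ≤ ((2 : ℝ) ^ L) ^ ε := by
    rw [← Real.rpow_natCast, ← Real.rpow_natCast, ← Real.rpow_mul zero_le_two]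
    refine Real.rpow_le_rpow_of_exponent_le one_le_two ?_
    have h6 : ((N * e : ℕ) : ℝ) ≤ L := by exact_mod_cast hNe
    push_cast at h6 ⊢
    calc (6 * d * e : ℝ) ≤ (ε * N) * e := by gcongr
      _ = ε * (N * e) := mul_assoc _ _ _
      _ ≤ ε * L := by gcongr
      _ = L * ε := mul_comm _ _
  have h6 : (2 : ℝ) ^ L ≤ 2 ^ k / κ := by
    rw [le_div_iff₀ hκ, ← hk, pow_add, mul_comm]
    gcongr
  have h7 : (2 : ℝ) ^ (d * (m + 3 * e)) * 2 ^ (d * (k - (m + 3 * e + (N - 5) * e)))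
      ≤ 2 ^ (d * m) * 2 ^ (d * N) * 2 ^ (6 * d * e) := by
    rw [← pow_add, ← pow_add, ← pow_add]
    refine pow_le_pow_right₀ one_le_two ?_
    have h8 : d * (m + 3 * e) + d * (k - (m + 3 * e + (N - 5) * e)) ≤ d * (m + N + 6 * e) := by
      rw [← mul_add]
      exact Nat.mul_le_mul_left _ (by omega)
    refine h8.trans_eq ?_
    ring
  calc (2 : ℝ) ^ (d * (m + 3 * e)) * ((R * ((2 : ℝ) ^ e) ^ Λ) ^ (N - 5)
        * 2 ^ (d * (k - (m + 3 * e + (N - 5) * e))))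
      = ((2 : ℝ) ^ (d * (m + 3 * e)) * 2 ^ (d * (k - (m + 3 * e + (N - 5) * e))))
        * (R * ((2 : ℝ) ^ e) ^ Λ) ^ (N - 5) := by ring
    _ ≤ (2 ^ (d * m) * 2 ^ (d * N) * 2 ^ (6 * d * e)) * (R ^ N * ((2 : ℝ) ^ L) ^ Λ) :=
      mul_le_mul h7 h4 (by positivity) (by positivity)
    _ ≤ (2 ^ (d * m) * 2 ^ (d * N) * ((2 : ℝ) ^ L) ^ ε) * (R ^ N * ((2 : ℝ) ^ L) ^ Λ) := by
      gcongr
    _ = 2 ^ (d * m) * 2 ^ (d * N) * R ^ N * ((2 : ℝ) ^ L) ^ (Λ + ε) := by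
      rw [Real.rpow_add (by positivity)]
      ring
    _ ≤ 2 ^ (d * m) * 2 ^ (d * N) * R ^ N * (2 ^ k / κ) ^ (Λ + ε) := by
      gcongr

/-- Decoupling for cubes near the regular part of the zero set of a polynomial. -/
theorem exists_decouplesPow_of_nearRegularZero (hd : 0 < d)
    {P : Fin n → QuadraticForm ℝ (Fin d → ℝ)} {B C : ℝ}
    (hB : FormBound P B) (hC : 2 + 8 * B * (Fintype.card (Fin d) + 1) ^ 2 ≤ C) {p : ℝ≥0∞}
    (hp : 1 ≤ p) (hp' : p ≠ ∞) {Λ : ℝ} (hΛ : 0 ≤ Λ) {B' : ℝ} (hB' : 1 ≤ B')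
    (hdec : ∀ (i : Fin d) (b : {l : Fin d // l ≠ i} → ℝ), (∀ l, |b l| ≤ 1) → ∀ e : ℕ,
      DecouplesPow (fun j => (P j).comp (graphMap i b)) C p
        (Finset.univ : Finset (DyadicCube {l : Fin d // l ≠ i} e)) (B' * ((2 : ℝ) ^ e) ^ Λ))
    (D : ℕ) {ε : ℝ} (hε : 0 < ε) :
    ∃ M : ℝ, 0 ≤ M ∧ ∀ (Q : MvPolynomial (Fin d) ℝ) (K κ : ℝ) (k : ℕ)
      (G : Finset (DyadicCube (Fin d) k)), Q ≠ 0 → Q.totalDegree ≤ D → 1 ≤ κ → κ ≤ 2 ^ k →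
      0 < K → 1 / K ≤ 1 / 2 ^ k / κ → (∀ θ ∈ G, NearRegularZero Q K κ θ) →
        DecouplesPow P C p G (M * (κ ^ d * (2 ^ k / κ) ^ (Λ + ε))) := by
  obtain ⟨X, hX0, hX⟩ := exists_hyperplane_of_nearRegularZero hd D
  have hB0 := hB.1
  have hC0 : 0 ≤ C := le_trans (by positivity) hC
  have hq : 0 ≤ p.toReal := ENNReal.toReal_nonneg
  set Y : ℝ := X + (2 * Fintype.card (Fin d) * (C + 2) + C + B * C ^ 2) with hY
  have hY0 : 0 ≤ Y := by positivity
  obtain ⟨e₀, he₀⟩ := pow_unbounded_of_one_lt Y (one_lt_two (α := ℝ))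
  -- The number of steps depends on d and ε only, so the accumulated constant R^N is admissible.
  set N : ℕ := ⌈6 * d / ε⌉₊ + 6 with hN
  have hNε : 6 * d ≤ ε * N := by
    have := Nat.le_ceil (6 * d / ε)
    rw [div_le_iff₀ hε] at this
    rw [hN]
    push_cast
    nlinarith
  set R : ℝ := B' * (2 * (3 * Fintype.card (Fin d) + 1) + 1 : ℕ) with hR
  have hR1 : 1 ≤ R := by
    rw [hR]
    refine one_le_mul_of_one_le_of_one_le hB' ?_
    exact_mod_cast Nat.le_add_left 1 _
  refine ⟨2 ^ d * R ^ N * 2 ^ (d * N) + 2 ^ d * 2 ^ (d * (N * (e₀ + 1))), by positivity, ?_⟩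
  intro Q K κ k G hQ hQD hκ hκk hK hKk hG f hf hs
  have hκ0 : 0 < κ := zero_lt_one.trans_le hκ
  obtain ⟨m, hm1, hm2⟩ := exists_two_pow_near hκ
  have h2m : (2 : ℝ) ^ (d * m) ≤ 2 ^ d * κ ^ d := by
    rw [mul_comm, pow_mul, ← mul_pow]
    gcongr
  have htriv : ∀ a b : ℕ, a ≤ b → b ≤ k → levelSum p G f a
      ≤ ENNReal.ofReal (2 ^ (d * (b - a))) ^ p.toReal * levelSum p G f b := by
    intro a b hab hb
    have h := levelSum_le_of_le hp hp' hf hab hb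
    rw [Fintype.card_fin] at h
    rw [ENNReal.ofReal_pow zero_le_two]
    simpa using h
  have h1 := lpPow_le_levelSum_zero (f := f) (G := G) hp hp'
  rw [← levelSum_self]
  suffices h : ∃ y : ℝ, levelSum p G f 0 ≤ ENNReal.ofReal y ^ p.toReal * levelSum p G f k ∧
      y ≤ (2 ^ d * R ^ N * 2 ^ (d * N) + 2 ^ d * 2 ^ (d * (N * (e₀ + 1)))) *
        (κ ^ d * (2 ^ k / κ) ^ (Λ + ε)) by
    obtain ⟨y, hy1, hy2⟩ := h
    refine h1.trans (hy1.trans ?_)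
    gcongr
  have hone : (1 : ℝ) ≤ (2 ^ k / κ) ^ (Λ + ε) :=
    Real.one_le_rpow ((one_le_div hκ0).2 hκk) (by positivity)
  -- Possibly m = k + 1; then L = 0 by truncation and the first case below applies.
  set L : ℕ := k - m with hL
  set e : ℕ := L / N with he
  have hNpos : 0 < N := by omega
  -- If the step is too short to absorb constants, then k - m is bounded and the trivial estimate
  -- costs only a constant times κ^d. The two summands of the final constant belong to the two
  -- cases.
  by_cases hee : e < e₀ + 1
  · refine ⟨_, htriv 0 k (Nat.zero_le _) le_rfl, ?_⟩
    have hLN : L ≤ N * (e₀ + 1) := by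
      have h2 := Nat.div_add_mod L N
      rw [← he] at h2
      have h3 := Nat.mod_lt L hNpos
      have h4 : N * (e + 1) ≤ N * (e₀ + 1) := Nat.mul_le_mul_left _ hee
      rw [mul_add, mul_one] at h4
      omega
    calc (2 : ℝ) ^ (d * (k - 0)) ≤ 2 ^ (d * m + d * (N * (e₀ + 1))) := by
          refine pow_le_pow_right₀ one_le_two ?_
          rw [← mul_add]
          exact Nat.mul_le_mul_left _ (by omega)
      _ = 2 ^ (d * m) * 2 ^ (d * (N * (e₀ + 1))) := pow_add _ _ _
      _ ≤ (2 ^ d * κ ^ d) * 2 ^ (d * (N * (e₀ + 1))) := by gcongr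
      _ = (2 ^ d * 2 ^ (d * (N * (e₀ + 1)))) * (κ ^ d * 1) := by ring
      _ ≤ _ := by
          gcongr
          exact le_add_of_nonneg_left (by positivity)
  · push Not at hee
    have he1 : 1 ≤ e := by omega
    have hNe : N * e ≤ L := Nat.mul_div_le L N
    have hmod := Nat.div_add_mod L N
    rw [← he] at hmod
    have hmodlt := Nat.mod_lt L hNpos
    have hmk : m + L = k := by
      have : 1 ≤ N * e := Nat.mul_pos hNpos he1
      omega
    have h1K : 1 / K ≤ 1 / 2 ^ k := hKk.trans (div_le_self (by positivity) hκ)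
    have h2K : 1 / K ≤ 1 / (2 * κ) := by
      refine hKk.trans ?_
      rw [div_div]
      gcongr
      refine le_self_pow₀ one_le_two ?_
      have : 1 ≤ N * e := Nat.mul_pos hNpos he1
      omega
    have hδ : Y * (1 / 2 ^ e) ≤ 1 := by
      rw [mul_one_div, div_le_one (by positivity)]
      exact he₀.le.trans (pow_le_pow_right₀ one_le_two (by omega))
    set W : ℝ := (B' * ((2 : ℝ) ^ e) ^ Λ) * (2 * (3 * Fintype.card (Fin d) + 1) + 1 : ℕ) with hW
    have hW0 : 0 ≤ W := by positivity
    have hZ0 : 0 ≤ 2 * Fintype.card (Fin d) * (C + 2) + C + B * C ^ 2 := by positivity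
    have hδX : X * (1 / 2 ^ e) ≤ 1 := by
      refine le_trans ?_ hδ
      gcongr
      linarith
    have hδZ : (2 * Fintype.card (Fin d) * (C + 2) + C + B * C ^ 2) * (1 / 2 ^ e) ≤ 1 := by
      refine le_trans ?_ hδ
      gcongr
      linarith
    have hstep : ∀ a : ℕ, m + 3 * e ≤ a → a + 3 * e ≤ k → levelSum p G f a
        ≤ ENNReal.ofReal W ^ p.toReal * levelSum p G f (a + e) := by
      intro a ha hak
      have h2 := levelSum_le_of_hyperplane hB hC hp hp' hf hs (a := a) (e := e)
        (fun i b hb => hdec i b hb e) hak hδZ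
        (hX Q K κ k a e G hQ hQD hκ0 hK h1K h2K (by omega) ?_ hδX hG)
      · refine h2.trans_eq ?_
        rw [hW, ENNReal.ofReal_mul (p := B' * ((2 : ℝ) ^ e) ^ Λ) (by positivity), ENNReal.ofReal_natCast]
      · calc κ * (1 / 2 ^ a) ≤ 2 ^ m * (1 / 2 ^ (m + 3 * e)) := by
              gcongr
              exact one_le_two
          _ = (1 / 2 ^ e) ^ 3 := by
              rw [pow_add, mul_comm 3 e, pow_mul]
              field_simp
    have hNL : m + N * e ≤ k := by omega
    refine ⟨_, le_of_iterate_step hq hW0 htriv hstep (by omega) hNL, ?_⟩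
    have h3 : W = R * ((2 : ℝ) ^ e) ^ Λ := by
      rw [hW, hR]
      ring
    rw [h3]
    refine (two_pow_mul_pow_le hΛ hε hR1 hκ0 hm1 hNε (by omega) hmk hNe (by omega)).trans ?_
    calc (2 : ℝ) ^ (d * m) * 2 ^ (d * N) * R ^ N * (2 ^ k / κ) ^ (Λ + ε)
        ≤ (2 ^ d * κ ^ d) * 2 ^ (d * N) * R ^ N * (2 ^ k / κ) ^ (Λ + ε) := by gcongr
      _ = (2 ^ d * R ^ N * 2 ^ (d * N)) * (κ ^ d * (2 ^ k / κ) ^ (Λ + ε)) := by ring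
      _ ≤ _ := by
        gcongr
        exact le_add_of_nonneg_right (by positivity)

end Level

/-! ### Iterated derivatives and the multi-scale covering -/

section Cover

open MvPolynomial

/-- Each cube is assigned to one covering family. The triangle inequality between the families costs
their number, and within a family the functions assigned elsewhere are replaced by zero. -/
theorem DecouplesPow.of_cover {ι : Type} [Fintype ι] {n k : ℕ}
    {P : Fin n → QuadraticForm ℝ (ι → ℝ)} {C : ℝ} {p : ℝ≥0∞} (hp : 1 ≤ p) (hp' : p ≠ ∞)
    {κ : Type*} (S : Finset κ) (Γ : κ → Finset (DyadicCube ι k)) {G : Finset (DyadicCube ι k)}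
    (hG : ∀ θ ∈ G, ∃ q ∈ S, θ ∈ Γ q) {M : ℝ} (h : ∀ q ∈ S, DecouplesPow P C p (Γ q) M) :
    DecouplesPow P C p G (S.card * M) := by
  classical
  intro f hf hs
  have hpos : 0 < p.toReal := ENNReal.toReal_pos (zero_lt_one.trans_le hp).ne' hp'
  rcases G.eq_empty_or_nonempty with rfl | ⟨θ₀, hθ₀⟩
  · simp [lpPow, hpos]
  have : Nonempty κ := let ⟨q, _⟩ := hG θ₀ hθ₀; ⟨q⟩
  choose! q hqS hqΓ using hG
  have hsum : (fun x => ∑ θ ∈ G, f θ x) = fun x => ∑ s ∈ S, ∑ θ ∈ G with q θ = s, f θ x :=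
    funext fun x => (Finset.sum_fiberwise_of_maps_to hqS _).symm
  have hpart : ∀ s ∈ S, lpPow p (fun x => ∑ θ ∈ G with q θ = s, f θ x)
      ≤ ENNReal.ofReal M ^ p.toReal * ∑ θ ∈ G with q θ = s, lpPow p (f θ) := by
    intro s hsS
    let g : DyadicCube ι k → Ambient ι n → ℂ := fun θ =>
      if θ ∈ G ∧ q θ = s then f θ else fun _ => 0
    have hg : ∀ θ, θ ∈ G ∧ q θ = s → g θ = f θ := fun θ hθ => if_pos hθ
    have hg' : ∀ θ, ¬ (θ ∈ G ∧ q θ = s) → g θ = fun _ => 0 := fun θ hθ => if_neg hθ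
    have hsub : (G.filter fun θ => q θ = s) ⊆ Γ s := fun θ hθ => by
      obtain ⟨h1, h2⟩ := Finset.mem_filter.1 hθ
      exact h2 ▸ hqΓ θ h1
    have key := h s hsS g (fun θ _ => ?_) fun θ _ => ?_
    · have h1 : (fun x => ∑ θ ∈ Γ s, g θ x) = fun x => ∑ θ ∈ G with q θ = s, f θ x := by
        funext x
        rw [← Finset.sum_subset hsub fun θ _ hθ => by
          rw [hg' θ fun h => hθ (Finset.mem_filter.2 h)]]
        exact Finset.sum_congr rfl fun θ hθ => by rw [hg θ (Finset.mem_filter.1 hθ)]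
      have h2 : ∑ θ ∈ Γ s, lpPow p (g θ) = ∑ θ ∈ G with q θ = s, lpPow p (f θ) := by
        rw [← Finset.sum_subset hsub fun θ _ hθ => by
          rw [hg' θ fun h => hθ (Finset.mem_filter.2 h)]
          simp [lpPow, hpos]]
        exact Finset.sum_congr rfl fun θ hθ => by rw [hg θ (Finset.mem_filter.1 hθ)]
      rwa [h1, h2] at key
    · by_cases hθ : θ ∈ G ∧ q θ = s
      · rw [hg θ hθ]
        exact hf θ hθ.1
      · rw [hg' θ hθ]
        exact MemLp.zero
    · by_cases hθ : θ ∈ G ∧ q θ = s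
      · rw [hg θ hθ]
        exact hs θ hθ.1
      · rw [hg' θ hθ]
        exact spectrumIn_zero _
  rw [hsum]
  refine (lpPow_sum_le S hp hp' fun s _ => (memLp_finsetSum _ fun θ hθ =>
    hf θ (Finset.mem_filter.1 hθ).1).1).trans ?_
  rw [ENNReal.ofReal_mul (by positivity), ENNReal.ofReal_natCast,
    ENNReal.mul_rpow_of_nonneg _ _ hpos.le, mul_assoc,
    ← Finset.sum_fiberwise_of_maps_to hqS fun θ => lpPow p (f θ), Finset.mul_sum _ _
      (ENNReal.ofReal M ^ p.toReal)]
  gcongr with s hsS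
  exact hpart s hsS

theorem DecouplesPow.mono_const {ι : Type} [Fintype ι] {n k : ℕ}
    {P : Fin n → QuadraticForm ℝ (ι → ℝ)} {C : ℝ} {p : ℝ≥0∞} {G : Finset (DyadicCube ι k)}
    {M M' : ℝ} (h : DecouplesPow P C p G M) (hM : M ≤ M') : DecouplesPow P C p G M' := by
  intro f hf hs
  refine (h f hf hs).trans ?_
  gcongr

variable {d : ℕ}

/-- The nonzero first and second derivatives of the polynomials in `S`. -/
def derivFamily (S : Finset (MvPolynomial (Fin d) ℝ)) : Finset (MvPolynomial (Fin d) ℝ) := by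
  classical exact (S.biUnion fun q => (Finset.univ.image fun l => pderiv l q) ∪
    Finset.univ.image fun jl : Fin d × Fin d => pderiv jl.1 (pderiv jl.2 q)).filter (· ≠ 0)

theorem pderiv_mem_derivFamily {S : Finset (MvPolynomial (Fin d) ℝ)} {q : MvPolynomial (Fin d) ℝ}
    (hq : q ∈ S) (l : Fin d) (h : pderiv l q ≠ 0) : pderiv l q ∈ derivFamily S := by
  classical
  refine Finset.mem_filter.2 ⟨Finset.mem_biUnion.2 ⟨q, hq, Finset.mem_union_left _ ?_⟩, h⟩
  exact Finset.mem_image_of_mem _ (Finset.mem_univ l)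

theorem pderiv_pderiv_mem_derivFamily {S : Finset (MvPolynomial (Fin d) ℝ)}
    {q : MvPolynomial (Fin d) ℝ} (hq : q ∈ S) (j l : Fin d) (h : pderiv j (pderiv l q) ≠ 0) :
    pderiv j (pderiv l q) ∈ derivFamily S := by
  classical
  refine Finset.mem_filter.2 ⟨Finset.mem_biUnion.2 ⟨q, hq, Finset.mem_union_right _ ?_⟩, h⟩
  exact Finset.mem_image.2 ⟨(j, l), Finset.mem_univ _, rfl⟩

theorem card_derivFamily_le (S : Finset (MvPolynomial (Fin d) ℝ)) :
    (derivFamily S).card ≤ S.card * (d + d * d) := by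
  classical
  refine (Finset.card_filter_le _ _).trans (Finset.card_biUnion_le_card_mul _ _ _ fun q _ => ?_)
  refine (Finset.card_union_le _ _).trans (add_le_add ?_ ?_)
  · exact Finset.card_image_le.trans_eq (by simp)
  · exact Finset.card_image_le.trans_eq (by simp)

theorem mem_derivFamily_degree {S : Finset (MvPolynomial (Fin d) ℝ)} {D : ℕ}
    (hS : ∀ q ∈ S, q.totalDegree ≤ D) {q : MvPolynomial (Fin d) ℝ} (hq : q ∈ derivFamily S) :
    q ≠ 0 ∧ q.totalDegree ≤ D - 1 := by
  classical
  obtain ⟨h1, h2⟩ := Finset.mem_filter.1 hq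
  refine ⟨h2, ?_⟩
  obtain ⟨r, hr, h3⟩ := Finset.mem_biUnion.1 h1
  have h4 := hS r hr
  rcases Finset.mem_union.1 h3 with h | h
  · obtain ⟨l, -, rfl⟩ := Finset.mem_image.1 h
    have := totalDegree_pderiv_le l r
    omega
  · obtain ⟨⟨j, l⟩, -, rfl⟩ := Finset.mem_image.1 h
    have h5 := totalDegree_pderiv_le l r
    have h6 := totalDegree_pderiv_le j (pderiv l r)
    simp only
    omega

/-- The `t`-th iterated family of derivatives of `Q`. -/
def iterDerivFamily (Q : MvPolynomial (Fin d) ℝ) (t : ℕ) : Finset (MvPolynomial (Fin d) ℝ) :=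
  derivFamily^[t] {Q}

theorem iterDerivFamily_succ (Q : MvPolynomial (Fin d) ℝ) (t : ℕ) :
    iterDerivFamily Q (t + 1) = derivFamily (iterDerivFamily Q t) :=
  Function.iterate_succ_apply' _ _ _

theorem card_iterDerivFamily_le (Q : MvPolynomial (Fin d) ℝ) (t : ℕ) :
    (iterDerivFamily Q t).card ≤ (d + d * d) ^ t := by
  induction t with
  | zero => simp [iterDerivFamily]
  | succ t ih =>
    rw [iterDerivFamily_succ, pow_succ]
    exact (card_derivFamily_le _).trans (Nat.mul_le_mul_right _ ih)

theorem mem_iterDerivFamily {Q : MvPolynomial (Fin d) ℝ} {D : ℕ} (hQ : Q ≠ 0)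
    (hD : Q.totalDegree ≤ D) (t : ℕ) :
    ∀ q ∈ iterDerivFamily Q t, q ≠ 0 ∧ q.totalDegree ≤ D - t := by
  induction t with
  | zero =>
    intro q hq
    obtain rfl : q = Q := by simpa [iterDerivFamily] using hq
    exact ⟨hQ, hD⟩
  | succ t ih =>
    intro q hq
    rw [iterDerivFamily_succ] at hq
    exact mem_derivFamily_degree (fun q hq => (ih q hq).2) hq

theorem interior_cubeSet_subset {k : ℕ} (θ : DyadicCube (Fin d) k) (l : Fin d)
    {t : EuclideanSpace ℝ (Fin d)} (ht : t ∈ interior (cubeSet θ)) :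
    corner θ l < t l ∧ t l < corner θ l + 1 / 2 ^ k := by
  have hopen : IsOpenMap (EuclideanSpace.proj l : EuclideanSpace ℝ (Fin d) →L[ℝ] ℝ) := by
    refine ContinuousLinearMap.isOpenMap _ fun y => ⟨EuclideanSpace.single l y, ?_⟩
    simp
  have hsub : cubeSet θ ⊆ (EuclideanSpace.proj l : EuclideanSpace ℝ (Fin d) →L[ℝ] ℝ) ⁻¹'
      Set.Icc (corner θ l) (corner θ l + 1 / 2 ^ k) := fun t ht => ht l
  have h := interior_mono hsub ht
  rw [← hopen.preimage_interior_eq_interior_preimage (ContinuousLinearMap.continuous _),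
    interior_Icc] at h
  exact h

/-- Dyadic cubes whose interiors meet are nested; the strict inequalities available in the interiors
identify the integer quotients. -/
theorem ancestor_eq_of_not_disjoint {a b : ℕ} (hab : a ≤ b) (θ : DyadicCube (Fin d) a)
    (θ' : DyadicCube (Fin d) b)
    (h : ¬ Disjoint (interior (cubeSet θ)) (interior (cubeSet θ'))) : ancestor a θ' = θ := by
  obtain ⟨t, ht, ht'⟩ := Set.not_disjoint_iff.1 h
  funext l
  apply Fin.ext
  obtain ⟨h1, h2⟩ := interior_cubeSet_subset θ l ht
  obtain ⟨h3, h4⟩ := interior_cubeSet_subset θ' l ht'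
  have hb : (2 : ℝ) ^ b = 2 ^ a * 2 ^ (b - a) := by rw [← pow_add, Nat.add_sub_cancel' hab]
  have ha0 : (0 : ℝ) < 2 ^ a := by positivity
  have hb0 : (0 : ℝ) < 2 ^ b := by positivity
  have h5 : ((θ l : ℕ) : ℝ) / 2 ^ a < (((θ' l : ℕ) : ℝ) + 1) / 2 ^ b := by
    simpa [corner, add_div] using h1.trans h4
  have h6 : ((θ' l : ℕ) : ℝ) / 2 ^ b < (((θ l : ℕ) : ℝ) + 1) / 2 ^ a := by
    simpa [corner, add_div] using h3.trans h2
  rw [div_lt_div_iff₀ ha0 hb0, hb, mul_comm (2 ^ a : ℝ), ← mul_assoc] at h5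
  rw [div_lt_div_iff₀ hb0 ha0, hb, mul_comm (2 ^ a : ℝ), ← mul_assoc] at h6
  have h7 : ((θ l : ℕ) : ℝ) * 2 ^ (b - a) < ((θ' l : ℕ) : ℝ) + 1 := lt_of_mul_lt_mul_right h5 ha0.le
  have h8 : ((θ' l : ℕ) : ℝ) < (((θ l : ℕ) : ℝ) + 1) * 2 ^ (b - a) :=
    lt_of_mul_lt_mul_right h6 ha0.le
  have h7' : (θ l : ℕ) * 2 ^ (b - a) < (θ' l : ℕ) + 1 := by exact_mod_cast h7
  have h8' : (θ' l : ℕ) < ((θ l : ℕ) + 1) * 2 ^ (b - a) := by exact_mod_cast h8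
  rw [ancestor_val hab]
  exact Nat.div_eq_of_lt_le (by omega) h8'

theorem exists_mem_cubeSet (k : ℕ) {x : EuclideanSpace ℝ (Fin d)}
    (hx : ∀ l, x l ∈ Set.Icc (0 : ℝ) 1) : ∃ θ : DyadicCube (Fin d) k, x ∈ cubeSet θ := by
  have h2 : (0 : ℝ) < 2 ^ k := by positivity
  have hpos : 0 < 2 ^ k := by positivity
  -- The minimum takes care of x_l = 1, where the floor would be 2^k.
  refine ⟨fun l => ⟨min ⌊x l * 2 ^ k⌋₊ (2 ^ k - 1), by omega⟩, fun l => ?_⟩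
  have h0 : 0 ≤ x l * 2 ^ k := mul_nonneg (hx l).1 h2.le
  have h1 : x l * 2 ^ k ≤ 2 ^ k := mul_le_of_le_one_left h2.le (hx l).2
  simp only [corner]
  rw [← add_div, div_le_iff₀ h2, le_div_iff₀ h2]
  constructor
  · refine le_trans ?_ (Nat.floor_le h0)
    exact_mod_cast min_le_left _ _
  · rcases le_total ⌊x l * 2 ^ k⌋₊ (2 ^ k - 1) with h | h
    · rw [min_eq_left h]
      exact (Nat.lt_floor_add_one _).le
    · rw [min_eq_right h]
      have : ((2 ^ k - 1 : ℕ) : ℝ) + 1 = 2 ^ k := by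
        rw [Nat.cast_sub hpos]
        push_cast
        ring
      rw [this]
      exact h1

theorem mem_cubeSet_ancestor {a k : ℕ} (ha : a ≤ k) {θ : DyadicCube (Fin d) k}
    {x : EuclideanSpace ℝ (Fin d)} (hx : x ∈ cubeSet θ) : x ∈ cubeSet (ancestor a θ) := fun l =>
  ⟨(corner_ancestor_le ha θ l).trans (hx l).1, (hx l).2.trans (corner_add_le_ancestor ha θ l)⟩

/-- Let A t say that x is within 1/κ(D - t + 1) of a zero of a polynomial of generation t. It holds
for t = 0 and fails for t = D, where only nonzero constants remain. At a generation t where A t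
holds and A (t + 1) fails, x is close to Z_q but far from the zeros of the derivatives of q; the
scale is j = D - t. -/
theorem exists_nearRegularZero {Q : MvPolynomial (Fin d) ℝ} {D : ℕ} (hQ : Q ≠ 0)
    (hD : Q.totalDegree ≤ D) (κ : ℕ → ℝ) (k : ℕ → ℕ) {x : EuclideanSpace ℝ (Fin d)}
    (hx : x ∈ Metric.thickening (1 / κ (D + 1)) (zeroSet Q))
    (hx' : ∀ l, x l ∈ Set.Icc (0 : ℝ) 1) :
    ∃ j ∈ Finset.Icc 1 D, ∃ θ : DyadicCube (Fin d) (k j), x ∈ cubeSet θ ∧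
      ∃ q ∈ iterDerivFamily Q (D - j), NearRegularZero q (κ (j + 1)) (κ j) θ := by
  classical
  let A : ℕ → Prop := fun t =>
    ∃ q ∈ iterDerivFamily Q t, x ∈ Metric.thickening (1 / κ (D - t + 1)) (zeroSet q)
  have hA0 : A 0 := ⟨Q, by simp [iterDerivFamily], hx⟩
  have hAD : ¬ A D := by
    rintro ⟨q, hq, hxq⟩
    obtain ⟨h1, h2⟩ := mem_iterDerivFamily hQ hD D q hq
    obtain ⟨z, hz, -⟩ := Metric.mem_thickening_iff.1 hxq
    rw [Nat.sub_self, Nat.le_zero, totalDegree_eq_zero_iff_eq_C] at h2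
    rw [zeroSet, Set.mem_ofPred_eq, h2, eval_C] at hz
    rw [hz, C_0] at h2
    exact h1 h2
  obtain ⟨t, htD, ⟨q, hq, hxq⟩, hnot⟩ : ∃ t < D, A t ∧ ¬ A (t + 1) := by
    by_contra! h
    have : ∀ t ≤ D, A t := by
      intro t
      induction t with
      | zero => exact fun _ => hA0
      | succ t ih => exact fun ht => h t (by omega) (ih (by omega))
    exact hAD (this D le_rfl)
  obtain ⟨θ, hθ⟩ := exists_mem_cubeSet (k (D - t)) hx'
  have hfree : ∀ r : MvPolynomial (Fin d) ℝ, (r ≠ 0 → r ∈ derivFamily (iterDerivFamily Q t)) →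
      ZeroFreeOn r {y | WithLp.toLp 2 y ∈ Metric.ball x (1 / κ (D - t))} := by
    intro r hr
    by_cases h0 : r = 0
    · exact Or.inl h0
    · refine Or.inr fun y hy hy0 => hnot ⟨r, ?_, ?_⟩
      · rw [iterDerivFamily_succ]
        exact hr h0
      · rw [show D - (t + 1) + 1 = D - t by omega]
        refine Metric.mem_thickening_iff.2 ⟨WithLp.toLp 2 y, hy0, ?_⟩
        rw [dist_comm]
        exact hy
  refine ⟨D - t, Finset.mem_Icc.2 ⟨by omega, by omega⟩, θ, hθ, q, ?_, x, hθ, hxq, fun l => ?_,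
    fun j l => ?_⟩
  · rwa [show D - (D - t) = t by omega]
  · exact hfree _ (pderiv_mem_derivFamily hq l)
  · exact hfree _ (pderiv_pderiv_mem_derivFamily hq j l)

/-- All cubes containing a suitable regular point are collected, and those with a collected ancestor
at a coarser scale are dropped. Nestedness gives disjointness, and a point remains covered by a cube
of the coarsest scale at which a collected cube contains it. -/
theorem exists_disjointCover {Q : MvPolynomial (Fin d) ℝ} {D : ℕ} (hQ : Q ≠ 0)
    (hD : Q.totalDegree ≤ D) (κ : ℕ → ℝ) (k : ℕ → ℕ)
    (hk : ∀ i j : ℕ, 1 ≤ i → i ≤ j → j ≤ D → k i ≤ k j) :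
    ∃ G : (j : ℕ) → Finset (DyadicCube (Fin d) (k j)), DisjointCover Q (κ (D + 1)) D k G ∧
      ∀ j, ∀ θ ∈ G j, ∃ q ∈ iterDerivFamily Q (D - j),
        NearRegularZero q (κ (j + 1)) (κ j) θ := by
  classical
  let Γ : (j : ℕ) → Finset (DyadicCube (Fin d) (k j)) := fun j =>
    Finset.univ.filter fun θ => ∃ q ∈ iterDerivFamily Q (D - j),
      NearRegularZero q (κ (j + 1)) (κ j) θ
  let G : (j : ℕ) → Finset (DyadicCube (Fin d) (k j)) := fun j =>
    (Γ j).filter fun θ => ∀ i, 1 ≤ i → i < j → ancestor (k i) θ ∉ Γ i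
  have hmem : ∀ j θ, θ ∈ G j ↔ θ ∈ Γ j ∧ ∀ i, 1 ≤ i → i < j → ancestor (k i) θ ∉ Γ i :=
    fun j θ => by simp only [G, Finset.mem_filter]
  have hlt : ∀ j j' : ℕ, 1 ≤ j → j < j' → j' ≤ D → ∀ θ ∈ G j, ∀ θ' ∈ G j',
      Disjoint (interior (cubeSet θ)) (interior (cubeSet θ')) := by
    intro j j' hj hjj hj' θ hθ θ' hθ'
    by_contra h
    have h1 := ancestor_eq_of_not_disjoint (hk j j' hj hjj.le hj') θ θ' h
    refine ((hmem _ _).1 hθ').2 j hj hjj ?_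
    rw [h1]
    exact ((hmem _ _).1 hθ).1
  refine ⟨G, ⟨?_, ?_⟩, fun j θ hθ => (Finset.mem_filter.1 ((hmem _ _).1 hθ).1).2⟩
  · intro j hj j' hj' θ hθ θ' hθ' hne
    rw [Finset.mem_Icc] at hj hj'
    rcases lt_trichotomy j j' with h | rfl | h
    · exact hlt j j' hj.1 h hj'.2 θ hθ θ' hθ'
    · by_contra h
      have h1 := ancestor_eq_of_not_disjoint le_rfl θ θ' h
      rw [ancestor_self] at h1
      exact hne (by rw [h1])
    · exact (hlt j' j hj'.1 h hj.2 θ' hθ' θ hθ).symm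
  · rintro x ⟨hx, hx'⟩
    have hex : ∃ j, j ∈ Finset.Icc 1 D ∧ ∃ θ ∈ Γ j, x ∈ cubeSet θ := by
      obtain ⟨j, hj, θ, hθ, hq⟩ := exists_nearRegularZero hQ hD κ k hx hx'
      exact ⟨j, hj, θ, Finset.mem_filter.2 ⟨Finset.mem_univ _, hq⟩, hθ⟩
    obtain ⟨hj, θ, hθ, hxθ⟩ := Nat.find_spec hex
    have hj' := Finset.mem_Icc.1 hj
    refine Set.mem_iUnion₂.2 ⟨Nat.find hex, hj, Set.mem_iUnion₂.2 ⟨θ, ?_, hxθ⟩⟩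
    refine (hmem _ _).2 ⟨hθ, fun i hi hij hΓ => ?_⟩
    exact Nat.find_min hex hij ⟨Finset.mem_Icc.2 ⟨hi, by omega⟩, _, hΓ,
      mem_cubeSet_ancestor (hk i _ hi hij.le hj'.2) hxθ⟩

end Cover

/-! ### Choice of the scales -/

section Scales

/-- The scales `κ` of the multi-scale covering, with `κ (D + 1) = K`, and the levels `k` of the
corresponding dyadic cubes. -/
theorem exists_scales {A : ℝ} (hA : 1 < A) {K : ℝ} (hK : 1 ≤ K) (D : ℕ) :
    ∃ (κ : ℕ → ℝ) (k : ℕ → ℕ), κ (D + 1) = K ∧ (∀ j, 1 ≤ κ j) ∧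
      (∀ j ∈ Finset.Icc 1 D, κ j ≤ κ (j + 1) ∧ κ (j + 1) ≤ 4 * κ j ^ (A + 1) ∧
        κ j ^ (A + 1) ≤ κ (j + 1) ∧ κ j ^ A = 2 ^ k j) ∧
      ∀ j ∈ Finset.Icc 1 D, Real.logb 2 K / (A + 1) ^ D - 2 ≤ Real.logb 2 (κ j) := by
  have hA0 : 0 < A := by linarith
  let lev : ℝ → ℕ := fun x => ⌊A / (A + 1) * Real.logb 2 x⌋₊
  -- The scales are built downwards from K: up to rounding this is x^{1/(A+1)}, rounded so that its
  -- A-th power is a power of two. Rounding costs (A+1)/A ≤ 2 in log₂(next x ^ (A+1)), whence the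
  -- factor 4.
  let next : ℝ → ℝ := fun x => 2 ^ ((lev x : ℝ) / A)
  have hnext1 : ∀ x, 1 ≤ next x := fun x => Real.one_le_rpow one_le_two (by positivity)
  have hlogn : ∀ x, Real.logb 2 (next x) = lev x / A := fun x =>
    Real.logb_rpow two_pos (by norm_num)
  have hpow : ∀ x, next x ^ A = 2 ^ lev x := fun x => by
    rw [← Real.rpow_mul zero_le_two, div_mul_cancel₀ _ hA0.ne', Real.rpow_natCast]
  have hlog0 : ∀ x, 1 ≤ x → 0 ≤ Real.logb 2 x := fun x hx => Real.logb_nonneg one_lt_two hx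
  have hup : ∀ x, 1 ≤ x → (A + 1) * Real.logb 2 (next x) ≤ Real.logb 2 x := by
    intro x hx
    have h1 : (lev x : ℝ) ≤ A / (A + 1) * Real.logb 2 x :=
      Nat.floor_le (mul_nonneg (by positivity) (hlog0 x hx))
    rw [hlogn]
    calc (A + 1) * (lev x / A) ≤ (A + 1) * (A / (A + 1) * Real.logb 2 x / A) := by gcongr
      _ = Real.logb 2 x := by field_simp
  have hlow : ∀ x, Real.logb 2 x - 2 ≤ (A + 1) * Real.logb 2 (next x) := by
    intro x
    have h1 : A / (A + 1) * Real.logb 2 x < lev x + 1 := Nat.lt_floor_add_one _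
    rw [hlogn]
    have h2 : Real.logb 2 x = (A + 1) * ((A / (A + 1) * Real.logb 2 x) / A) := by field_simp
    have h3 : (A + 1) * ((A / (A + 1) * Real.logb 2 x) / A) ≤ (A + 1) * ((lev x + 1) / A) := by
      gcongr
    have h4 : (A + 1) / A ≤ 2 := by
      rw [div_le_iff₀ hA0]
      linarith
    have h5 : (A + 1) * ((lev x + 1) / A) = (A + 1) * (lev x / A) + (A + 1) / A := by ring
    linarith
  have hnextpow : ∀ x, next x ^ (A + 1) = 2 ^ ((A + 1) * Real.logb 2 (next x)) := fun x => by
    rw [mul_comm, Real.rpow_mul zero_le_two, Real.rpow_logb two_pos (by norm_num)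
      (zero_lt_one.trans_le (hnext1 x))]
  let s : ℕ → ℝ := fun t => next^[t] K
  have hs : ∀ t, s (t + 1) = next (s t) := fun t => Function.iterate_succ_apply' _ _ _
  have hs1 : ∀ t, 1 ≤ s t := by
    intro t
    cases t with
    | zero => exact hK
    | succ t => rw [hs]; exact hnext1 _
  -- The loss 2 reproduces itself: two losses of 2 divided by A + 1 ≥ 2 are again at most 2.
  have hlower : ∀ t, Real.logb 2 K / (A + 1) ^ t - 2 ≤ Real.logb 2 (s t) := by
    intro t
    induction t with
    | zero => simp [s]
    | succ t ih =>
      have h1 := hlow (s t)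
      rw [← hs] at h1
      have h2 : Real.logb 2 K / (A + 1) ^ t = (A + 1) * (Real.logb 2 K / (A + 1) ^ (t + 1)) := by
        rw [pow_succ]
        field_simp
      rw [h2] at ih
      nlinarith
  refine ⟨fun j => s (D + 1 - j), fun j => lev (s (D - j)), by simp [s], fun j => hs1 _,
    fun j hj => ?_, fun j hj => ?_⟩
  · have hj' := Finset.mem_Icc.1 hj
    have h1 : D + 1 - j = (D - j) + 1 := by omega
    have h2 : D + 1 - (j + 1) = D - j := by omega
    simp only [h1, h2, hs]
    set x := s (D - j) with hx
    have hx1 : 1 ≤ x := hs1 _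
    have hx0 : 0 < x := zero_lt_one.trans_le hx1
    have hxlog : (2 : ℝ) ^ Real.logb 2 x = x := Real.rpow_logb two_pos (by norm_num) hx0
    have hle : next x ^ (A + 1) ≤ x := by
      rw [hnextpow]
      nth_rewrite 2 [← hxlog]
      exact Real.rpow_le_rpow_of_exponent_le one_le_two (hup x hx1)
    refine ⟨?_, ?_, hle, hpow x⟩
    · refine le_trans ?_ hle
      nth_rewrite 1 [← Real.rpow_one (next x)]
      exact Real.rpow_le_rpow_of_exponent_le (hnext1 x) (by linarith)
    · rw [hnextpow]
      nth_rewrite 1 [← hxlog]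
      rw [show (4 : ℝ) = 2 ^ (2 : ℝ) by norm_num, ← Real.rpow_add two_pos]
      exact Real.rpow_le_rpow_of_exponent_le one_le_two (by linarith [hlow x])
  · have hj' := Finset.mem_Icc.1 hj
    refine le_trans ?_ (hlower _)
    have h0 := hlog0 K hK
    gcongr
    · linarith
    · omega

end Scales

/-! ### Nonnegativity of the exponent -/

section LowerBound

variable {ι : Type} [Fintype ι] {n k : ℕ}

theorem exists_spectrumIn_closedBall (p : ℝ≥0∞) (hp : 1 ≤ p) (hp' : p ≠ ∞) {r : ℝ} (hr : 0 < r) :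
    ∃ g : Ambient ι n → ℂ, MemLp g p ∧ SpectrumIn g (Metric.closedBall 0 r) ∧
      lpPow p g ≠ 0 ∧ lpPow p g ≠ ∞ := by
  have hpos : 0 < p.toReal := ENNReal.toReal_pos (zero_lt_one.trans_le hp).ne' hp'
  let b : ContDiffBump (0 : Ambient ι n) := ⟨r / 2, r, by positivity, by linarith⟩
  have hcs : HasCompactSupport fun x : Ambient ι n => ((b x : ℝ) : ℂ) :=
    b.hasCompactSupport.comp_left Complex.ofReal_zero
  have hsm : ContDiff ℝ (⊤ : ℕ∞) fun x : Ambient ι n => ((b x : ℝ) : ℂ) :=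
    Complex.ofRealCLM.contDiff.comp b.contDiff
  let φ : 𝓢(Ambient ι n, ℂ) := hcs.toSchwartzMap hsm
  have hφ : ∀ x, φ x = ((b x : ℝ) : ℂ) := fun _ => rfl
  have hsupp : ∀ x, x ∉ Metric.closedBall (0 : Ambient ι n) r → φ x = 0 := fun x hx => by
    rw [hφ, b.zero_of_le_dist (not_le.1 hx).le, Complex.ofReal_zero]
  set γ : 𝓢(Ambient ι n, ℂ) := 𝓕⁻ φ with hγ
  have hγφ : 𝓕 γ = φ := FourierTransform.fourier_fourierInv_eq φ
  refine ⟨⇑γ, γ.memLp p _, fun ψ hψ => ?_, fun h0 => ?_, ?_⟩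
  · rw [SchwartzMap.integral_fourier_mul_eq, hγφ]
    refine integral_eq_zero_of_ae (Filter.Eventually.of_forall fun x => ?_)
    by_cases hx : x ∈ Metric.closedBall (0 : Ambient ι n) r
    · have : x ∉ tsupport ψ := fun h => Set.disjoint_left.1 hψ h hx
      simp [image_eq_zero_of_notMem_tsupport this]
    · simp [hsupp x hx]
  · have hae : ⇑γ =ᵐ[volume] 0 := by
      rw [lpPow, lintegral_eq_zero_iff'
        (γ.continuous.aestronglyMeasurable.enorm.pow_const _)] at h0
      filter_upwards [h0] with x hx
      simpa [hpos] using hx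
    have h1 : φ 0 = 0 := by
      rw [← hγφ, SchwartzMap.fourier_coe, Real.fourier_eq]
      refine integral_eq_zero_of_ae ?_
      filter_upwards [hae] with x hx
      simp [hx]
    rw [hφ, b.one_of_mem_closedBall (Metric.mem_closedBall_self b.rIn_pos.le)] at h1
    simp at h1
  · have h1 : MemLp (⇑γ) p (volume : Measure (Ambient ι n)) := γ.memLp p _
    exact (lintegral_rpow_enorm_lt_top_of_eLpNorm_lt_top (zero_lt_one.trans_le hp).ne' hp'
      h1.2).ne

/-- A single nonzero function, attached to the cube at the origin, already forces the constant to be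
at least 1. The box of that cube contains a ball about 0, so the inverse transform of a bump
function is admissible. -/
theorem one_le_of_decouplesPow [DecidableEq ι] {P : Fin n → QuadraticForm ℝ (ι → ℝ)} {C : ℝ} (hC : 0 < C)
    {p : ℝ≥0∞} (hp : 1 ≤ p) (hp' : p ≠ ∞) {M : ℝ}
    (h : DecouplesPow P C p (Finset.univ : Finset (DyadicCube ι k)) M) : 1 ≤ M := by
  have hpos : 0 < p.toReal := ENNReal.toReal_pos (zero_lt_one.trans_le hp).ne' hp'
  obtain ⟨g, hg, hgs, hg0, hgt⟩ := exists_spectrumIn_closedBall (ι := ι) (n := n) p hp hp'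
    (r := C * (1 / 2 ^ k) ^ 2) (by positivity)
  let θ₀ : DyadicCube ι k := fun _ => ⟨0, by positivity⟩
  have hcorner : corner θ₀ = 0 := by
    ext l
    simp [corner, θ₀]
  have hδ : (1 / 2 ^ k : ℝ) ^ 2 ≤ 1 / 2 ^ k := by
    refine pow_le_of_le_one (by positivity) ?_ two_ne_zero
    rw [div_le_one (by positivity)]
    exact one_le_pow₀ one_le_two
  have hbox : Metric.closedBall 0 (C * (1 / 2 ^ k) ^ 2) ⊆ uncertaintyBox P C θ₀ := by
    intro z hz
    rw [mem_closedBall_zero_iff] at hz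
    rw [mem_uncertaintyBox_iff, hcorner]
    refine ⟨fun i => ?_, fun j => ?_⟩
    · rw [Pi.zero_apply, sub_zero]
      exact (PiLp.norm_apply_le z _).trans (hz.trans (by gcongr))
    · have : QuadraticMap.polar (P j) 0 (fun i => z (Sum.inl i) - (0 : ι → ℝ) i) = 0 := by
        rw [QuadraticMap.polar, zero_add, QuadraticMap.map_zero, sub_zero, sub_self]
      rw [this, QuadraticMap.map_zero, sub_zero, sub_zero]
      exact (PiLp.norm_apply_le z _).trans hz
  let f : DyadicCube ι k → Ambient ι n → ℂ := fun θ => if θ = θ₀ then g else fun _ => 0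
  have hf0 : f θ₀ = g := if_pos rfl
  have hf1 : ∀ θ, θ ≠ θ₀ → f θ = fun _ => 0 := fun θ hθ => if_neg hθ
  have key := h f (fun θ _ => ?_) fun θ _ => ?_
  · have h1 : (fun x => ∑ θ, f θ x) = g := by
      funext x
      rw [Finset.sum_eq_single θ₀ (fun θ _ hθ => by rw [hf1 θ hθ]) (by simp), hf0]
    have h2 : ∑ θ, lpPow p (f θ) = lpPow p g := by
      rw [Finset.sum_eq_single θ₀ (fun θ _ hθ => by rw [hf1 θ hθ]; simp [lpPow, hpos]) (by simp),
        hf0]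
    rw [h1, h2] at key
    by_contra! hM
    have h3 : ENNReal.ofReal M ^ p.toReal < 1 :=
      ENNReal.rpow_lt_one (by rwa [ENNReal.ofReal_lt_one]) hpos
    have h4 := ENNReal.mul_lt_mul_left hg0 hgt h3
    rw [one_mul] at h4
    exact absurd key (not_le.2 h4)
  · by_cases hθ : θ = θ₀
    · rw [hθ, hf0]
      exact hg
    · rw [hf1 θ hθ]
      exact MemLp.zero
  · by_cases hθ : θ = θ₀
    · rw [hθ, hf0]
      exact hgs.mono hbox
    · rw [hf1 θ hθ]
      exact spectrumIn_zero _

variable [DecidableEq ι]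

/-- The infimum in `decConst` is attained, so the decoupling constant is itself admissible.
Enlarging `B` to at least 1 keeps powers of the constant monotone. -/
theorem LowerDimDecoupling.decouplesPow {P : Fin n → QuadraticForm ℝ (ι → ℝ)} {C : ℝ}
    {p : ℝ≥0∞} [Fact (1 ≤ p)] (hp' : p ≠ ∞) {Λ : ℝ} (h : LowerDimDecoupling P C p Λ) :
    ∃ B : ℝ, 1 ≤ B ∧ ∀ (i : ι) (b : {l : ι // l ≠ i} → ℝ), (∀ l, |b l| ≤ 1) → ∀ e : ℕ,
      DecouplesPow (fun j => (P j).comp (graphMap i b)) C p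
        (Finset.univ : Finset (DyadicCube {l : ι // l ≠ i} e)) (B * ((2 : ℝ) ^ e) ^ Λ) := by
  obtain ⟨B, hB⟩ := h
  refine ⟨max B 1, le_max_right _ _, fun i b hb e => ?_⟩
  obtain ⟨⟨h0, h1⟩, -⟩ := isLeast_decConst (fun j => (P j).comp (graphMap i b)) C p hp' e
  refine (decouplesPow_of_decouples hp' h0 h1).mono_const ((hB i b hb e).trans ?_)
  rw [one_div, Real.inv_rpow (by positivity), Real.rpow_neg (by positivity), inv_inv]
  gcongr
  exact le_max_left _ _

/-- Decoupling constants are at least 1 at every scale, whereas B δ^{-Λ} would tend to 0 with δ if Λ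
were negative. Nonnegativity allows (2^e)^Λ to be enlarged with e in the iteration. -/
theorem LowerDimDecoupling.nonneg [Nonempty ι] {P : Fin n → QuadraticForm ℝ (ι → ℝ)} {C : ℝ}
    (hC : 0 < C) {p : ℝ≥0∞} [hp : Fact (1 ≤ p)] (hp' : p ≠ ∞) {Λ : ℝ}
    (h : LowerDimDecoupling P C p Λ) : 0 ≤ Λ := by
  obtain ⟨B, hB1, hB⟩ := h.decouplesPow hp'
  have i : ι := Classical.arbitrary ι
  have hone : ∀ e : ℕ, 1 ≤ B * ((2 : ℝ) ^ e) ^ Λ := fun e =>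
    one_le_of_decouplesPow hC hp.out hp' (hB i 0 (by simp) e)
  by_contra! hΛ
  have hlim : Filter.Tendsto (fun e : ℕ => B * ((2 : ℝ) ^ e) ^ Λ) Filter.atTop (nhds (B * 0)) := by
    refine Filter.Tendsto.const_mul B ?_
    have h1 := tendsto_rpow_neg_atTop (neg_pos.2 hΛ)
    rw [neg_neg] at h1
    exact h1.comp (tendsto_pow_atTop_atTop_of_one_lt one_lt_two)
  have h2 := ge_of_tendsto' hlim hone
  norm_num at h2

end LowerBound

/-! ### Assembly of the scales, the theorem and the corollary -/

/-- The decoupling inequality over the cubes near the zero set of a polynomial, at all scales. -/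
theorem exists_disjointCover_decouples {d n : ℕ} (hd : 0 < d)
    {P : Fin n → QuadraticForm ℝ (Fin d → ℝ)} {B C : ℝ} (hB : FormBound P B)
    (hC : 2 + 8 * B * (Fintype.card (Fin d) + 1) ^ 2 ≤ C) (p : ℝ≥0∞) [hp : Fact (1 ≤ p)]
    (hp' : p ≠ ∞) {Λ : ℝ} (hΛ : LowerDimDecoupling P C p Λ) (D : ℕ) :
    ∃ M : ℝ → ℝ, (∀ ε, 0 ≤ M ε) ∧ ∀ A : ℝ, 1 < A → ∀ K : ℝ, 1 ≤ K → ∀ (κ : ℕ → ℝ) (k : ℕ → ℕ),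
      κ (D + 1) = K → (∀ j, 1 ≤ κ j) →
      (∀ j ∈ Finset.Icc 1 D, κ j ≤ κ (j + 1) ∧ κ j ^ (A + 1) ≤ κ (j + 1) ∧ κ j ^ A = 2 ^ k j) →
      ∀ Q : MvPolynomial (Fin d) ℝ, Q ≠ 0 → Q.totalDegree ≤ D →
        ∃ G : (j : ℕ) → Finset (DyadicCube (Fin d) (k j)), DisjointCover Q K D k G ∧
          ∀ ε : ℝ, 0 < ε → ∀ j ∈ Finset.Icc 1 D,
            Decouples P C p (G j) (M ε * (κ j ^ d * (κ j ^ (A - 1)) ^ (Λ + ε))) := by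
  classical
  have : Nonempty (Fin d) := ⟨⟨0, hd⟩⟩
  have hC0 : 0 < C := lt_of_lt_of_le (by have := hB.1; positivity) hC
  have hΛ0 := hΛ.nonneg hC0 hp'
  obtain ⟨B', hB', hdec⟩ := hΛ.decouplesPow hp'
  have hlevel := fun (ε : ℝ) (hε : 0 < ε) =>
    exists_decouplesPow_of_nearRegularZero hd hB hC hp.out hp' hΛ0 hB' hdec D hε
  choose! M₀ hM₀ hM using hlevel
  -- The factor bounds the number of polynomials in each generation; the added 1 makes the base at
  -- least 1, so the exponent D serves all of them. The value 0 for ε ≤ 0 only keeps the constant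
  -- nonnegative.
  refine ⟨fun ε => if 0 < ε then (d + d * d + 1 : ℕ) ^ D * M₀ ε else 0, fun ε => ?_, ?_⟩
  · dsimp only
    split_ifs with hε
    · exact mul_nonneg (by positivity) (hM₀ ε hε)
    · exact le_rfl
  intro A hA K hK κ k hκK hκ1 hκ Q hQ hQD
  have hA0 : 0 < A := by linarith
  have hmono : ∀ i j : ℕ, 1 ≤ i → i ≤ j → j ≤ D → κ i ≤ κ j := by
    intro i j hi hij hj
    induction j, hij using Nat.le_induction with
    | base => exact le_rfl
    | succ j hij ih =>
      exact (ih (by omega)).trans (hκ j (Finset.mem_Icc.2 ⟨by omega, by omega⟩)).1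
  have hk : ∀ i j : ℕ, 1 ≤ i → i ≤ j → j ≤ D → k i ≤ k j := by
    intro i j hi hij hj
    have h1 : (2 : ℝ) ^ k i ≤ 2 ^ k j := by
      rw [← (hκ i (Finset.mem_Icc.2 ⟨hi, by omega⟩)).2.2,
        ← (hκ j (Finset.mem_Icc.2 ⟨by omega, hj⟩)).2.2]
      exact Real.rpow_le_rpow (zero_le_one.trans (hκ1 i)) (hmono i j hi hij hj) hA0.le
    exact (pow_le_pow_iff_right₀ one_lt_two).1 h1
  obtain ⟨G, hG, hG'⟩ := exists_disjointCover hQ hQD κ k hk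
  rw [hκK] at hG
  refine ⟨G, hG, fun ε hε j hj => ?_⟩
  have hj' := Finset.mem_Icc.1 hj
  obtain ⟨-, h2, h3⟩ := hκ j hj
  have hκj := hκ1 j
  have hκj0 : 0 < κ j := zero_lt_one.trans_le hκj
  have hpow : 2 ^ k j / κ j = κ j ^ (A - 1) := by
    rw [← h3, Real.rpow_sub_one hκj0.ne']
  have hX0 : 0 ≤ κ j ^ d * (κ j ^ (A - 1)) ^ (Λ + ε) := by positivity
  simp only [if_pos hε]
  refine decouples_of_decouplesPow hp' (by have := hM₀ ε hε; positivity) ?_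
  -- The cubes of one scale are grouped by the polynomial near whose regular zeros they lie.
  have hcov := DecouplesPow.of_cover (P := P) (C := C) hp.out hp'
    (iterDerivFamily Q (D - j))
    (fun q => (G j).filter fun θ => NearRegularZero q (κ (j + 1)) (κ j) θ) (G := G j)
    (M := M₀ ε * (κ j ^ d * (2 ^ k j / κ j) ^ (Λ + ε))) (fun θ hθ => ?_) fun q hq => ?_
  · refine hcov.mono_const ?_
    rw [hpow, ← mul_assoc]
    have hcard : ((iterDerivFamily Q (D - j)).card : ℝ) ≤ ((d + d * d + 1 : ℕ) : ℝ) ^ D := by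
      have h4 : (iterDerivFamily Q (D - j)).card ≤ (d + d * d + 1) ^ D :=
        (card_iterDerivFamily_le Q _).trans
          ((Nat.pow_le_pow_left (Nat.le_succ _) _).trans
            (Nat.pow_le_pow_right (Nat.succ_pos _) (Nat.sub_le _ _)))
      exact_mod_cast h4
    have := hM₀ ε hε
    gcongr
  · obtain ⟨q, hq, hθq⟩ := hG' j θ hθ
    exact ⟨q, hq, Finset.mem_filter.2 ⟨hθ, hθq⟩⟩
  · obtain ⟨h4, h5⟩ := mem_iterDerivFamily hQ hQD _ q hq
    refine hM ε hε q (κ (j + 1)) (κ j) (k j) _ h4 (h5.trans (Nat.sub_le _ _)) hκj ?_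
      (zero_lt_one.trans_le (hκ1 _)) ?_ fun θ hθ => (Finset.mem_filter.1 hθ).2
    · rw [← h3]
      exact Real.self_le_rpow_of_one_le hκj hA.le
    · rw [div_div, ← h3, ← Real.rpow_add_one hκj0.ne']
      gcongr

end QuadDecoupling

end

theorem mainTheorem7 (d n : ℕ) (hn : 1 ≤ n) (hnd : n ≤ d) :
    ∃ (b : ℕ → ℝ) (c : ℕ → ℝ → ℝ),
      (∀ (D : ℕ) (ε : ℝ), 1 ≤ D → 0 < ε → 0 < c D ε) ∧
      ∀ P : Fin n → QuadraticForm ℝ (Fin d → ℝ),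
      ∃ C₀ : ℝ, ∀ C : ℝ, C₀ ≤ C →
      ∀ (p : ℝ≥0∞) [Fact (1 ≤ p)], p ≠ ∞ →
      ∀ Λ : ℝ, QuadDecoupling.LowerDimDecoupling P C p Λ →
      (∀ D : ℕ, 1 ≤ D → ∃ M : ℝ → ℝ, ∀ A : ℝ, 1 < A → ∃ K₀ : ℝ, ∀ K : ℝ, K₀ ≤ K →
        ∃ (κ : ℕ → ℝ) (k : ℕ → ℕ),
          κ (D + 1) = K ∧
          (∀ j ∈ Finset.Icc 1 D,
            1 ≤ κ j ∧ κ j ≤ κ (j + 1) ∧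
            κ (j + 1) ≤ b j * κ j ^ (A + 1) ∧ κ j ^ (A + 1) ≤ b j * κ (j + 1) ∧
            κ j ^ A = 2 ^ k j) ∧
          ∀ Q : MvPolynomial (Fin d) ℝ, Q ≠ 0 → Q.totalDegree ≤ D →
          ∃ G : (j : ℕ) → Finset (QuadDecoupling.DyadicCube (Fin d) (k j)),
            QuadDecoupling.DisjointCover Q K D k G ∧
            ∀ ε : ℝ, 0 < ε → ∀ j ∈ Finset.Icc 1 D,
              QuadDecoupling.Decouples P C p (G j)
                (M ε * (κ j ^ d * (κ j ^ (A - 1)) ^ (Λ + ε)))) ∧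
      (∀ (D : ℕ) (ε : ℝ), 1 ≤ D → 0 < ε → ∃ M K₀ : ℝ, ∀ K : ℝ, K₀ ≤ K →
        ∃ k : ℕ → ℕ,
          (∀ j ∈ Finset.Icc 1 D, K ^ c D ε ≤ 2 ^ k j ∧ 2 ^ k j ≤ √K) ∧
          (∀ j j' : ℕ, 1 ≤ j → j ≤ j' → j' ≤ D → (2 : ℝ) ^ k j ≤ 2 ^ k j') ∧
          ∀ Q : MvPolynomial (Fin d) ℝ, Q ≠ 0 → Q.totalDegree ≤ D →
          ∃ G : (j : ℕ) → Finset (QuadDecoupling.DyadicCube (Fin d) (k j)),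
            QuadDecoupling.DisjointCover Q K D k G ∧
            ∀ j ∈ Finset.Icc 1 D,
              QuadDecoupling.Decouples P C p (G j) (M * (2 ^ k j : ℝ) ^ (Λ + ε))) := by
  have hd : 0 < d := by omega
  -- The 4 is the rounding factor of the scales. The exponent c is 1/(4(A+1)^D) for the A = 2d/ε + 2
  -- used in the corollary.
  refine ⟨fun _ => 4, fun D ε => ((2 * d / ε + 3) ^ D)⁻¹ / 4, fun D ε _ hε => by positivity,
    fun P => ?_⟩
  obtain ⟨B, hB⟩ := QuadDecoupling.exists_formBound P
  refine ⟨2 + 8 * B * (Fintype.card (Fin d) + 1) ^ 2, fun C hC p hp hp' Λ hΛ =>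
    ⟨fun D _ => ?_, fun D ε _ hε => ?_⟩⟩
  · obtain ⟨M, -, hM⟩ :=
      QuadDecoupling.exists_disjointCover_decouples hd hB hC p hp' hΛ D
    refine ⟨M, fun A hA => ⟨1, fun K hK => ?_⟩⟩
    obtain ⟨κ, k, h1, h2, h3, -⟩ := QuadDecoupling.exists_scales hA hK D
    refine ⟨κ, k, h1, fun j hj => ?_, ?_⟩
    · obtain ⟨h4, h5, h6, h7⟩ := h3 j hj
      exact ⟨h2 j, h4, h5, h6.trans (by linarith [h2 (j + 1)]), h7⟩
    · exact hM A hA K hK κ k h1 h2 fun j hj =>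
        ⟨(h3 j hj).1, (h3 j hj).2.2.1, (h3 j hj).2.2.2⟩
  · have : Nonempty (Fin d) := ⟨⟨0, hd⟩⟩
    have hC0 : 0 < C := lt_of_lt_of_le (by have := hB.1; positivity) hC
    have hΛ0 : 0 ≤ Λ := hΛ.nonneg hC0 hp'
    obtain ⟨M, hM0, hM⟩ :=
      QuadDecoupling.exists_disjointCover_decouples hd hB hC p hp' hΛ D
    -- Since 2d ≤ Aε, the loss κ_j^d is at most (κ_j^A)^{ε/2}; the theorem is used with ε/2.
    set A : ℝ := 2 * d / ε + 2 with hA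
    have hA2 : 2 ≤ A := by
      rw [hA]
      have : 0 ≤ 2 * d / ε := by positivity
      linarith
    have hA1 : 1 < A := by linarith
    have hAε : 2 * d ≤ A * ε := by
      rw [hA, add_mul, div_mul_cancel₀ _ hε.ne']
      linarith
    have hA3 : (2 * d / ε + 3 : ℝ) = A + 1 := by rw [hA]; ring
    -- For such K the quotient log₂K/(A+1)^D is at least 8, so half of it minus the rounding loss 2
    -- is still at least a quarter of it.
    refine ⟨M (ε / 2), 2 ^ (8 * (A + 1) ^ D), fun K hK => ?_⟩
    have hK1 : 1 ≤ K := (Real.one_le_rpow one_le_two (by positivity)).trans hK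
    have hK0 : 0 < K := zero_lt_one.trans_le hK1
    have hlogK : 8 * (A + 1) ^ D ≤ Real.logb 2 K :=
      (Real.le_logb_iff_rpow_le one_lt_two hK0).2 hK
    have hsq1 : 1 ≤ √K := Real.one_le_sqrt.2 hK1
    have hsqK : √K ≤ K := Real.sqrt_le_iff.2 ⟨hK0.le, by nlinarith⟩
    have hlogsq : Real.logb 2 √K = Real.logb 2 K / 2 := by
      rw [Real.sqrt_eq_rpow, Real.logb_rpow_eq_mul_logb_of_pos hK0]
      ring
    -- Starting the scales at √K gives κ_j^A ≤ κ_j^{A+1} ≤ κ_{j+1} ≤ √K, and covering the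
    -- 1/√K-neighbourhood also covers the smaller 1/K-neighbourhood.
    obtain ⟨κ, k, h1, h2, h3, h4⟩ := QuadDecoupling.exists_scales hA1 hsq1 D
    have hmono : ∀ i j : ℕ, 1 ≤ i → i ≤ j → j ≤ D + 1 → κ i ≤ κ j := by
      intro i j hi hij hj
      induction j, hij using Nat.le_induction with
      | base => exact le_rfl
      | succ j hij ih =>
        exact (ih (by omega)).trans (h3 j (Finset.mem_Icc.2 ⟨by omega, by omega⟩)).1
    have hκA : ∀ j ∈ Finset.Icc 1 D, κ j ^ A = 2 ^ k j := fun j hj => (h3 j hj).2.2.2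
    refine ⟨k, fun j hj => ⟨?_, ?_⟩, fun j j' hj hjj' hj' => ?_, fun Q hQ hQD => ?_⟩
    · dsimp only
      rw [← hκA j hj, hA3]
      have h5 := h4 j hj
      rw [hlogsq] at h5
      have hT : 0 < (A + 1) ^ D := by positivity
      have h6 : 8 ≤ Real.logb 2 K / (A + 1) ^ D := (le_div_iff₀ hT).2 hlogK
      have h7 : Real.logb 2 K / 2 / (A + 1) ^ D = Real.logb 2 K / (A + 1) ^ D / 2 := by ring
      rw [h7] at h5
      have h8 : Real.logb 2 K / (A + 1) ^ D / 4 ≤ Real.logb 2 (κ j) := by linarith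
      have h9 : K ^ (((A + 1) ^ D)⁻¹ / 4) ≤ κ j := by
        rw [← Real.logb_le_logb one_lt_two (by positivity) (zero_lt_one.trans_le (h2 j)),
          Real.logb_rpow_eq_mul_logb_of_pos hK0]
        refine le_trans (le_of_eq ?_) h8
        ring
      exact h9.trans (Real.self_le_rpow_of_one_le (h2 j) hA1.le)
    · have hj' := Finset.mem_Icc.1 hj
      rw [← hκA j hj, ← h1]
      calc κ j ^ A ≤ κ j ^ (A + 1) :=
            Real.rpow_le_rpow_of_exponent_le (h2 j) (by linarith)
        _ ≤ κ (j + 1) := (h3 j hj).2.2.1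
        _ ≤ κ (D + 1) := hmono _ _ (by omega) (by omega) le_rfl
    · rw [← hκA j (Finset.mem_Icc.2 ⟨hj, by omega⟩), ← hκA j' (Finset.mem_Icc.2 ⟨by omega, hj'⟩)]
      exact Real.rpow_le_rpow (zero_le_one.trans (h2 j)) (hmono j j' hj hjj' (by omega))
        (by linarith)
    · obtain ⟨G, hG, hGdec⟩ := hM A hA1 √K hsq1 κ k h1 h2 (fun j hj =>
        ⟨(h3 j hj).1, (h3 j hj).2.2.1, (h3 j hj).2.2.2⟩) Q hQ hQD
      refine ⟨G, ⟨hG.1, (Set.inter_subset_inter_left _ ?_).trans hG.2⟩, fun j hj => ?_⟩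
      · refine Metric.thickening_mono ?_ _
        gcongr
      · refine fun f hf => (hGdec (ε / 2) (by positivity) j hj f hf).trans ?_
        have hκ0 : 0 < κ j := zero_lt_one.trans_le (h2 j)
        have h5 : κ j ^ d * (κ j ^ (A - 1)) ^ (Λ + ε / 2) ≤ (2 ^ k j : ℝ) ^ (Λ + ε) := by
          rw [← hκA j hj, ← Real.rpow_natCast, ← Real.rpow_mul hκ0.le, ← Real.rpow_mul hκ0.le,
            ← Real.rpow_add hκ0]
          refine Real.rpow_le_rpow_of_exponent_le (h2 j) ?_
          -- The exponents satisfy d + (A - 1)(Λ + ε/2) ≤ A(Λ + ε), from d ≤ Aε/2 and Λ ≥ 0.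
          nlinarith
        have h6 := hM0 (ε / 2)
        gcongr
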